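/- Let $k$ be a finite field with $q$ elements, $\overline{k}$ an algebraic closure, $L=\overline{k}((t))$, and let $\sigma$ be the Frobenius $\sum\alpha_it^i\mapsto\sum\alpha_i^qt^i$ of $L$. Let $m,h$ be coprime positive integers and let $\mu=(\mu_1\le\dots\le\mu_h)\in\mathbb{N}^h$ with $\sum_i\mu_i=m$. Let $N=L^h$ with standard basis $e_0,\dots,e_{h-1}$, put $e_{i+h}=te_i$ for $i\in\mathbb{Z}$, and let $b$ be the $L$-linear map with $b(e_i)=e_{i+m}$ for all $i$. Let $X$ be the affine Grassmannian of $GL_h$ over $\overline{k}$, so that $X(\overline{k})$ is the set of lattices $M\subset N$. A *normalized semi-module* for $m,h$ is a subset $A\subset\mathbb{Z}$ that is bounded below, satisfies $m+A\subset A$ and $h+A\subset A$, and for which the sum of the elements of $A\setminus(h+A)$ is $h(h-1)/2$. An *extended semi-module* $(A,\varphi)$ for $\mu$ is a normalized semi-module $A$ for $m,h$ with a function $\varphi:\mathbb{Z}\to\mathbb{N}\cup\{-\infty\}$ such that 1. $\varphi(a)=-\infty$ if and only if $a\notin A$; 2. $\varphi(a+h)\ge\varphi(a)+1$ for all $a$;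 3. $\varphi(a)\le\max\{n\mid a+m-nh\in A\}$ for all $a\in A$, with equality if $c\in A$ for all $c\ge a$; 4. $A$ is the disjoint union of $h$ sequences $(a^l_j)_{j\in\mathbb{N}}$, $l=1,\dots,h$, such that $\varphi(a^l_{j+1})=\varphi(a^l_j)+1$; $a^l_{j+1}=a^l_j+h$ if $\varphi(a^l_j+h)=\varphi(a^l_j)+1$, and $a^l_{j+1}>a^l_j+h$ otherwise; and $(\varphi(a^l_0))_l$ is a permutation of $\mu$. It is *cyclic* if equality holds in 3 for all $a\in A$. For $0\neq v=\sum_i\alpha_ie_i\in N$ let $I(v)=\min\{i\mid\alpha_i\ne0\}$. For a lattice $M\subset N$ let $A(M)=\{I(v)\mid 0\ne v\in M\}$, and let $\varphi(M)(a)$ be the maximum of the $n\in\mathbb{N}$ for which there is a $v\in M$ with $I(v)=a$ and $t^{-n}b\sigma(v)\in M$, or $-\infty$ if there is no such $n$. For an extended semi-module $(A,\varphi)$ for $\mu$ let $$\mathcal{S}_{A,\varphi}=\{M\subset N\text{ lattice}\mid A(M)=A,\ \varphi(M)=\varphi\}\subset X(\overline{k}),$$ $$\mathcal{V}(A,\varphi)=\{(a,b)\in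 A\times A\mid b>a,\ \varphi(a)>\varphi(b)>\varphi(a-h)\}.$$ **Theorem.** Let $(A,\varphi)$ be an extended semi-module for $\mu$. Then $\mathcal{V}(A,\varphi)$ is finite and $\mathcal{S}_{A,\varphi}$ is locally closed in $X$; regard it as a reduced locally closed subscheme. There exist a nonempty open subscheme $U(A,\varphi)\subseteq\mathbb{A}^{\mathcal{V}(A,\varphi)}$ of affine space over $\overline{k}$ and a morphism $U(A,\varphi)\to\mathcal{S}_{A,\varphi}$ over $\overline{k}$ that induces a bijection between the $\overline{k}$-valued points of $U(A,\varphi)$ and $\mathcal{S}_{A,\varphi}$, where moreover $U(A,\varphi)=\mathbb{A}^{\mathcal{V}(A,\varphi)}$ if $(A,\varphi)$ is cyclic. In particular, $\dim\mathcal{S}_{A,\varphi}=|\mathcal{V}(A,\varphi)|$. -/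

import Mathlib

open CategoryTheory AlgebraicGeometry

universe u v

namespace SemiModuleStrata

/-! ### Lattices and the affine Grassmannian of `GL_h` -/

section Lattices

variable {R : Type*} {R' : Type*} [CommRing R] [CommRing R']

theorem laurentMap_mul (g : R →+* R') (x y : LaurentSeries R) :
    HahnSeries.map (x * y) g = HahnSeries.map x g * HahnSeries.map y g := by
  classical
  ext a
  have hx : (HahnSeries.map x g).support ⊆ x.support := by
    intro i hi hx
    exact hi (by simp [hx])
  have hy : (HahnSeries.map y g).support ⊆ y.support := by
    intro i hi hx
    exact hi (by simp [hx])
  rw [HahnSeries.map_coeff, HahnSeries.coeff_mul, map_sum, HahnSeries.coeff_mul]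
  symm
  apply Finset.sum_subset_zero_on_sdiff
  · intro p hp
    rw [Finset.mem_antidiagonal] at hp ⊢
    exact ⟨hx hp.1, hy hp.2.1, hp.2.2⟩
  · intro p hp
    rw [Finset.mem_sdiff, Finset.mem_antidiagonal, Finset.mem_antidiagonal] at hp
    rw [map_mul]
    by_contra hne
    refine hp.2 ⟨?_, ?_, hp.1.2.2⟩
    · intro h0
      exact hne (by rw [HahnSeries.map_coeff] at h0; rw [h0, zero_mul])
    · intro h0
      exact hne (by rw [HahnSeries.map_coeff] at h0; rw [h0, mul_zero])
  · intro p _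
    simp

/-- The ring homomorphism `R((t)) → R'((t))` that applies `g : R → R'` to all coefficients. -/
noncomputable def laurentMap (g : R →+* R') : LaurentSeries R →+* LaurentSeries R' where
  toFun x := HahnSeries.map x g
  map_one' := by
    ext a
    by_cases h : a = 0 <;> simp [HahnSeries.coeff_one, h]
  map_mul' := laurentMap_mul g
  map_zero' := by ext; simp
  map_add' x y := by ext; simp

theorem laurentMap_algebraMap (g : R →+* R') (a : PowerSeries R) :
    laurentMap g (algebraMap (PowerSeries R) (LaurentSeries R) a) =
      algebraMap (PowerSeries R') (LaurentSeries R') (PowerSeries.map g a) := by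
  ext i
  simp only [laurentMap, RingHom.coe_mk, MonoidHom.coe_mk, OneHom.coe_mk, HahnSeries.map_coeff,
    LaurentSeries.coe_algebraMap]
  rw [PowerSeries.coeff_coe, PowerSeries.coeff_coe]
  split_ifs <;> simp

variable {h : ℕ}

/-- `Λ` is a lattice in `R((t))^h`: a finitely generated projective `R[[t]]`-submodule that
generates `R((t))^h` over `R((t))`. Over a field `R` these are the usual lattices, i.e. the free
`R[[t]]`-submodules spanned by a basis of `R((t))^h`. -/
structure IsLattice (Λ : Submodule (PowerSeries R) (Fin h → LaurentSeries R)) : Prop where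
  finite : Module.Finite (PowerSeries R) Λ
  projective : Module.Projective (PowerSeries R) Λ
  span_eq_top : Submodule.span (LaurentSeries R) (Λ : Set (Fin h → LaurentSeries R)) = ⊤

theorem exists_pow_smul_mem {Λ : Submodule (PowerSeries R) (Fin h → LaurentSeries R)}
    (hΛ : Submodule.span (LaurentSeries R) (Λ : Set (Fin h → LaurentSeries R)) = ⊤)
    (v : Fin h → LaurentSeries R) : ∃ n : ℕ, (PowerSeries.X ^ n : PowerSeries R) • v ∈ Λ := by
  have hv : v ∈ Submodule.span (LaurentSeries R) (Λ : Set (Fin h → LaurentSeries R)) := by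
    rw [hΛ]; trivial
  induction hv using Submodule.span_induction with
  | mem x hx => exact ⟨0, by simpa using hx⟩
  | zero => exact ⟨0, by simp⟩
  | add x y _ _ hx hy =>
    obtain ⟨n, hn⟩ := hx
    obtain ⟨k, hk⟩ := hy
    refine ⟨n + k, ?_⟩
    rw [smul_add]
    refine Λ.add_mem ?_ ?_
    · rw [add_comm n k, pow_add, mul_smul]; exact Λ.smul_mem _ hn
    · rw [pow_add, mul_smul]; exact Λ.smul_mem _ hk
  | smul c x _ hx =>
    obtain ⟨n, hn⟩ := hx
    obtain ⟨⟨a, s⟩, hs⟩ :=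
      IsLocalization.surj (Submonoid.powers (PowerSeries.X : PowerSeries R)) c
    obtain ⟨k, hk⟩ := s.2
    refine ⟨k + n, ?_⟩
    have hk' : (PowerSeries.X ^ k : PowerSeries R) = s.1 := hk
    have : (PowerSeries.X ^ (k + n) : PowerSeries R) • c • x
        = a • (PowerSeries.X ^ n : PowerSeries R) • x := by
      rw [pow_add, hk', mul_smul, smul_comm _ c x,
        ← algebraMap_smul (LaurentSeries R) (s.1 : PowerSeries R), smul_smul, mul_comm, hs,
        algebraMap_smul]
    rw [this]
    exact Λ.smul_mem _ hn

theorem IsLattice.exists_dual {Λ : Submodule (PowerSeries R) (Fin h → LaurentSeries R)}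
    (hΛ : IsLattice Λ) : ∃ (k : ℕ) (p w : Fin k → Fin h → LaurentSeries R),
      Submodule.span (PowerSeries R) (Set.range p) = Λ ∧
      (∀ r s, ∑ i, w i s * p i r = if r = s then 1 else 0) ∧
      ∀ i j, ∃ a : PowerSeries R, w i ⬝ᵥ p j = algebraMap _ _ a := by
  classical
  have := hΛ.finite
  have := hΛ.projective
  obtain ⟨k, f, g, hf, -, hfg⟩ :=
    Module.Finite.exists_comp_eq_id_of_projective (PowerSeries R) Λ
  let T : LaurentSeries R := algebraMap (PowerSeries R) _ PowerSeries.X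
  have hT : IsUnit T :=
    IsLocalization.map_units (LaurentSeries R)
      (⟨PowerSeries.X, Submonoid.mem_powers _⟩ :
        Submonoid.powers (PowerSeries.X : PowerSeries R))
  have hTs : ∀ (n : ℕ) (x : Fin h → LaurentSeries R),
      (PowerSeries.X ^ n : PowerSeries R) • x = T ^ n • x := by
    intro n x
    rw [← algebraMap_smul (LaurentSeries R) (PowerSeries.X ^ n : PowerSeries R), map_pow]
  choose n hn using fun r : Fin h => exists_pow_smul_mem hΛ.span_eq_top (Pi.single r 1)
  let U := hT.unit
  let w : Fin k → Fin h → LaurentSeries R := fun i r =>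
    ((U⁻¹ ^ n r : (LaurentSeries R)ˣ) : LaurentSeries R) * algebraMap _ _ (g ⟨_, hn r⟩ i)
  have hw : ∀ i (v : Λ), w i ⬝ᵥ (v : Fin h → LaurentSeries R) = algebraMap _ _ (g v i) := by
    intro i v
    -- clear denominators
    obtain ⟨b, hb⟩ := IsLocalization.exist_integer_multiples_of_finite
      (Submonoid.powers (PowerSeries.X : PowerSeries R))
      (fun r => ((U⁻¹ ^ n r : (LaurentSeries R)ˣ) : LaurentSeries R) * (v : Fin h → _) r)
    choose c hc using hb
    have key : (b : PowerSeries R) • v = ∑ r, c r • (⟨_, hn r⟩ : Λ) := by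
      ext1
      rw [Submodule.coe_smul, Submodule.coe_sum]
      funext s
      simp only [Submodule.coe_smul, Finset.sum_apply, Pi.smul_apply, hTs]
      rw [Finset.sum_eq_single s]
      · simp only [Pi.single_eq_same, smul_eq_mul, mul_one]
        rw [Algebra.smul_def (c s), hc s, Algebra.smul_def, Algebra.smul_def]
        have : ((U⁻¹ ^ n s : (LaurentSeries R)ˣ) : LaurentSeries R) * T ^ n s = 1 := by
          have h1 : T ^ n s = ((U ^ n s : (LaurentSeries R)ˣ) : LaurentSeries R) := by simp [U]
          rw [h1, ← Units.val_mul]; simp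
        linear_combination
          (-(algebraMap _ _ (b : PowerSeries R)) * (v : Fin h → LaurentSeries R) s) * this
      · intro r _ hr
        simp [hr.symm]
      · simp
    have hbu : IsUnit (algebraMap (PowerSeries R) (LaurentSeries R) b) :=
      IsLocalization.map_units (LaurentSeries R) b
    apply hbu.mul_left_cancel
    have hg : (b : PowerSeries R) * g v i = ∑ r, c r * g ⟨_, hn r⟩ i := by
      have := congrArg (fun z => g z i) key
      simp only [map_smul, map_sum, Finset.sum_apply, Pi.smul_apply, smul_eq_mul] at this
      exact this
    rw [← map_mul, hg, map_sum, dotProduct, Finset.mul_sum]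
    refine Finset.sum_congr rfl fun r _ => ?_
    rw [map_mul, hc r, Algebra.smul_def]
    simp only [w]
    ring
  let p : Fin k → Fin h → LaurentSeries R := fun i => (f (Pi.single i 1) : Λ)
  have hfp : ∀ x, ((f x : Λ) : Fin h → LaurentSeries R) = ∑ i, x i • p i := by
    intro x
    conv_lhs => rw [← Finset.univ_sum_single x]
    rw [map_sum, Submodule.coe_sum]
    refine Finset.sum_congr rfl fun i _ => ?_
    have : Pi.single i (x i) = x i • (Pi.single i (1 : PowerSeries R) : Fin k → _) := by
      rw [← Pi.single_smul]; simp
    rw [this, map_smul]; rfl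
  refine ⟨k, p, w, ?_, ?_, ?_⟩
  · apply le_antisymm
    · rw [Submodule.span_le]
      rintro _ ⟨i, rfl⟩
      exact (f _).2
    · intro v hv
      obtain ⟨x, hx⟩ := hf ⟨v, hv⟩
      have : v = ∑ i, x i • p i := by rw [← hfp, hx]
      rw [this]
      exact Submodule.sum_mem _ fun i _ =>
        Submodule.smul_mem _ _ (Submodule.subset_span ⟨i, rfl⟩)
  · let G : (Fin h → LaurentSeries R) →ₗ[LaurentSeries R] (Fin h → LaurentSeries R) :=
      Matrix.mulVecLin (Matrix.of fun r s => ∑ i, w i s * p i r)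
    have hG : G = LinearMap.id := by
      refine LinearMap.ext_on hΛ.span_eq_top fun v hv => ?_
      have h1 : v = ∑ i, (g ⟨v, hv⟩ i) • p i := by
        rw [← hfp]
        exact congrArg Subtype.val (LinearMap.congr_fun hfg ⟨v, hv⟩).symm
      funext r
      have h2 := congrFun h1 r
      rw [LinearMap.id_apply, h2]
      have h3 : ∀ i, ((g ⟨v, hv⟩ i) • p i) r = (∑ s, w i s * v s) * p i r := by
        intro i
        rw [Pi.smul_apply, Algebra.smul_def, ← hw]
        rfl
      simp only [G, Matrix.mulVecLin_apply, Matrix.mulVec, dotProduct, Matrix.of_apply,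
        Finset.sum_apply, h3, Finset.sum_mul]
      rw [Finset.sum_comm]
      refine Finset.sum_congr rfl fun i _ => Finset.sum_congr rfl fun s _ => ?_
      ring
    intro r s
    have := congrFun (LinearMap.congr_fun hG (Pi.single s 1)) r
    simpa [G, Pi.single_apply] using this
  · intro i j
    exact ⟨_, hw i _⟩

theorem isLattice_of_dual {k : ℕ} (p w : Fin k → Fin h → LaurentSeries R)
    (hpw : ∀ r s, ∑ i, w i s * p i r = if r = s then 1 else 0)
    (hint : ∀ i j, ∃ a : PowerSeries R, w i ⬝ᵥ p j = algebraMap _ _ a) :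
    IsLattice (Submodule.span (PowerSeries R) (Set.range p)) := by
  classical
  have hrec : ∀ v : Fin h → LaurentSeries R, v = ∑ i, (w i ⬝ᵥ v) • p i := by
    intro v
    funext r
    simp only [Finset.sum_apply, Pi.smul_apply, smul_eq_mul, dotProduct, Finset.sum_mul]
    rw [Finset.sum_comm]
    have : ∀ s, ∑ i, w i s * v s * p i r = (if r = s then 1 else 0) * v s := by
      intro s
      rw [← hpw, Finset.sum_mul]
      exact Finset.sum_congr rfl fun i _ => by ring
    simp [this]
  have hv : ∀ v ∈ Submodule.span (PowerSeries R) (Set.range p), ∀ i,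
      ∃ a : PowerSeries R, algebraMap _ _ a = w i ⬝ᵥ v := by
    intro v hv i
    induction hv using Submodule.span_induction with
    | mem x hx =>
      obtain ⟨j, rfl⟩ := hx
      obtain ⟨a, ha⟩ := hint i j
      exact ⟨a, ha.symm⟩
    | zero => exact ⟨0, by simp⟩
    | add x y _ _ hx hy =>
      obtain ⟨a, ha⟩ := hx
      obtain ⟨b, hb⟩ := hy
      exact ⟨a + b, by rw [map_add, ha, hb, dotProduct_add]⟩
    | smul c x _ hx =>
      obtain ⟨a, ha⟩ := hx
      refine ⟨c * a, ?_⟩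
      rw [map_mul, ha, ← algebraMap_smul (LaurentSeries R) c x, dotProduct_smul, smul_eq_mul]
  have hinj : Function.Injective (algebraMap (PowerSeries R) (LaurentSeries R)) :=
    HahnSeries.ofPowerSeries_injective
  choose a ha using hv
  let i : Submodule.span (PowerSeries R) (Set.range p) →ₗ[PowerSeries R]
      (Fin k → PowerSeries R) :=
    { toFun := fun v j => a v.1 v.2 j
      map_add' := by
        intro x y
        funext j
        apply hinj
        simp only [ha, Pi.add_apply, map_add, Submodule.coe_add, dotProduct_add]
      map_smul' := by
        intro c x
        funext j
        apply hinj
        simp only [ha, RingHom.id_apply, Pi.smul_apply, smul_eq_mul, map_mul, Submodule.coe_smul]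
        rw [← algebraMap_smul (LaurentSeries R) c x.1, dotProduct_smul, smul_eq_mul] }
  let s : (Fin k → PowerSeries R) →ₗ[PowerSeries R]
      Submodule.span (PowerSeries R) (Set.range p) :=
    Fintype.linearCombination (PowerSeries R)
      (fun j => (⟨p j, Submodule.subset_span ⟨j, rfl⟩⟩ : Submodule.span _ (Set.range p)))
  refine ⟨Module.Finite.span_of_finite _ (Set.finite_range p), Module.Projective.of_split i s ?_,
    ?_⟩
  · ext1 v
    ext1
    conv_rhs => rw [LinearMap.id_apply, hrec v.1]
    simp only [LinearMap.comp_apply, s, Fintype.linearCombination_apply, Submodule.coe_sum,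
      Submodule.coe_smul]
    refine Finset.sum_congr rfl fun j _ => ?_
    rw [← ha v.1 v.2 j, algebraMap_smul]
    rfl
  · rw [eq_top_iff]
    intro v _
    rw [hrec v]
    exact Submodule.sum_mem _ fun j _ => Submodule.smul_mem _ _
      (Submodule.subset_span (Submodule.subset_span ⟨j, rfl⟩))

/-- The base change of `Λ ⊆ R((t))^h` along `g : R → R'`: the `R'[[t]]`-submodule of `R'((t))^h`
generated by the image of `Λ`. -/
noncomputable def latticeBaseChange (g : R →+* R')
    (Λ : Submodule (PowerSeries R) (Fin h → LaurentSeries R)) :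
    Submodule (PowerSeries R') (Fin h → LaurentSeries R') :=
  Submodule.span (PowerSeries R')
    ((fun (v : Fin h → LaurentSeries R) i => laurentMap g (v i)) '' Λ)

theorem IsLattice.baseChange (g : R →+* R')
    {Λ : Submodule (PowerSeries R) (Fin h → LaurentSeries R)} (hΛ : IsLattice Λ) :
    IsLattice (latticeBaseChange g Λ) := by
  obtain ⟨k, p, w, hp, hpw, hint⟩ := hΛ.exists_dual
  have hspan : latticeBaseChange g Λ =
      Submodule.span (PowerSeries R') (Set.range fun i r => laurentMap g (p i r)) := by
    apply le_antisymm
    · rw [latticeBaseChange, Submodule.span_le]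
      rintro _ ⟨v, hv, rfl⟩
      rw [← hp] at hv
      induction hv using Submodule.span_induction with
      | mem x hx =>
        obtain ⟨j, rfl⟩ := hx
        exact Submodule.subset_span ⟨j, rfl⟩
      | zero =>
        have : (fun i => laurentMap g ((0 : Fin h → LaurentSeries R) i)) = 0 := by
          funext r; simp
        refine SetLike.mem_coe.mpr ?_
        beta_reduce
        rw [this]
        exact Submodule.zero_mem _
      | add x y _ _ hx hy =>
        have : (fun i => laurentMap g ((x + y) i)) =
            (fun i => laurentMap g (x i)) + fun i => laurentMap g (y i) := by
          funext r; simp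
        refine SetLike.mem_coe.mpr ?_
        beta_reduce
        rw [this]
        exact Submodule.add_mem _ hx hy
      | smul c x _ hx =>
        have : (fun i => laurentMap g ((c • x) i)) =
            PowerSeries.map g c • fun i => laurentMap g (x i) := by
          funext r
          rw [Pi.smul_apply, Pi.smul_apply, Algebra.smul_def, Algebra.smul_def, map_mul,
            laurentMap_algebraMap]
        refine SetLike.mem_coe.mpr ?_
        beta_reduce
        rw [this]
        exact Submodule.smul_mem _ _ hx
    · rw [Submodule.span_le]
      rintro _ ⟨i, rfl⟩
      refine Submodule.subset_span ⟨p i, ?_, rfl⟩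
      rw [← hp]
      exact Submodule.subset_span ⟨i, rfl⟩
  rw [hspan]
  refine isLattice_of_dual _ (fun i r => laurentMap g (w i r)) ?_ ?_
  · intro r s
    have := congrArg (laurentMap g) (hpw r s)
    rw [map_sum] at this
    simp only [map_mul] at this
    rw [this]
    split_ifs <;> simp
  · intro i j
    obtain ⟨a, ha⟩ := hint i j
    refine ⟨PowerSeries.map g a, ?_⟩
    rw [← laurentMap_algebraMap, ← ha]
    simp [dotProduct]

end Lattices

/-- The `R`-valued points of the affine Grassmannian `X` of `GL_h`: the lattices in `R((t))^h`. -/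
def Gr (h : ℕ) (R : Type u) [CommRing R] : Type u :=
  {Λ : Submodule (PowerSeries R) (Fin h → LaurentSeries R) // IsLattice Λ}

/-- The affine Grassmannian as a functor: base change of lattices. -/
noncomputable def Gr.map {h : ℕ} {R R' : Type u} [CommRing R] [CommRing R'] (g : R →+* R')
    (Λ : Gr h R) : Gr h R' :=
  ⟨latticeBaseChange g Λ.1, Λ.2.baseChange g⟩

/-! ### The Zariski topology on the `K`-valued points -/

section Topology

variable (K : Type u) [Field K]

/-- The Zariski topology on the set of `K`-valued points of the affine scheme `Spec R`, with the
sets `{y | y r ≠ 0}` for `r ∈ R` as a basis. -/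
abbrev zariskiPoints (R : Type u) [CommRing R] [Algebra K R] : TopologicalSpace (R →ₐ[K] K) :=
  TopologicalSpace.generateFrom (Set.range fun r : R => {y : R →ₐ[K] K | y r ≠ 0})

/-- The Zariski topology on the set of `K`-valued points of the ind-scheme `X` over an
algebraically closed field `K`: the finest topology for which each morphism `Spec R → X` (that is,
each lattice over `R`), with `R` a finitely generated `K`-algebra, is continuous on `K`-valued
points. As `X` is the increasing union of the closed projective schemes of lattices between
`t ^ n K[[t]]^h` and `t ^ (-n) K[[t]]^h`, a set is closed if and only if its intersection with each
of these projective varieties is Zariski closed. -/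
noncomputable instance Gr.zariski (h : ℕ) : TopologicalSpace (Gr h K) :=
  ⨆ (R : Type u) (_ : CommRing R) (_ : Algebra K R) (_ : Algebra.FiniteType K R) (Λ : Gr h R),
    TopologicalSpace.coinduced (fun y : R →ₐ[K] K => Λ.map (y : R →+* K)) (zariskiPoints K R)

end Topology

/-! ### Morphisms from a `K`-scheme to a reduced subscheme of the affine Grassmannian -/

section Morphisms

variable (K : Type u) [Field K]

/-- The `R`-valued points of the `K`-scheme `p : T → Spec K`. -/
noncomputable def Points {T : Scheme.{u}} (p : T ⟶ Spec (.of K)) (R : Type u) [CommRing R] [Algebra K R] :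
    Type u :=
  {x : Spec (.of R) ⟶ T // x ≫ p = Spec.map (CommRingCat.ofHom (algebraMap K R))}

/-- Functoriality of `R`-valued points in `R`. -/
noncomputable def Points.map {K : Type u} [Field K] {T : Scheme.{u}} {p : T ⟶ Spec (.of K)} {R R' : Type u}
    [CommRing R] [Algebra K R] [CommRing R'] [Algebra K R'] (g : R →ₐ[K] R')
    (x : Points K p R) : Points K p R' :=
  ⟨Spec.map (CommRingCat.ofHom (g : R →+* R')) ≫ x.1, by
    rw [Category.assoc, x.2, ← Spec.map_comp, ← CommRingCat.ofHom_comp, g.comp_algebraMap]⟩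

/-- A morphism from the `K`-scheme `p : T → Spec K` to the subset `S` of the affine Grassmannian
`X`: a morphism of functors on `K`-algebras from `T` to `X` that sends the `K`-valued points of `T`
into `S`. If `K` is algebraically closed, `S` is locally closed in `X` and `T` is reduced and
locally of finite type over `K`, this is the same as a morphism of schemes from `T` to the reduced
locally closed subscheme of `X` with set of `K`-valued points `S`. -/
structure MorphismTo {T : Scheme.{u}} (p : T ⟶ Spec (.of K)) {h : ℕ} (S : Set (Gr h K)) where
  /-- the lattice over `R` that belongs to an `R`-valued point -/
  app : ∀ (R : Type u) [CommRing R] [Algebra K R], Points K p R → Gr h R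
  naturality : ∀ (R R' : Type u) [CommRing R] [Algebra K R] [CommRing R'] [Algebra K R']
    (g : R →ₐ[K] R') (x : Points K p R), app R' (x.map g) = (app R x).map (g : R →+* R')
  mem : ∀ x : Points K p K, app K x ∈ S

/-- The map on `K`-valued points induced by a morphism. -/
def MorphismTo.onPoints {K : Type u} [Field K] {T : Scheme.{u}} {p : T ⟶ Spec (.of K)} {h : ℕ}
    {S : Set (Gr h K)} (f : MorphismTo K p S) (x : Points K p K) : S :=
  ⟨f.app K x, f.mem x⟩

end Morphisms

/-! ### Extended semi-modules -/

section Combinatorics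

/-- `A` is a semi-module for `m`, `h`. -/
structure IsSemiModule (m h : ℕ) (A : Set ℤ) : Prop where
  bddBelow : BddBelow A
  add_m_mem : ∀ a ∈ A, a + m ∈ A
  add_h_mem : ∀ a ∈ A, a + h ∈ A

/-- The set `B = A \ (h + A)`. -/
def generators (h : ℕ) (A : Set ℤ) : Set ℤ := {a | a ∈ A ∧ a - h ∉ A}

/-- `A` is a normalized semi-module for `m`, `h`: the sum of the elements of `B` (a finite set, as
it has at most one element in each residue class modulo `h`) is `h (h - 1) / 2`. -/
structure IsNormalizedSemiModule (m h : ℕ) (A : Set ℤ) : Prop extends IsSemiModule m h A where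
  sum_generators : 2 * ∑ᶠ a ∈ generators h A, a = (h : ℤ) * (h - 1)

/-- `max {n | a + m - n h ∈ A}`, for `a` in a semi-module `A`. -/
noncomputable def maxShift (m h : ℕ) (A : Set ℤ) (a : ℤ) : ℕ :=
  sSup {n : ℕ | a + m - n * h ∈ A}

/-- `(A, φ)` is an extended semi-module for `μ`; the value `-∞` of `φ` is `⊥`. -/
structure IsExtendedSemiModule (m h : ℕ) (μ : Fin h → ℕ) (A : Set ℤ) (φ : ℤ → WithBot ℕ) :
    Prop where
  normalized : IsNormalizedSemiModule m h A
  eq_bot_iff : ∀ a, φ a = ⊥ ↔ a ∉ A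
  add_one_le : ∀ a, φ a + 1 ≤ φ (a + h)
  le_maxShift : ∀ a ∈ A, φ a ≤ (maxShift m h A a : WithBot ℕ)
  eq_maxShift : ∀ a ∈ A, (∀ b, a ≤ b → b ∈ A) → φ a = (maxShift m h A a : WithBot ℕ)
  /-- the decomposition of `A` into the disjoint sequences `s l 0, s l 1, s l 2, …` -/
  exists_sequences : ∃ s : Fin h → ℕ → ℤ,
    (∀ l j l' j', s l j = s l' j' → l = l' ∧ j = j') ∧
    (∀ a, a ∈ A ↔ ∃ l j, s l j = a) ∧
    (∀ l j, φ (s l (j + 1)) = φ (s l j) + 1) ∧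
    (∀ l j, φ (s l j + h) = φ (s l j) + 1 → s l (j + 1) = s l j + h) ∧
    (∀ l j, φ (s l j + h) ≠ φ (s l j) + 1 → s l j + h < s l (j + 1)) ∧
    ∃ π : Equiv.Perm (Fin h), ∀ l, φ (s l 0) = (μ (π l) : WithBot ℕ)

/-- An extended semi-module `(A, φ)` is cyclic if `φ a = max {n | a + m - n h ∈ A}` for all
`a ∈ A`. -/
def IsCyclic (m h : ℕ) (A : Set ℤ) (φ : ℤ → WithBot ℕ) : Prop :=
  ∀ a ∈ A, φ a = (maxShift m h A a : WithBot ℕ)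

/-- The index set `V(A, φ)`. -/
def pairs (h : ℕ) (A : Set ℤ) (φ : ℤ → WithBot ℕ) : Set (ℤ × ℤ) :=
  {x | x.1 ∈ A ∧ x.2 ∈ A ∧ x.1 < x.2 ∧ φ x.2 < φ x.1 ∧ φ (x.1 - h) < φ x.2}

end Combinatorics

/-! ### The invariants of a lattice and the strata -/

section Strata

variable (k : Type v) [Field k] [Fintype k] {K : Type u} [Field K] [Algebra k K] (m : ℕ) {h : ℕ}

/-- Let `e_0, …, e_{h-1}` be the standard basis of `N = K((t))^h` and `e_{i+h} = t e_i`, so that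
`e_{r + h n} = t ^ n e_r`. For `v = ∑ α_i e_i` this is the set `{i | α_i ≠ 0}`. For `v ≠ 0`, its
least element is `I(v)`. -/
def eSupport (v : Fin h → LaurentSeries K) : Set ℤ :=
  {i | ∃ (r : Fin h) (n : ℤ), i = r + h * n ∧ (v r).coeff n ≠ 0}

/-- The matrix of the `K((t))`-linear map `b` with `b e_i = e_{i+m}` for all `i`: for `0 ≤ r < h`,
`b e_r = t ^ ((r + m) / h) e_{(r + m) % h}`. -/
noncomputable def bMatrix : Matrix (Fin h) (Fin h) (LaurentSeries K) :=
  Matrix.of fun s r =>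
    if ((r : ℕ) + m) % h = s then HahnSeries.single ((((r : ℕ) + m) / h : ℕ) : ℤ) 1 else 0

/-- The map `b σ : N → N`, where `σ` is the Frobenius `∑ α_i t ^ i ↦ ∑ α_i ^ q t ^ i` of `K((t))`,
`q` being the cardinality of `k`, applied to each coordinate. -/
noncomputable def bσ (v : Fin h → LaurentSeries K) : Fin h → LaurentSeries K :=
  (bMatrix m).mulVec fun r => laurentMap (FiniteField.frobeniusAlgHom k K : K →+* K) (v r)

/-- `A(M) = {I(v) | v ∈ M, v ≠ 0}`. -/
def semiModuleOf (M : Gr h K) : Set ℤ :=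
  {a | ∃ v ∈ M.1, IsLeast (eSupport v) a}

/-- The set of the `n` such that there is a `v ∈ M` with `I(v) = a` and `t ^ (-n) b σ(v) ∈ M`. -/
def phiSet (M : Gr h K) (a : ℤ) : Set ℕ :=
  {n | ∃ v ∈ M.1, IsLeast (eSupport v) a ∧
    (HahnSeries.single (-(n : ℤ)) (1 : K) : LaurentSeries K) • bσ k m v ∈ M.1}

open Classical in
/-- The function `φ(M)`: the maximum of the set `phiSet`, and `-∞` if it is empty. If
`b σ(M) ⊆ M`, it is empty exactly for `a ∉ A(M)`. -/
noncomputable def phiOf (M : Gr h K) (a : ℤ) : WithBot ℕ :=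
  if (phiSet k m M a).Nonempty then ((sSup (phiSet k m M a) : ℕ) : WithBot ℕ) else ⊥

/-- The set of lattices `S_{A, φ}`. -/
def stratum (A : Set ℤ) (φ : ℤ → WithBot ℕ) : Set (Gr h K) :=
  {M | semiModuleOf M = A ∧ phiOf k m M = φ}

end Strata

end SemiModuleStrata

/-!
# Strata of lattices with a given extended semi-module

An element `v = ∑ αᵢ eᵢ` of `N` is identified with the function `i ↦ αᵢ` on the integers. Then `t`
and `b` become the shifts by `h` and `m`, the leading exponent `I(v)` becomes the place of the first
nonzero value, and a lattice becomes a space of functions (`funSpace`), which is determined by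
finite approximations because it contains all functions that vanish below some bound.

**The family.** Let `y` be the largest element of `A \ (h + A)`. For parameters `x a b` indexed by
the pairs `(a, b) ∈ V(A, φ)`, elements `v(a)` with leading exponent `a ∈ A` are defined recursively
by `v(a) = s(a) + ∑ b, x a b • v(b)` (`coef`, `vec`). Here `s(a) = t v(a - h)` if `a - h ∈ A`,
`s(y) = e_y`, and `s(a) = t ^ (-n) b σ(v(a'))` for the other `a ∈ A \ (h + A)`, where `a'` is the
element of `[y, y + h)` and `n = φ(a')` the number with `a = a' + m - n h`. Since `m` and `h` are
coprime, each `a ∈ A \ (h + A)` is reached in this way from `y`, so that the recursion terminates.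
The `v(a)` span a lattice `M_x` (`family`), and for all `x` the element `t ^ (-φ(a)) b σ(v(a))`
belongs to `M_x` (`IsFrame.frobenius_vec_mem`).

**The open set.** The lattice is filtered by the closed spans of the `v(a)` with `φ(a) ≥ n`, and
`M_x` belongs to the stratum if and only if multiplication by `t` is injective on the graded space
of this filtration (`IsFrame.hasInvariants_family_iff`). The injectivity is automatic in large
degrees, so this is a condition on finitely many matrices with polynomial entries, and it defines an
open set (`IsFrame.IsGeneric.exists_ne_zero`). The set is nonempty because the sequences that make up
`A` provide parameters for which `t` maps, up to sign, the basis of the graded space injectively to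
itself (`IsFrame.exists_isGeneric`), and it is everything in the cyclic case, where these matrices
contain identity matrices (`IsFrame.isGeneric_of_cyclic`).

**Bijectivity.** For a lattice in the stratum, the parameters are found one after the other, by
increasing `b - a`: the value of `x a b` has to be chosen such that `v(a)` belongs, up to the
exponent `b`, to the elements `v` of the lattice with `t ^ (-φ(a)) b σ(v)` in the lattice. Such a
value exists, and if `(a, b)` is not in `V(A, φ)` then no choice is needed (`recovered`,
`HasInvariants.eq_family`). It is also unique (`IsFrame.eq_of_family_eq`). The lattice over the
polynomial ring that is spanned by the universal `v(a)` (`IsFrame.exists_universal`) defines the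
morphism.

**Local closedness.** In an algebraic family of lattices, the functions with support in a bounded
interval that belong to a member of the family, or to one of its levels, are the solutions of
finitely many linear equations with algebraic coefficients (`exists_equations`,
`exists_level_equations`). Hence the dimensions of these spaces are upper semicontinuous
(`isOpen_finrank_le`), and finitely many of them determine the invariants of a lattice
(`IsFrame.isLocallyClosed`).

**Dimension.** To compare dimensions, the parametrization is shown to be a homeomorphism. The
equations that determine the parameters of a lattice are linear in `σ ∘ v`, so by Cramer's rule some
`q ^ n`-th power of each parameter is locally a quotient of algebraic functions of the lattice
(`IsFrame.recovered_mem`). Therefore the inverse map is continuous (`isHomeomorph_parametrization`),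
and the dimension of the stratum is that of a nonempty open subset of affine space
(`topologicalKrullDim_open`).
-/

namespace SemiModuleStrata

/-! ### Extended semi-modules with values in the natural numbers -/

/-- The numerical data of an extended semi-module in the form used below: `f` is `φ` with values
in `ℕ` (its values outside `A` are irrelevant), `lo` is a lower bound of `A`, and `y` is the largest
element of `A \ (h + A)`. -/
structure IsFrame (m h : ℕ) (A : Set ℤ) (f : ℤ → ℕ) (lo y : ℤ) : Prop where
  h_pos : 0 < h
  coprime : Nat.Coprime m h
  le_of_mem : ∀ a ∈ A, lo ≤ a
  add_mem : ∀ a ∈ A, a + h ∈ A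
  mem_of_le : ∀ c, y ≤ c → c ∈ A
  sub_notMem : y - h ∉ A
  succ_le : ∀ a ∈ A, f a + 1 ≤ f (a + h)
  image_mem : ∀ a ∈ A, a + m - f a * h ∈ A
  image_min : ∀ a, y ≤ a → a + m - f a * h - h ∉ A

/-- `(a, b)` belongs to the index set `V(A, φ)`, in terms of the `ℕ`-valued function `f`. -/
def IsPair (h : ℕ) (A : Set ℤ) (f : ℤ → ℕ) (a b : ℤ) : Prop :=
  a ∈ A ∧ b ∈ A ∧ a < b ∧ f b < f a ∧ (a - h ∈ A → f (a - h) < f b)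

/-- `g` maps each element of `A` to its successor in one of the sequences into which `A` is
decomposed. -/
structure IsSuccessor (h : ℕ) (A : Set ℤ) (f : ℤ → ℕ) (g : ℤ → ℤ) : Prop where
  injOn : Set.InjOn g A
  mem : ∀ a ∈ A, g a ∈ A
  apply_eq : ∀ a ∈ A, f (g a) = f a + 1
  eq_add : ∀ a ∈ A, f (a + h) = f a + 1 → g a = a + h
  add_lt : ∀ a ∈ A, f (a + h) ≠ f a + 1 → a + h < g a

section Extraction

variable {m h : ℕ} {μ : Fin h → ℕ} {A : Set ℤ} {φ : ℤ → WithBot ℕ}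

theorem IsExtendedSemiModule.coe_unbotD (hA : IsExtendedSemiModule m h μ A φ) {a : ℤ}
    (ha : a ∈ A) : φ a = (((φ a).unbotD 0 : ℕ) : WithBot ℕ) := by
  have h1 : φ a ≠ ⊥ := fun hb => (hA.eq_bot_iff a).1 hb ha
  obtain ⟨n, hn⟩ := WithBot.ne_bot_iff_exists.1 h1
  rw [← hn]; rfl

theorem maxShift_spec (hA : IsSemiModule m h A) (hh : 0 < h) {a : ℤ} (ha : a ∈ A) :
    ∀ n : ℕ, a + m - n * h ∈ A ↔ n ≤ maxShift m h A a := by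
  obtain ⟨lo, hlo⟩ := hA.bddBelow
  have hbdd : BddAbove {n : ℕ | a + m - n * h ∈ A} := by
    refine ⟨(a + m - lo).toNat, fun n hn => ?_⟩
    have h1 : lo ≤ a + m - n * h := hlo hn
    have h2 : (n : ℤ) ≤ n * h := by
      have : (1 : ℤ) ≤ h := by exact_mod_cast hh
      nlinarith
    omega
  have hne : {n : ℕ | a + m - n * h ∈ A}.Nonempty := ⟨0, by simpa using hA.add_m_mem a ha⟩
  have hmem : a + m - (maxShift m h A a : ℕ) * h ∈ A := Nat.sSup_mem hne hbdd
  have hmul : ∀ (j : ℕ) (c : ℤ), c ∈ A → c + j * h ∈ A := by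
    intro j
    induction j with
    | zero => intro c hc; simpa using hc
    | succ j ih =>
      intro c hc
      have := hA.add_h_mem _ (ih c hc)
      push_cast
      convert this using 1
      ring
  intro n
  refine ⟨fun hn => le_csSup hbdd hn, fun hn => ?_⟩
  have := hmul (maxShift m h A a - n) _ hmem
  rw [Nat.cast_sub hn] at this
  convert this using 1
  ring

theorem IsExtendedSemiModule.exists_frame (hA : IsExtendedSemiModule m h μ A φ) (hh : 0 < h)
    (hmh : Nat.Coprime m h) : ∃ lo y, IsFrame m h A (fun a => (φ a).unbotD 0) lo y := by
  have hS := hA.normalized.toIsSemiModule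
  obtain ⟨lo, hlo⟩ := hS.bddBelow
  obtain ⟨s, -, hs, -⟩ := hA.exists_sequences
  have ha0 : s ⟨0, hh⟩ 0 ∈ A := (hs _).2 ⟨_, _, rfl⟩
  set a0 := s ⟨0, hh⟩ 0
  have hmul : ∀ (i j : ℕ), a0 + i * m + j * h ∈ A := by
    intro i j
    induction j with
    | zero =>
      induction i with
      | zero => simpa using ha0
      | succ i ih =>
        have := hS.add_m_mem _ ih
        push_cast at this ⊢
        convert this using 1
        ring
    | succ j ih =>
      have := hS.add_h_mem _ ih
      push_cast at this ⊢
      convert this using 1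
      ring
  have hcop : IsCoprime (m : ℤ) h := Nat.isCoprime_iff_coprime.2 hmh
  have hh' : (0 : ℤ) < h := by exact_mod_cast hh
  have hco : ∀ c, a0 + h * m ≤ c → c ∈ A := by
    intro c hc
    obtain ⟨u, v, huv⟩ := hcop
    have hi0 := Int.emod_nonneg ((c - a0) * u) hh'.ne'
    have hi1 := Int.emod_lt_of_pos ((c - a0) * u) hh'
    have hdiv := Int.mul_ediv_add_emod ((c - a0) * u) h
    set i := ((c - a0) * u) % h
    set j := c - a0 - i * m with hj
    have hdvd : c - a0 - i * m = ((c - a0) * v + ((c - a0) * u / h) * m) * h := by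
      linear_combination (-(c - a0)) * huv - m * hdiv
    set e := ((c - a0) * v + ((c - a0) * u / h) * m)
    have he : 0 ≤ e := by
      by_contra hne
      have h1 : i * m ≤ h * m := by nlinarith [Int.natCast_nonneg m]
      nlinarith
    obtain ⟨i', hi'⟩ := Int.eq_ofNat_of_zero_le hi0
    obtain ⟨e', he'⟩ := Int.eq_ofNat_of_zero_le he
    have := hmul i' e'
    rw [← hi', ← he'] at this
    convert this using 1
    linear_combination hdvd
  obtain ⟨c, hc1, hc2⟩ := Int.exists_least_of_bdd (P := fun z => ∀ c, z ≤ c → c ∈ A)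
    ⟨lo, fun z hz => hlo (hz z le_rfl)⟩ ⟨_, hco⟩
  have hcn : c - 1 ∉ A := by
    intro hmem
    have := hc2 (c - 1) (fun d hd => by
      rcases eq_or_lt_of_le hd with h1 | h1
      · rwa [← h1]
      · exact hc1 d (by omega))
    omega
  have hmax : ∀ a ∈ A, (φ a).unbotD 0 ≤ maxShift m h A a := by
    intro a ha
    have := hA.le_maxShift a ha
    rw [hA.coe_unbotD ha] at this
    exact_mod_cast this
  refine ⟨lo, c - 1 + h, hh, hmh, fun a ha => hlo ha, hS.add_h_mem, fun d hd => hc1 d (by omega),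
    by simpa using hcn, fun a ha => ?_, fun a ha => ?_, fun a ha => ?_⟩
  · have := hA.add_one_le a
    rw [hA.coe_unbotD ha, hA.coe_unbotD (hS.add_h_mem a ha)] at this
    exact_mod_cast this
  · exact (maxShift_spec hS hh ha _).2 (hmax a ha)
  · have haA : a ∈ A := hc1 a (by omega)
    have h1 := hA.eq_maxShift a haA (fun b hb => hc1 b (by omega))
    rw [hA.coe_unbotD haA] at h1
    have h2 : (φ a).unbotD 0 = maxShift m h A a := by exact_mod_cast h1
    have h3 := (maxShift_spec hS hh haA ((φ a).unbotD 0 + 1)).not.2 (by omega)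
    intro h4
    apply h3
    push_cast
    convert h4 using 1
    ring

theorem IsExtendedSemiModule.mem_pairs_iff (hA : IsExtendedSemiModule m h μ A φ) (a b : ℤ) :
    (a, b) ∈ pairs h A φ ↔ IsPair h A (fun a => (φ a).unbotD 0) a b := by
  simp only [pairs, IsPair, Set.mem_ofPred_eq]
  refine and_congr_right fun ha => and_congr_right fun hb => and_congr_right fun _ => ?_
  refine and_congr ?_ ?_
  · rw [hA.coe_unbotD ha, hA.coe_unbotD hb]
    exact_mod_cast Iff.rfl
  · by_cases h1 : a - h ∈ A
    · rw [hA.coe_unbotD h1, hA.coe_unbotD hb]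
      simp only [h1, true_imp_iff]
      exact_mod_cast Iff.rfl
    · rw [(hA.eq_bot_iff _).2 h1, hA.coe_unbotD hb]
      simp only [h1, false_imp_iff, iff_true]
      exact WithBot.bot_lt_coe _

theorem IsExtendedSemiModule.exists_successor (hA : IsExtendedSemiModule m h μ A φ) :
    ∃ g, IsSuccessor h A (fun a => (φ a).unbotD 0) g := by
  classical
  have hS := hA.normalized.toIsSemiModule
  obtain ⟨s, hinj, hs, h1, h2, h3, -⟩ := hA.exists_sequences
  choose l j hlj using fun a (ha : a ∈ A) => (hs a).1 ha
  have hmem : ∀ l j, s l j ∈ A := fun l j => (hs _).2 ⟨l, j, rfl⟩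
  let g : ℤ → ℤ := fun a => if ha : a ∈ A then s (l a ha) (j a ha + 1) else a
  have hg : ∀ a (ha : a ∈ A), g a = s (l a ha) (j a ha + 1) := fun a ha => dif_pos ha
  have hstep : ∀ a (ha : a ∈ A), (φ (a + h) = φ a + 1 ↔
      (φ (a + h)).unbotD 0 = (φ a).unbotD 0 + 1) := by
    intro a ha
    rw [hA.coe_unbotD ha, hA.coe_unbotD (hS.add_h_mem a ha)]
    exact_mod_cast Iff.rfl
  refine ⟨g, fun a ha b hb hab => ?_, fun a ha => ?_, fun a ha => ?_, fun a ha he => ?_,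
    fun a ha he => ?_⟩
  · rw [hg a ha, hg b hb] at hab
    obtain ⟨e1, e2⟩ := hinj _ _ _ _ hab
    rw [← hlj a ha, ← hlj b hb, e1, Nat.succ_injective e2]
  · rw [hg a ha]; exact hmem _ _
  · have h4 := h1 (l a ha) (j a ha)
    rw [← hg a ha, hlj a ha] at h4
    have h5 : g a ∈ A := by rw [hg a ha]; exact hmem _ _
    rw [hA.coe_unbotD ha, hA.coe_unbotD h5] at h4
    exact_mod_cast h4
  · have h4 := h2 (l a ha) (j a ha)
    rw [hlj a ha, ← hg a ha] at h4
    exact h4 ((hstep a ha).2 he)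
  · have h4 := h3 (l a ha) (j a ha)
    rw [hlj a ha, ← hg a ha] at h4
    exact h4 (mt (hstep a ha).1 he)

end Extraction

/-! ### Elementary consequences -/

namespace IsFrame

variable {m h : ℕ} {A : Set ℤ} {f : ℤ → ℕ} {lo y : ℤ}

theorem h_pos_int (F : IsFrame m h A f lo y) : (0 : ℤ) < h := by exact_mod_cast F.h_pos

theorem y_mem (F : IsFrame m h A f lo y) : y ∈ A := F.mem_of_le y le_rfl

theorem add_mul_mem (F : IsFrame m h A f lo y) {a : ℤ} (ha : a ∈ A) (n : ℕ) :
    a + n * h ∈ A := by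
  induction n with
  | zero => simpa using ha
  | succ n ih =>
    convert F.add_mem _ ih using 1
    push_cast; ring

theorem le_of_image_mem (F : IsFrame m h A f lo y) {a : ℤ} (ha : y ≤ a) {n : ℕ}
    (hn : a + m - n * h ∈ A) : n ≤ f a := by
  by_contra hlt
  push Not at hlt
  apply F.image_min a ha
  have := F.add_mul_mem hn (n - (f a + 1))
  rw [Nat.cast_sub hlt] at this
  convert this using 1
  push_cast; ring

theorem apply_add (F : IsFrame m h A f lo y) {a : ℤ} (ha : y ≤ a) : f (a + h) = f a + 1 := by
  have h1 := F.succ_le a (F.mem_of_le a ha)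
  have hh := F.h_pos_int
  have h2 : f (a + h) - 1 ≤ f a := by
    apply F.le_of_image_mem ha
    convert F.image_mem (a + h) (F.mem_of_le _ (by omega)) using 1
    rw [Nat.cast_sub (by omega)]
    push_cast; ring
  omega

/-- The function `f` tends to infinity. -/
theorem lt_apply (F : IsFrame m h A f lo y) (n : ℕ) {a : ℤ} (ha : y + n * h ≤ a) : n ≤ f a := by
  have hh := F.h_pos_int
  have hy : y ≤ a := by nlinarith [Int.natCast_nonneg n]
  apply F.le_of_image_mem hy
  apply F.mem_of_le
  have := Int.natCast_nonneg m
  linarith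

theorem exists_le_apply (F : IsFrame m h A f lo y) (n : ℕ) : ∃ D, y ≤ D ∧ ∀ a, D ≤ a → n ≤ f a :=
  ⟨y + n * h, by nlinarith [F.h_pos_int, Int.natCast_nonneg n], fun _ ha => F.lt_apply n ha⟩

theorem finite_isPair (F : IsFrame m h A f lo y) : {x : ℤ × ℤ | IsPair h A f x.1 x.2}.Finite := by
  have hh := F.h_pos_int
  -- for `a ≥ y + h` there is no pair `(a, b)`
  have h1 : ∀ a b, IsPair h A f a b → a < y + h := by
    rintro a b ⟨-, -, -, h2, h3⟩
    by_contra hlt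
    have h4 := F.apply_add (a := a - h) (by omega)
    rw [sub_add_cancel] at h4
    have := h3 (F.mem_of_le _ (by omega))
    omega
  have h2 : (f '' (Set.Icc lo (y + h))).Finite := (Set.finite_Icc _ _).image _
  obtain ⟨n, hn⟩ := h2.bddAbove
  obtain ⟨D, -, hD⟩ := F.exists_le_apply n
  refine ((Set.finite_Icc lo (y + h)).prod (Set.finite_Icc lo D)).subset ?_
  rintro ⟨a, b⟩ hab
  have h3 := h1 a b hab
  obtain ⟨ha, hb, h4, h5, -⟩ := hab
  refine ⟨⟨F.le_of_mem a ha, h3.le⟩, F.le_of_mem b hb, ?_⟩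
  by_contra hlt
  have h6 := hD b (not_le.1 hlt).le
  have h7 := hn ⟨a, ⟨F.le_of_mem a ha, h3.le⟩, rfl⟩
  simp only at *
  omega

/-- There is no pair `(a, b)` if `φ` increases by exactly one from `a - h` to `a`. -/
theorem not_isPair {a b : ℤ} (ha : a - h ∈ A) (hf : f a = f (a - h) + 1) :
    ¬ IsPair h A f a b := by
  rintro ⟨-, -, -, h2, h3⟩
  have := h3 ha
  omega

end IsFrame

theorem IsSuccessor.isPair {h : ℕ} {A : Set ℤ} {f : ℤ → ℕ} {g : ℤ → ℤ}
    (hg : IsSuccessor h A f g)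
    (hadd : ∀ a ∈ A, a + h ∈ A) (hsucc : ∀ a ∈ A, f a + 1 ≤ f (a + h))
    {a : ℤ} (ha : a ∈ A) (he : f (a + h) ≠ f a + 1) : IsPair h A f (a + h) (g a) := by
  have := hsucc a ha
  refine ⟨hadd a ha, hg.mem a ha, hg.add_lt a ha he, ?_, fun _ => ?_⟩
  · rw [hg.apply_eq a ha]; omega
  · rw [add_sub_cancel_right, hg.apply_eq a ha]; omega

/-! ### The universal family of generators -/

section Coefficients

/-- The element of `[y, y + h)` that is congruent to `a - m` modulo `h`. -/
def sourceOf (m h : ℕ) (y a : ℤ) : ℤ := y + (a - m - y) % h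

/-- The `i` with `0 ≤ i < h` and `a ≡ y + i m` modulo `h`. -/
def classIndex (m h : ℕ) (y a : ℤ) : ℕ := (((a - y : ℤ) : ZMod h) * (m : ZMod h)⁻¹).val

/-- A rank on `A` that increases from `a - h` to `a`, and from `sourceOf m h y a` to `a` for `a ≠ y`
in `A \ (h + A)`: elements are compared first by their class modulo `h`, in the cyclic order
generated by `m` that starts at `y`, then by size. -/
def rank (m h : ℕ) (lo y a : ℤ) : ℕ :=
  classIndex m h y a * (y + h - lo).toNat + (a - lo).toNat

open Classical in
/-- The coefficient of `e_{a + d}` in the element `v(a)` of the family with parameters `x`. The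
elements are determined by `v(a) = s(a) + ∑ b, x a b • v(b)`, the sum extending over `b > a`, with
`s(a) = t v(a - h)` if `a - h ∈ A`, with `s(y) = e_y`, and with `s(a) = t ^ (-n) b σ(v(a'))` if
`a ≠ y` belongs to `A \ (h + A)`, where `a' = sourceOf m h y a` and `n = φ(a')`. The comparisons of
ranks always hold for `a ∈ A`; they only make the recursion well-founded for all `a`. -/
noncomputable def coef (q m h : ℕ) (A : Set ℤ) (lo y : ℤ) {R : Type*} [CommRing R]
    (x : ℤ → ℤ → R) (d : ℕ) (a : ℤ) : R :=
  (if a - h ∈ A then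
      if _ : rank m h lo y (a - h) < rank m h lo y a then coef q m h A lo y x d (a - h) else 0
    else if a = y then if d = 0 then 1 else 0
    else if _ : rank m h lo y (sourceOf m h y a) < rank m h lo y a then
      coef q m h A lo y x d (sourceOf m h y a) ^ q else 0) +
  ∑ b ∈ (Finset.Ioc a (a + d)).attach,
    x a b * coef q m h A lo y x (a + d - b).toNat b
termination_by (d, rank m h lo y a)
decreasing_by
  · exact Prod.Lex.right _ ‹_›
  · exact Prod.Lex.right _ ‹_›
  · refine Prod.Lex.left _ _ ?_
    have := Finset.mem_Ioc.1 b.2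
    omega

/-- The element `v(a)` of the family with parameters `x`, as the function that maps `i` to the
coefficient of `e_i`. -/
noncomputable def vec (q m h : ℕ) (A : Set ℤ) (lo y : ℤ) {R : Type*} [CommRing R]
    (x : ℤ → ℤ → R) (a n : ℤ) : R :=
  if a ≤ n then coef q m h A lo y x (n - a).toNat a else 0

variable {m h : ℕ} {A : Set ℤ} {f : ℤ → ℕ} {lo y : ℤ}

theorem IsFrame.eq_of_dvd (F : IsFrame m h A f lo y) {a c : ℤ} (ha : a ∈ A) (ha' : a - h ∉ A)
    (hc : c ∈ A) (hc' : c - h ∉ A) (hac : (h : ℤ) ∣ a - c) : a = c := by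
  have hh := F.h_pos_int
  have key : ∀ a c : ℤ, a ∈ A → c - h ∉ A → (h : ℤ) ∣ c - a → ¬ a < c := by
    rintro a c ha hc ⟨e, he⟩ hlt
    have he1 : 1 ≤ e := by
      by_contra h0
      have : e ≤ 0 := by omega
      nlinarith
    apply hc
    obtain ⟨n, hn⟩ := Int.eq_ofNat_of_zero_le (a := e - 1) (by omega)
    convert F.add_mul_mem ha n using 1
    rw [← hn]; linear_combination he
  have h1 := key a c ha hc' (by rw [← neg_sub]; exact hac.neg_right)
  have h2 := key c a hc ha' hac
  omega

theorem IsFrame.sourceOf_mem (F : IsFrame m h A f lo y) (a : ℤ) :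
    y ≤ sourceOf m h y a ∧ sourceOf m h y a < y + h ∧ (h : ℤ) ∣ (a - m) - sourceOf m h y a := by
  have hh := F.h_pos_int
  have h1 := Int.emod_nonneg (a - m - y) hh.ne'
  have h2 := Int.emod_lt_of_pos (a - m - y) hh
  refine ⟨by unfold sourceOf; omega, by unfold sourceOf; omega, (a - m - y) / h, ?_⟩
  have := Int.mul_ediv_add_emod (a - m - y) h
  unfold sourceOf
  linear_combination -this

theorem IsFrame.sourceOf_eq (F : IsFrame m h A f lo y) {a c : ℤ} (h1 : y ≤ c) (h2 : c < y + h)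
    (h3 : (h : ℤ) ∣ (a - m) - c) : sourceOf m h y a = c := by
  obtain ⟨h4, h5, h6⟩ := F.sourceOf_mem a
  have h7 := dvd_sub h3 h6
  have : (a - m) - c - ((a - m) - sourceOf m h y a) = sourceOf m h y a - c := by ring
  rw [this] at h7
  have := Int.eq_zero_of_abs_lt_dvd h7 (by rw [abs_lt]; omega)
  omega

theorem IsFrame.image_sourceOf (F : IsFrame m h A f lo y) {a : ℤ} (ha : a ∈ A) (ha' : a - h ∉ A) :
    sourceOf m h y a + m - f (sourceOf m h y a) * h = a := by
  obtain ⟨h1, -, h2⟩ := F.sourceOf_mem a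
  refine F.eq_of_dvd (F.image_mem _ (F.mem_of_le _ h1)) (F.image_min _ h1) ha ha' ?_
  rw [← dvd_neg]
  have := dvd_add h2 (dvd_mul_left (h : ℤ) (f (sourceOf m h y a)))
  convert this using 1
  ring

theorem IsFrame.rank_sub (F : IsFrame m h A f lo y) {a : ℤ} (ha : a - h ∈ A) :
    rank m h lo y (a - h) < rank m h lo y a := by
  have h1 : classIndex m h y (a - h) = classIndex m h y a := by simp [classIndex]
  have h2 := F.le_of_mem _ ha
  have := F.h_pos_int
  rw [rank, rank, h1]
  omega

theorem IsFrame.rank_sourceOf (F : IsFrame m h A f lo y) {a : ℤ} (ha : a ∈ A) (ha' : a - h ∉ A)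
    (hay : a ≠ y) : rank m h lo y (sourceOf m h y a) < rank m h lo y a := by
  have : NeZero h := ⟨F.h_pos.ne'⟩
  obtain ⟨h1, h2, h3⟩ := F.sourceOf_mem a
  have hm : (m : ZMod h) * (m : ZMod h)⁻¹ = 1 := ZMod.coe_mul_inv_eq_one m F.coprime
  have h4 : ((sourceOf m h y a : ℤ) : ZMod h) = (a : ZMod h) - m := by
    have := (ZMod.intCast_zmod_eq_zero_iff_dvd _ h).2 h3
    push_cast at this
    rw [sub_eq_zero] at this
    exact this.symm
  set z : ZMod h := ((a - y : ℤ) : ZMod h) * (m : ZMod h)⁻¹ with hz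
  have h5 : ((sourceOf m h y a - y : ℤ) : ZMod h) * (m : ZMod h)⁻¹ = z - 1 := by
    rw [hz]; push_cast; rw [h4]; linear_combination -hm
  have hz0 : z ≠ 0 := by
    intro h0
    apply hay
    refine F.eq_of_dvd ha ha' F.y_mem F.sub_notMem ?_
    rw [← ZMod.intCast_zmod_eq_zero_iff_dvd]
    have : ((a - y : ℤ) : ZMod h) = z * m := by
      rw [hz]; linear_combination (-((a - y : ℤ) : ZMod h)) * hm
    rw [this, h0, zero_mul]
  have h6 : z.val = (z - 1).val + 1 := by
    have hlt := z.val_lt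
    have hpos : 0 < z.val := Nat.pos_of_ne_zero (by rwa [Ne, ZMod.val_eq_zero])
    have : z - 1 = ((z.val - 1 : ℕ) : ZMod h) := by
      rw [Nat.cast_sub hpos, ZMod.natCast_zmod_val, Nat.cast_one]
    rw [this, ZMod.val_natCast_of_lt (by omega)]
    omega
  have h7 : classIndex m h y a = classIndex m h y (sourceOf m h y a) + 1 := by
    rw [classIndex, classIndex, h5, ← hz, h6]
  have h8 := F.le_of_mem _ (F.mem_of_le _ h1)
  rw [rank, rank, h7, add_mul]
  have : (sourceOf m h y a - lo).toNat < (y + h - lo).toNat := by omega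
  omega

section

variable {R : Type*} [CommRing R] (q : ℕ) (x : ℤ → ℤ → R)

theorem coef_map {R' : Type*} [CommRing R'] (g : R →+* R') (d : ℕ) (a : ℤ) :
    coef q m h A lo y (fun a b => g (x a b)) d a = g (coef q m h A lo y x d a) := by
  induction d, a using coef.induct m h lo y with
  | case1 d a ih1 ih2 ih3 =>
    conv_lhs => rw [coef]
    conv_rhs => rw [coef]
    rw [map_add, map_sum]
    congr 1
    · split_ifs with h1 h2 h3 h4 h5
      · exact ih1 h2
      · simp
      · simp
      · simp
      · rw [ih2 h5, map_pow]
      · simp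
    · refine Finset.sum_congr rfl fun b _ => ?_
      rw [ih3, map_mul]

theorem vec_map {R' : Type*} [CommRing R'] (g : R →+* R') (a n : ℤ) :
    vec q m h A lo y (fun a b => g (x a b)) a n = g (vec q m h A lo y x a n) := by
  unfold vec
  split_ifs
  · exact coef_map q x g _ _
  · simp

theorem vec_of_lt {a n : ℤ} (hn : n < a) : vec q m h A lo y x a n = 0 :=
  if_neg (not_le.2 hn)

theorem vec_add (a : ℤ) (d : ℕ) : vec q m h A lo y x a (a + d) = coef q m h A lo y x d a := by
  simp [vec]

variable {q x}

/-- The recursion for the coefficients of `v(a)`, for `a ∈ A`. -/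
theorem IsFrame.coef_eq (F : IsFrame m h A f lo y) {a : ℤ} (ha : a ∈ A) (d : ℕ) :
    (a - h ∈ A → coef q m h A lo y x d a = coef q m h A lo y x d (a - h) +
      ∑ b ∈ Finset.Ioc a (a + d), x a b * coef q m h A lo y x (a + d - b).toNat b) ∧
    (a = y → coef q m h A lo y x d a = (if d = 0 then 1 else 0) +
      ∑ b ∈ Finset.Ioc a (a + d), x a b * coef q m h A lo y x (a + d - b).toNat b) ∧
    (a - h ∉ A → a ≠ y → coef q m h A lo y x d a = coef q m h A lo y x d (sourceOf m h y a) ^ q +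
      ∑ b ∈ Finset.Ioc a (a + d), x a b * coef q m h A lo y x (a + d - b).toNat b) := by
  rw [coef, Finset.sum_attach (Finset.Ioc a (a + d))
    (fun b => x a b * coef q m h A lo y x (a + d - b).toNat b)]
  refine ⟨fun h1 => ?_, fun h1 => ?_, fun h1 h2 => ?_⟩
  · rw [if_pos h1, dif_pos (F.rank_sub h1)]
  · subst h1
    rw [if_neg F.sub_notMem, if_pos rfl]
  · rw [if_neg h1, if_neg h2, dif_pos (F.rank_sourceOf ha h1 h2)]

theorem IsFrame.coef_zero (F : IsFrame m h A f lo y) {a : ℤ} (ha : a ∈ A) :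
    coef q m h A lo y x 0 a = 1 := by
  induction hn : rank m h lo y a using Nat.strong_induction_on generalizing a with
  | _ n ih =>
    subst hn
    obtain ⟨h1, h2, h3⟩ := F.coef_eq (q := q) (x := x) ha 0
    simp only [Nat.cast_zero, add_zero, Finset.Ioc_self, Finset.sum_empty, if_true] at h1 h2 h3
    by_cases c1 : a - h ∈ A
    · rw [h1 c1]; exact ih _ (F.rank_sub c1) c1 rfl
    · by_cases c2 : a = y
      · exact h2 c2
      · rw [h3 c1 c2, ih _ (F.rank_sourceOf ha c1 c2) (F.mem_of_le _ (F.sourceOf_mem a).1) rfl,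
          one_pow]

theorem IsFrame.vec_self (F : IsFrame m h A f lo y) {a : ℤ} (ha : a ∈ A) :
    vec q m h A lo y x a a = 1 := by
  rw [← F.coef_zero (q := q) (x := x) ha]
  simpa using vec_add q x a 0

/-- The finite set of the `b` such that `(a, b)` is in `V(A, φ)`. -/
noncomputable def IsFrame.partners (F : IsFrame m h A f lo y) (a : ℤ) : Finset ℤ :=
  (F.finite_isPair.preimage (f := fun b => (a, b)) (fun _ _ _ _ => by simp)).toFinset

theorem IsFrame.mem_partners (F : IsFrame m h A f lo y) {a b : ℤ} :
    b ∈ F.partners a ↔ IsPair h A f a b := by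
  simp [partners]

theorem IsFrame.sum_partners (F : IsFrame m h A f lo y)
    (hx : ∀ a b, ¬ IsPair h A f a b → x a b = 0) (a : ℤ) (d : ℕ) :
    ∑ b ∈ Finset.Ioc a (a + d), x a b * coef q m h A lo y x (a + d - b).toNat b =
      (∑ b ∈ F.partners a, x a b • vec q m h A lo y x b) (a + d) := by
  classical
  rw [Finset.sum_apply]
  simp only [Pi.smul_apply, smul_eq_mul]
  have e : ∀ b ∈ Finset.Ioc a (a + d), x a b * coef q m h A lo y x (a + d - b).toNat b =
      x a b * vec q m h A lo y x b (a + d) := by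
    intro b hb
    rw [vec, if_pos (Finset.mem_Ioc.1 hb).2]
  rw [Finset.sum_congr rfl e]
  refine (Finset.sum_subset (Finset.subset_union_left (s₂ := F.partners a)) ?_).trans
    (Finset.sum_subset (Finset.subset_union_right (s₁ := Finset.Ioc a (a + d))) ?_).symm
  · intro b hb hb'
    have h1 : b ∈ F.partners a := (Finset.mem_union.1 hb).resolve_left hb'
    have h2 := (F.mem_partners.1 h1).2.2.1
    rw [vec_of_lt, mul_zero]
    rw [Finset.mem_Ioc] at hb'
    omega
  · intro b _ hb
    rw [hx a b (mt F.mem_partners.2 hb), zero_mul]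

end

/-- The shift by `j`: it maps `e_i` to `e_{i+j}`. -/
def shift (R : Type*) [CommRing R] (j : ℤ) : (ℤ → R) →ₗ[R] (ℤ → R) where
  toFun v n := v (n - j)
  map_add' _ _ := rfl
  map_smul' _ _ := rfl

section

variable {R : Type*} [CommRing R] {q : ℕ} {x : ℤ → ℤ → R}

@[simp] theorem shift_apply (j : ℤ) (v : ℤ → R) (n : ℤ) : shift R j v n = v (n - j) := rfl

theorem shift_shift (i j : ℤ) (v : ℤ → R) : shift R i (shift R j v) = shift R (i + j) v := by
  funext n; simp only [shift_apply]; congr 1; ring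

@[simp] theorem shift_zero (v : ℤ → R) : shift R 0 v = v := by
  funext n; simp

theorem IsFrame.vec_eq_of_coef_eq (F : IsFrame m h A f lo y)
    (hx : ∀ a b, ¬ IsPair h A f a b → x a b = 0) {a : ℤ} {s : ℤ → R} (hs : ∀ n, n < a → s n = 0)
    (hc : ∀ d : ℕ, coef q m h A lo y x d a = s (a + d) +
      ∑ b ∈ Finset.Ioc a (a + d), x a b * coef q m h A lo y x (a + d - b).toNat b) :
    vec q m h A lo y x a = s + ∑ b ∈ F.partners a, x a b • vec q m h A lo y x b := by
  funext n
  rw [Pi.add_apply]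
  rcases lt_or_ge n a with hn | hn
  · rw [vec_of_lt q x hn, hs n hn, Finset.sum_apply, Finset.sum_eq_zero, add_zero]
    intro b hb
    have := (F.mem_partners.1 hb).2.2.1
    rw [Pi.smul_apply, vec_of_lt q x (by omega), smul_zero]
  · obtain ⟨d, hd⟩ := Int.eq_ofNat_of_zero_le (a := n - a) (by omega)
    obtain rfl : n = a + d := by omega
    rw [vec_add, hc, F.sum_partners hx]

theorem IsFrame.vec_of_sub_mem (F : IsFrame m h A f lo y)
    (hx : ∀ a b, ¬ IsPair h A f a b → x a b = 0) {a : ℤ} (ha : a ∈ A) (ha' : a - h ∈ A) :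
    vec q m h A lo y x a = shift R h (vec q m h A lo y x (a - h)) +
      ∑ b ∈ F.partners a, x a b • vec q m h A lo y x b := by
  refine F.vec_eq_of_coef_eq hx (fun n hn => ?_) fun d => ?_
  · rw [shift_apply, vec_of_lt q x (by omega)]
  · rw [(F.coef_eq ha d).1 ha', shift_apply, ← vec_add]
    congr 2; ring

theorem IsFrame.vec_top (F : IsFrame m h A f lo y)
    (hx : ∀ a b, ¬ IsPair h A f a b → x a b = 0) :
    vec q m h A lo y x y = Pi.single y 1 +
      ∑ b ∈ F.partners y, x y b • vec q m h A lo y x b := by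
  refine F.vec_eq_of_coef_eq hx (fun n hn => ?_) fun d => ?_
  · rw [Pi.single_eq_of_ne hn.ne]
  · rw [(F.coef_eq F.y_mem d).2.1 rfl]
    congr 1
    by_cases hd : d = 0 <;> simp [hd]

theorem IsFrame.vec_of_sub_notMem (F : IsFrame m h A f lo y) (hq : q ≠ 0)
    (hx : ∀ a b, ¬ IsPair h A f a b → x a b = 0) {a : ℤ} (ha : a ∈ A) (ha' : a - h ∉ A)
    (hay : a ≠ y) :
    vec q m h A lo y x a = shift R (m - f (sourceOf m h y a) * h)
        (vec q m h A lo y x (sourceOf m h y a) ^ q) +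
      ∑ b ∈ F.partners a, x a b • vec q m h A lo y x b := by
  have h1 := F.image_sourceOf ha ha'
  refine F.vec_eq_of_coef_eq hx (fun n hn => ?_) fun d => ?_
  · rw [shift_apply, Pi.pow_apply, vec_of_lt q x (by linarith), zero_pow hq]
  · rw [(F.coef_eq ha d).2.2 ha' hay, shift_apply, Pi.pow_apply, ← vec_add]
    congr 3; linarith

end

end Coefficients

/-! ### Lattices as spaces of functions on the integers -/

section FunctionLattices

variable {K : Type*} [Field K]

/-- The functions that vanish below `D`, i.e. the span of the `e_i` with `i ≥ D`. -/
def tail (K : Type*) [Field K] (D : ℤ) : Submodule K (ℤ → K) where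
  carrier := {v | ∀ n, n < D → v n = 0}
  add_mem' ha hb n hn := by simp [ha n hn, hb n hn]
  zero_mem' n _ := rfl
  smul_mem' c v hv n hn := by simp [hv n hn]

theorem mem_tail {D : ℤ} {v : ℤ → K} : v ∈ tail K D ↔ ∀ n, n < D → v n = 0 := Iff.rfl

theorem tail_anti {D D' : ℤ} (hD : D ≤ D') : tail K D' ≤ tail K D :=
  fun _ hv n hn => hv n (by omega)

theorem shift_mem_tail {D : ℤ} {v : ℤ → K} (hv : v ∈ tail K D) (j : ℤ) :
    shift K j v ∈ tail K (D + j) := fun n hn => hv _ (by omega)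

/-- `I(v) = a`: the function `v` has its first nonzero value at `a`. -/
def Leads (v : ℤ → K) (a : ℤ) : Prop := v a ≠ 0 ∧ ∀ n, n < a → v n = 0

theorem Leads.unique {v : ℤ → K} {a b : ℤ} (ha : Leads v a) (hb : Leads v b) : a = b := by
  rcases lt_trichotomy a b with h | h | h
  · exact (ha.1 (hb.2 a h)).elim
  · exact h
  · exact (hb.1 (ha.2 b h)).elim

theorem Leads.shift {v : ℤ → K} {a : ℤ} (ha : Leads v a) (j : ℤ) :
    Leads (shift K j v) (a + j) :=
  ⟨by simpa using ha.1, fun n hn => ha.2 _ (by omega)⟩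

theorem Leads.congr {v w : ℤ → K} {a : ℤ} (ha : Leads v a) (hw : v - w ∈ tail K (a + 1)) :
    Leads w a := by
  have h : ∀ n, n < a + 1 → v n = w n := fun n hn => sub_eq_zero.1 (hw n hn)
  exact ⟨by rw [← h a (by omega)]; exact ha.1,
    fun n hn => by rw [← h n (by omega)]; exact ha.2 n hn⟩

theorem mem_tail_succ_or_leads {v : ℤ → K} {a : ℤ} (hv : v ∈ tail K a) :
    v ∈ tail K (a + 1) ∨ Leads v a := by
  by_cases h : v a = 0
  · refine Or.inl fun n hn => ?_
    rcases eq_or_lt_of_le (Int.lt_add_one_iff.1 hn) with rfl | h1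
    · exact h
    · exact hv n h1
  · exact Or.inr ⟨h, hv⟩

theorem Leads.sub_smul_mem {v w : ℤ → K} {a : ℤ} (hv : v ∈ tail K a) (hw : Leads w a) :
    v - (v a / w a) • w ∈ tail K (a + 1) := by
  intro n hn
  rcases eq_or_lt_of_le (Int.lt_add_one_iff.1 hn) with rfl | h1
  · simp [hw.1]
  · simp [hv n h1, hw.2 n h1]

theorem exists_leads {v : ℤ → K} {D : ℤ} (hv : v ∈ tail K D) (hv0 : v ≠ 0) :
    ∃ a, Leads v a := by
  classical
  obtain ⟨n, hn⟩ := Function.ne_iff.1 hv0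
  obtain ⟨a, ha1, ha2⟩ := Int.exists_least_of_bdd (P := fun n => v n ≠ 0)
    ⟨D, fun z hz => by by_contra hlt; exact hz (hv z (by omega))⟩ ⟨n, hn⟩
  exact ⟨a, ha1, fun n hn => by by_contra h0; have := ha2 n h0; omega⟩

/-- Successive elimination of leading terms: a space of functions with a common lower bound is
contained in a subspace that has the same leading exponents and contains all functions that vanish
below some bound. -/
theorem le_of_leads {L₁ L₂ : Submodule K (ℤ → K)} (h12 : L₁ ≤ L₂) {D D' : ℤ} (h1 : tail K D' ≤ L₁)
    (h2 : L₂ ≤ tail K D) (hl : ∀ v ∈ L₂, ∀ a, Leads v a → ∃ w ∈ L₁, Leads w a) : L₂ ≤ L₁ := by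
  have key : ∀ k : ℕ, ∀ v ∈ L₂, v ∈ tail K (D' - k) → v ∈ L₁ := by
    intro k
    induction k with
    | zero => intro v _ hv; exact h1 (by simpa using hv)
    | succ k ih =>
      intro v hv hv'
      have e : D' - ((k + 1 : ℕ) : ℤ) + 1 = D' - k := by push_cast; ring
      rcases mem_tail_succ_or_leads hv' with h | h
      · rw [e] at h; exact ih v hv h
      · obtain ⟨w, hw, hw'⟩ := hl v hv _ h
        have h3 := hw'.sub_smul_mem hv'
        rw [e] at h3
        have h4 := ih _ (L₂.sub_mem hv (L₂.smul_mem _ (h12 hw))) h3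
        have := L₁.add_mem h4 (L₁.smul_mem (v (D' - ((k + 1 : ℕ) : ℤ)) /
          w (D' - ((k + 1 : ℕ) : ℤ))) hw)
        rwa [sub_add_cancel] at this
  intro v hv
  exact key (D' - D).toNat v hv (tail_anti (by omega) (h2 hv))

/-- The spaces of functions that belong to lattices: they are stable under `t`, bounded below, and
contain all functions that vanish below some bound. -/
structure IsFunLattice (h : ℕ) (L : Submodule K (ℤ → K)) : Prop where
  shift_mem : ∀ v ∈ L, shift K h v ∈ L
  exists_le : ∃ D, L ≤ tail K D
  exists_ge : ∃ D, tail K D ≤ L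

theorem IsFunLattice.shift_mul_mem {h : ℕ} {L : Submodule K (ℤ → K)} (hL : IsFunLattice h L)
    (n : ℕ) {v : ℤ → K} (hv : v ∈ L) : shift K (n * h) v ∈ L := by
  induction n with
  | zero => simpa using hv
  | succ n ih =>
    have := hL.shift_mem _ ih
    rw [shift_shift] at this
    rwa [show (h : ℤ) + n * h = (n + 1 : ℕ) * h by push_cast; ring] at this

/-- The subspace of the `v ∈ L` with `t ^ (-n) b σ(v) ∈ L`. -/
def levelSubspace (m h : ℕ) (σ : K →+* K) (L : Submodule K (ℤ → K)) (n : ℕ) :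
    Submodule K (ℤ → K) where
  carrier := {v | v ∈ L ∧ shift K (m - n * h) (σ ∘ v) ∈ L}
  add_mem' := by
    rintro v w ⟨h1, h2⟩ ⟨h3, h4⟩
    refine ⟨L.add_mem h1 h3, ?_⟩
    have : σ ∘ (v + w) = σ ∘ v + σ ∘ w := by funext n; simp
    rw [this, map_add]
    exact L.add_mem h2 h4
  zero_mem' := by
    refine ⟨L.zero_mem, ?_⟩
    have : σ ∘ (0 : ℤ → K) = 0 := by funext n; simp
    rw [this, map_zero]
    exact L.zero_mem
  smul_mem' := by
    rintro c v ⟨h1, h2⟩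
    refine ⟨L.smul_mem c h1, ?_⟩
    have : σ ∘ (c • v) = σ c • (σ ∘ v) := by funext n; simp
    rw [this, map_smul]
    exact L.smul_mem _ h2

variable {m h : ℕ} {σ : K →+* K} {L : Submodule K (ℤ → K)}

theorem mem_levelSubspace {n : ℕ} {v : ℤ → K} : v ∈ levelSubspace m h σ L n ↔
    v ∈ L ∧ shift K (m - n * h) (σ ∘ v) ∈ L := Iff.rfl

theorem comp_shift (j : ℤ) (v : ℤ → K) : σ ∘ shift K j v = shift K j (σ ∘ v) := rfl

theorem Leads.comp {v : ℤ → K} {a : ℤ} (ha : Leads v a) : Leads (σ ∘ v) a :=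
  ⟨by simpa using ha.1, fun n hn => by simp [ha.2 n hn]⟩

theorem comp_mem_tail {v : ℤ → K} {D : ℤ} (hv : v ∈ tail K D) : σ ∘ v ∈ tail K D :=
  fun n hn => by simp [hv n hn]

theorem levelSubspace_anti (hL : IsFunLattice h L) {n n' : ℕ} (hn : n ≤ n') :
    levelSubspace m h σ L n' ≤ levelSubspace m h σ L n := by
  rintro v ⟨h1, h2⟩
  refine ⟨h1, ?_⟩
  have := hL.shift_mul_mem (n' - n) h2
  rw [shift_shift, Nat.cast_sub hn] at this
  rwa [show ((n' : ℤ) - n) * h + (m - n' * h) = m - n * h by ring] at this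

theorem shift_mem_levelSubspace_iff (hL : IsFunLattice h L) {n : ℕ} {v : ℤ → K} (hv : v ∈ L) :
    shift K h v ∈ levelSubspace m h σ L (n + 1) ↔ v ∈ levelSubspace m h σ L n := by
  rw [mem_levelSubspace, mem_levelSubspace, comp_shift, shift_shift]
  have : ((m : ℤ) - ((n + 1 : ℕ) : ℤ) * h + h) = m - n * h := by push_cast; ring
  rw [this]
  exact ⟨fun hh => ⟨hv, hh.2⟩, fun hh => ⟨hL.shift_mem v hv, hh.2⟩⟩

theorem exists_tail_le_levelSubspace (hL : IsFunLattice h L) (n : ℕ) :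
    ∃ D, tail K D ≤ levelSubspace m h σ L n := by
  obtain ⟨D, hD⟩ := hL.exists_ge
  refine ⟨max D (D - (m - n * h)), fun v hv => ⟨hD (tail_anti (le_max_left _ _) hv), hD ?_⟩⟩
  refine tail_anti ?_ (shift_mem_tail (comp_mem_tail hv) _)
  have := le_max_right D (D - (m - n * h))
  omega

/-- The leading exponents of `L` form the set `A`, and for `a ∈ A` the largest `n` for which an
element of the `n`-th level leads at `a` is `f a`. -/
structure HasInvariants (m h : ℕ) (σ : K →+* K) (A : Set ℤ) (f : ℤ → ℕ)
    (L : Submodule K (ℤ → K)) : Prop where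
  leads_iff : ∀ a, (∃ v ∈ L, Leads v a) ↔ a ∈ A
  level_iff : ∀ a ∈ A, ∀ n, (∃ v ∈ levelSubspace m h σ L n, Leads v a) ↔ n ≤ f a

end FunctionLattices

/-! ### The lattices of the family -/

section Family

variable {K : Type*} [Field K] {m h : ℕ} {A : Set ℤ} {f : ℤ → ℕ} {lo y : ℤ} {q : ℕ}

theorem IsFrame.vec_leads (F : IsFrame m h A f lo y) (x : ℤ → ℤ → K) {a : ℤ} (ha : a ∈ A) :
    Leads (vec q m h A lo y x a) a :=
  ⟨by rw [F.vec_self ha]; exact one_ne_zero, fun _ hn => vec_of_lt q x hn⟩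

theorem IsFrame.sum_leads (F : IsFrame m h A f lo y) (x : ℤ → ℤ → K) {T : Finset ℤ}
    (hT : ∀ a ∈ T, a ∈ A) {c : ℤ → K} (hc : ∃ a ∈ T, c a ≠ 0) :
    ∃ a ∈ T, c a ≠ 0 ∧ Leads (∑ b ∈ T, c b • vec q m h A lo y x b) a := by
  classical
  have hne : (T.filter fun a => c a ≠ 0).Nonempty := by
    obtain ⟨a, h1, h2⟩ := hc
    exact ⟨a, Finset.mem_filter.2 ⟨h1, h2⟩⟩
  obtain ⟨h1, h2⟩ := Finset.mem_filter.1 (Finset.min'_mem _ hne)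
  set a := (T.filter fun a => c a ≠ 0).min' hne
  have hmin : ∀ b ∈ T, b < a → c b = 0 := by
    intro b hb hlt
    by_contra h0
    have := Finset.min'_le (T.filter fun a => c a ≠ 0) b (Finset.mem_filter.2 ⟨hb, h0⟩)
    exact absurd hlt (not_lt.2 this)
  refine ⟨a, h1, h2, ?_, fun n hn => ?_⟩
  · rw [Finset.sum_apply, Finset.sum_eq_single a]
    · rw [Pi.smul_apply, F.vec_self (hT a h1)]; simpa using h2
    · intro b hb hne
      rcases lt_or_gt_of_ne hne with h3 | h3
      · simp [hmin b hb h3]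
      · simp [vec_of_lt q x h3]
    · exact fun h => (h h1).elim
  · rw [Finset.sum_apply, Finset.sum_eq_zero]
    intro b hb
    rcases lt_or_ge b a with h3 | h3
    · simp [hmin b hb h3]
    · simp [vec_of_lt q x (show n < b by omega)]

/-- The closed span of the `v(a)` with `φ(a) ≥ n`. For `n = 0` it is the lattice with
parameters `x`. -/
def family (q m h : ℕ) (A : Set ℤ) (f : ℤ → ℕ) (lo y : ℤ) (x : ℤ → ℤ → K) (n : ℕ) :
    Submodule K (ℤ → K) :=
  ⨅ D : ℤ, Submodule.span K (vec q m h A lo y x '' {a | a ∈ A ∧ n ≤ f a}) ⊔ tail K D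

variable {x : ℤ → ℤ → K}

theorem mem_family {n : ℕ} {v : ℤ → K} : v ∈ family q m h A f lo y x n ↔
    ∀ D : ℤ, v ∈ Submodule.span K (vec q m h A lo y x '' {a | a ∈ A ∧ n ≤ f a}) ⊔ tail K D := by
  simp [family, Submodule.mem_iInf]

theorem exists_sum_of_mem_family {n : ℕ} {v : ℤ → K} (hv : v ∈ family q m h A f lo y x n) (D : ℤ) :
    ∃ (T : Finset ℤ) (c : ℤ → K), (∀ a ∈ T, a ∈ A ∧ n ≤ f a) ∧
      v - ∑ a ∈ T, c a • vec q m h A lo y x a ∈ tail K D := by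
  obtain ⟨u, hu, r, hr, rfl⟩ := Submodule.mem_sup.1 (mem_family.1 hv D)
  obtain ⟨l, hl, rfl⟩ := (Finsupp.mem_span_image_iff_linearCombination K).1 hu
  refine ⟨l.support, l, fun a ha => (Finsupp.mem_supported K l).1 hl ha, ?_⟩
  rw [Finsupp.linearCombination_apply, Finsupp.sum, add_sub_cancel_left]
  exact hr

theorem vec_mem_family {a : ℤ} (ha : a ∈ A) {n : ℕ} (hn : n ≤ f a) :
    vec q m h A lo y x a ∈ family q m h A f lo y x n :=
  mem_family.2 fun _ => Submodule.mem_sup_left (Submodule.subset_span ⟨a, ⟨ha, hn⟩, rfl⟩)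

theorem family_anti {n n' : ℕ} (hn : n ≤ n') :
    family q m h A f lo y x n' ≤ family q m h A f lo y x n := by
  refine iInf_mono fun D => sup_le_sup_right (Submodule.span_mono (Set.image_mono ?_)) _
  exact fun a ha => ⟨ha.1, hn.trans ha.2⟩

theorem IsFrame.leads_family (F : IsFrame m h A f lo y) {n : ℕ} {v : ℤ → K}
    (hv : v ∈ family q m h A f lo y x n) {a : ℤ} (ha : Leads v a) : a ∈ A ∧ n ≤ f a := by
  obtain ⟨T, c, hT, hr⟩ := exists_sum_of_mem_family hv (a + 1)
  have h1 := ha.congr hr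
  have hc : ∃ a ∈ T, c a ≠ 0 := by
    by_contra! hne
    apply h1.1
    rw [Finset.sum_apply, Finset.sum_eq_zero]
    intro b hb
    simp [hne b hb]
  obtain ⟨b, hb, -, hb'⟩ := F.sum_leads x (q := q) (fun a ha => (hT a ha).1) hc
  rw [h1.unique hb']
  exact hT b hb

theorem IsFrame.tail_le_family (F : IsFrame m h A f lo y) {n : ℕ} {D : ℤ}
    (hD : ∀ a, D ≤ a → a ∈ A ∧ n ≤ f a) : tail K D ≤ family q m h A f lo y x n := by
  intro v hv
  have key : ∀ k : ℕ,
      v ∈ Submodule.span K (vec q m h A lo y x '' {a | a ∈ A ∧ n ≤ f a}) ⊔ tail K (D + k) := by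
    intro k
    induction k with
    | zero => exact Submodule.mem_sup_right (by simpa using hv)
    | succ k ih =>
      obtain ⟨u, hu, r, hr, rfl⟩ := Submodule.mem_sup.1 ih
      have h1 := hD (D + k) (by omega)
      have h2 := (F.vec_leads (q := q) x h1.1).sub_smul_mem hr
      have h3 : D + k + 1 = D + (k + 1 : ℕ) := by push_cast; ring
      rw [h3] at h2
      have h4 : vec q m h A lo y x (D + k) ∈
          Submodule.span K (vec q m h A lo y x '' {a | a ∈ A ∧ n ≤ f a}) :=
        Submodule.subset_span ⟨_, h1, rfl⟩
      refine Submodule.mem_sup.2 ⟨_, Submodule.add_mem _ hu (Submodule.smul_mem _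
        (r (D + k) / vec q m h A lo y x (D + k) (D + k)) h4), _, h2, ?_⟩
      abel
  refine mem_family.2 fun D' => ?_
  have h5 : tail K (D + (D' - D).toNat) ≤ tail K D' := tail_anti (by omega)
  exact (sup_le_sup_left h5 (Submodule.span K _) : _ ≤ _) (key (D' - D).toNat)

theorem IsFrame.shift_vec (F : IsFrame m h A f lo y)
    (hx : ∀ a b, ¬ IsPair h A f a b → x a b = 0) {a : ℤ} (ha : a ∈ A) :
    shift K h (vec q m h A lo y x a) = vec q m h A lo y x (a + h) -
      ∑ b ∈ F.partners (a + h), x (a + h) b • vec q m h A lo y x b := by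
  have := F.vec_of_sub_mem (q := q) hx (F.add_mem a ha) (by simpa using ha)
  rw [this, add_sub_cancel_right, add_sub_cancel_right]

theorem IsFrame.lt_of_mem_partners (F : IsFrame m h A f lo y) {a b : ℤ} (ha : a ∈ A)
    (hb : b ∈ F.partners (a + h)) : b ∈ A ∧ f a + 1 ≤ f b ∧ a + h < b := by
  obtain ⟨-, h2, h3, -, h5⟩ := F.mem_partners.1 hb
  rw [add_sub_cancel_right] at h5
  exact ⟨h2, h5 ha, h3⟩

theorem IsFrame.shift_vec_mem (F : IsFrame m h A f lo y)
    (hx : ∀ a b, ¬ IsPair h A f a b → x a b = 0) {a : ℤ} (ha : a ∈ A) {n : ℕ} (hn : n ≤ f a) :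
    shift K h (vec q m h A lo y x a) ∈ family q m h A f lo y x (n + 1) := by
  rw [F.shift_vec hx ha]
  have := F.succ_le a ha
  refine Submodule.sub_mem _ (vec_mem_family (F.add_mem a ha) (by omega))
    (Submodule.sum_mem _ fun b hb => Submodule.smul_mem _ _ ?_)
  obtain ⟨h2, h5, -⟩ := F.lt_of_mem_partners ha hb
  exact vec_mem_family h2 (by omega)

theorem IsFrame.shift_mem_family (F : IsFrame m h A f lo y)
    (hx : ∀ a b, ¬ IsPair h A f a b → x a b = 0) {n : ℕ} {v : ℤ → K}
    (hv : v ∈ family q m h A f lo y x n) :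
    shift K h v ∈ family q m h A f lo y x (n + 1) := by
  obtain ⟨D, hD1, hD2⟩ := F.exists_le_apply (n + 1)
  obtain ⟨T, c, hT, hr⟩ := exists_sum_of_mem_family hv (D - h)
  have h1 := shift_mem_tail hr h
  rw [sub_add_cancel, map_sub, map_sum] at h1
  have h2 := F.tail_le_family (q := q) (x := x)
    (fun a ha => ⟨F.mem_of_le a (by omega), hD2 a ha⟩) h1
  rw [Submodule.sub_mem_iff_left] at h2
  · exact h2
  · refine Submodule.sum_mem _ fun a ha => ?_
    rw [map_smul]
    exact Submodule.smul_mem _ _ (F.shift_vec_mem hx (hT a ha).1 (hT a ha).2)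

theorem IsFrame.tail_le (F : IsFrame m h A f lo y) : tail K y ≤ family q m h A f lo y x 0 :=
  F.tail_le_family fun a ha => ⟨F.mem_of_le a ha, Nat.zero_le _⟩

theorem IsFrame.family_le (F : IsFrame m h A f lo y) (n : ℕ) :
    family q m h A f lo y x n ≤ tail K lo := by
  intro v hv
  have h1 : Submodule.span K (vec q m h A lo y x '' {a | a ∈ A ∧ n ≤ f a}) ⊔ tail K lo ≤
      tail K lo := by
    refine sup_le (Submodule.span_le.2 ?_) le_rfl
    rintro _ ⟨a, ha, rfl⟩ n hn
    exact vec_of_lt q x (by have := F.le_of_mem a ha.1; omega)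
  exact h1 (mem_family.1 hv lo)

theorem IsFrame.isFunLattice_family (F : IsFrame m h A f lo y)
    (hx : ∀ a b, ¬ IsPair h A f a b → x a b = 0) :
    IsFunLattice h (family q m h A f lo y x 0) where
  shift_mem _ hv := family_anti (Nat.zero_le _) (F.shift_mem_family hx hv)
  exists_le := ⟨lo, F.family_le 0⟩
  exists_ge := ⟨y, F.tail_le⟩

variable {σ : K →+* K}

/-- The element `t ^ (-φ(a)) b σ(v(a))` belongs to the lattice. For `a ≥ y` this follows from the
choice of `v(a + m - φ(a) h)`, and for smaller `a` by descending induction from the relation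
between `v(a)` and `v(a + h)`. -/
theorem IsFrame.frobenius_vec_mem (F : IsFrame m h A f lo y) (hq : q ≠ 0)
    (hσ : ∀ z, σ z = z ^ q) (hx : ∀ a b, ¬ IsPair h A f a b → x a b = 0) {a : ℤ} (ha : a ∈ A) :
    shift K (m - f a * h) (σ ∘ vec q m h A lo y x a) ∈ family q m h A f lo y x 0 := by
  have hh := F.h_pos_int
  have hL := F.isFunLattice_family (q := q) hx
  have hpow : ∀ v : ℤ → K, σ ∘ v = v ^ q := fun v => by funext n; simp [hσ]
  -- the case `y ≤ a < y + h`
  have h1 : ∀ a, y ≤ a → a < y + h →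
      shift K (m - f a * h) (σ ∘ vec q m h A lo y x a) ∈ family q m h A f lo y x 0 := by
    intro a h1 h2
    have hcA := F.image_mem a (F.mem_of_le a h1)
    have hcA' := F.image_min a h1
    set c := a + m - f a * h with hc
    by_cases hcy : c = y
    · apply F.tail_le
      have := shift_mem_tail (comp_mem_tail (σ := σ)
        (mem_tail.2 (F.vec_leads (q := q) x (F.mem_of_le a h1)).2)) (m - f a * h)
      rwa [show a + (m - f a * h) = y by omega] at this
    · have hs : sourceOf m h y c = a := by
        refine F.sourceOf_eq h1 h2 ⟨-f a, ?_⟩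
        rw [hc]; ring
      have h3 := F.vec_of_sub_notMem hq hx hcA hcA' hcy
      rw [hs, ← hpow, ← sub_eq_iff_eq_add] at h3
      rw [← h3]
      refine Submodule.sub_mem _ (vec_mem_family hcA (Nat.zero_le _))
        (Submodule.sum_mem _ fun b hb => Submodule.smul_mem _ _
          (vec_mem_family (F.mem_partners.1 hb).2.1 (Nat.zero_le _)))
  -- the case `a ≥ y`
  have h2 : ∀ k : ℕ, ∀ a, y ≤ a → a < y + h + k →
      shift K (m - f a * h) (σ ∘ vec q m h A lo y x a) ∈ family q m h A f lo y x 0 := by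
    intro k
    induction k with
    | zero => intro a h2 h3; exact h1 a h2 (by simpa using h3)
    | succ k ih =>
      intro a h2 h3
      by_cases h4 : a < y + h
      · exact h1 a h2 h4
      · have h5 := ih (a - h) (by omega) (by push_cast at h3; omega)
        have h6 := F.apply_add (a := a - h) (by omega)
        have h7 := F.vec_of_sub_mem (q := q) hx (F.mem_of_le a h2) (F.mem_of_le (a - h) (by omega))
        rw [sub_add_cancel] at h6
        have h8 : F.partners a = ∅ := by
          refine Finset.eq_empty_of_forall_notMem fun b hb => ?_
          exact IsFrame.not_isPair (F.mem_of_le (a - h) (by omega)) h6 (F.mem_partners.1 hb)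
        rw [h8, Finset.sum_empty, add_zero] at h7
        rw [h7, comp_shift, shift_shift, h6]
        rwa [show (m : ℤ) - (f (a - h) + 1 : ℕ) * h + h = m - f (a - h) * h by
          push_cast; ring]
  -- the general case
  have h3 : ∀ k : ℕ, ∀ a ∈ A, y - k ≤ a →
      shift K (m - f a * h) (σ ∘ vec q m h A lo y x a) ∈ family q m h A f lo y x 0 := by
    intro k
    induction k with
    | zero => intro a _ h3; exact h2 (a - y).toNat a (by simpa using h3) (by omega)
    | succ k ih =>
      intro a ha h3
      by_cases h4 : y - k ≤ a
      · exact ih a ha h4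
      · push_cast at h3
        have hlev : ∀ b ∈ A, f a + 1 ≤ f b → y - k ≤ b → vec q m h A lo y x b ∈
            levelSubspace m h σ (family q m h A f lo y x 0) (f a + 1) := by
          intro b hb h5 h6
          exact levelSubspace_anti hL h5 ⟨vec_mem_family hb (Nat.zero_le _), ih b hb h6⟩
        have h5 : shift K h (vec q m h A lo y x a) ∈
            levelSubspace m h σ (family q m h A f lo y x 0) (f a + 1) := by
          rw [F.shift_vec hx ha]
          refine Submodule.sub_mem _ (hlev _ (F.add_mem a ha) (F.succ_le a ha) (by omega))
            (Submodule.sum_mem _ fun b hb => Submodule.smul_mem _ _ ?_)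
          obtain ⟨h6, h7, h8⟩ := F.lt_of_mem_partners ha hb
          exact hlev b h6 h7 (by omega)
        exact ((shift_mem_levelSubspace_iff hL (vec_mem_family ha (Nat.zero_le _))).1 h5).2
  exact h3 (y - a).toNat a ha (by omega)

/-- The closed span of the `v(a)` with `φ(a) ≥ n` is contained in the `n`-th level of the lattice;
the converse needs genericity of the parameters. -/
theorem IsFrame.family_le_levelSubspace (F : IsFrame m h A f lo y) (hq : q ≠ 0)
    (hσ : ∀ z, σ z = z ^ q) (hx : ∀ a b, ¬ IsPair h A f a b → x a b = 0) (n : ℕ) :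
    family q m h A f lo y x n ≤ levelSubspace m h σ (family q m h A f lo y x 0) n := by
  intro v hv
  have hL := F.isFunLattice_family (q := q) hx
  obtain ⟨D, hD⟩ := exists_tail_le_levelSubspace (m := m) (σ := σ) hL n
  obtain ⟨T, c, hT, hr⟩ := exists_sum_of_mem_family hv D
  have h1 := hD hr
  rw [Submodule.sub_mem_iff_left] at h1
  · exact h1
  · refine Submodule.sum_mem _ fun a ha => Submodule.smul_mem _ _ ?_
    exact levelSubspace_anti hL (hT a ha).2
      ⟨vec_mem_family (hT a ha).1 (Nat.zero_le _), F.frobenius_vec_mem hq hσ hx (hT a ha).1⟩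

end Family

/-! ### The parameters that belong to the stratum -/

section Generic

variable {K : Type*} [Field K] {m h : ℕ} {A : Set ℤ} {f : ℤ → ℕ} {lo y : ℤ} {q : ℕ}

theorem IsFrame.finite_level (F : IsFrame m h A f lo y) (n : ℕ) : {a | a ∈ A ∧ f a = n}.Finite := by
  obtain ⟨D, -, hD⟩ := F.exists_le_apply (n + 1)
  refine (Set.finite_Icc lo D).subset fun a ha => ⟨F.le_of_mem a ha.1, ?_⟩
  by_contra hlt
  have h1 := hD a (not_le.1 hlt).le
  have h2 := ha.2
  omega

/-- The finite set of the `a ∈ A` with `φ(a) = n`. -/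
noncomputable def IsFrame.level (F : IsFrame m h A f lo y) (n : ℕ) : Finset ℤ :=
  (F.finite_level n).toFinset

theorem IsFrame.mem_level (F : IsFrame m h A f lo y) {n : ℕ} {a : ℤ} :
    a ∈ F.level n ↔ a ∈ A ∧ f a = n := by
  simp [level]

/-- The coefficients of `t v(a)` modulo the `v(b)` with `φ(b) > φ(a) + 1`. -/
def transfer {R : Type*} [CommRing R] (h : ℕ) (x : ℤ → ℤ → R) (a b : ℤ) : R :=
  (if b = a + h then 1 else 0) - x (a + h) b

/-- The condition on the parameters `x` that multiplication by `t` is injective on the graded space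
attached to the filtration of the lattice by the closed spans of the `v(a)` with `φ(a) ≥ n`. It
characterizes the lattices in the stratum. -/
def IsFrame.IsGeneric {R : Type*} [CommRing R] (F : IsFrame m h A f lo y) (x : ℤ → ℤ → R) : Prop :=
  ∀ n, ∀ c : ℤ → R, (∀ b ∈ F.level (n + 1), ∑ a ∈ F.level n, c a * transfer h x a b = 0) →
    ∀ a ∈ F.level n, c a = 0

variable {x : ℤ → ℤ → K}

theorem IsFrame.shift_vec_sub_mem (F : IsFrame m h A f lo y)
    (hx : ∀ a b, ¬ IsPair h A f a b → x a b = 0) {n : ℕ} {a : ℤ} (ha : a ∈ F.level n) :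
    shift K h (vec q m h A lo y x a) -
      ∑ b ∈ F.level (n + 1), transfer h x a b • vec q m h A lo y x b ∈
      family q m h A f lo y x (n + 2) := by
  classical
  obtain ⟨haA, han⟩ := F.mem_level.1 ha
  have h1 := F.succ_le a haA
  have e : ∑ b ∈ F.level (n + 1), transfer h x a b • vec q m h A lo y x b =
      (∑ b ∈ F.level (n + 1), (if b = a + h then vec q m h A lo y x b else 0)) -
      ∑ b ∈ F.level (n + 1), x (a + h) b • vec q m h A lo y x b := by
    rw [← Finset.sum_sub_distrib]
    refine Finset.sum_congr rfl fun b _ => ?_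
    rw [transfer, sub_smul]
    split_ifs <;> simp
  rw [F.shift_vec hx haA, e, sub_sub_sub_comm]
  refine Submodule.sub_mem _ ?_ ?_
  · rw [Finset.sum_ite_eq' (F.level (n + 1)) (a + (h : ℤ)) (fun b => vec q m h A lo y x b)]
    split_ifs with h2
    · rw [sub_self]; exact Submodule.zero_mem _
    · rw [sub_zero]
      refine vec_mem_family (F.add_mem a haA) ?_
      rw [F.mem_level] at h2
      have : f (a + h) ≠ n + 1 := fun h3 => h2 ⟨F.add_mem a haA, h3⟩
      omega
  · have h2 : ∑ b ∈ F.level (n + 1), x (a + h) b • vec q m h A lo y x b =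
        ∑ b ∈ (F.partners (a + h)).filter (fun b => f b = n + 1),
          x (a + h) b • vec q m h A lo y x b := by
      symm
      apply Finset.sum_subset
      · intro b hb
        obtain ⟨h3, h4⟩ := Finset.mem_filter.1 hb
        exact F.mem_level.2 ⟨(F.mem_partners.1 h3).2.1, h4⟩
      · intro b hb hb'
        rw [hx, zero_smul]
        intro h3
        exact hb' (Finset.mem_filter.2 ⟨F.mem_partners.2 h3, (F.mem_level.1 hb).2⟩)
    rw [h2, ← Finset.sum_filter_add_sum_filter_not (F.partners (a + h)) (fun b => f b = n + 1),
      add_sub_cancel_left]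
    refine Submodule.sum_mem _ fun b hb => Submodule.smul_mem _ _ ?_
    obtain ⟨h3, h4⟩ := Finset.mem_filter.1 hb
    obtain ⟨h5, h6, -⟩ := F.lt_of_mem_partners haA h3
    exact vec_mem_family h5 (by omega)

theorem IsFrame.sum_vec_sub_mem (F : IsFrame m h A f lo y) {n : ℕ} {v : ℤ → K}
    (hv : v ∈ family q m h A f lo y x n) :
    ∃ c : ℤ → K, v - ∑ a ∈ F.level n, c a • vec q m h A lo y x a ∈
      family q m h A f lo y x (n + 1) := by
  classical
  obtain ⟨D, hD1, hD2⟩ := F.exists_le_apply (n + 1)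
  obtain ⟨T, c, hT, hr⟩ := exists_sum_of_mem_family hv D
  have h1 := F.tail_le_family (q := q) (x := x)
    (fun a ha => ⟨F.mem_of_le a (by omega), hD2 a ha⟩) hr
  refine ⟨fun a => if a ∈ T then c a else 0, ?_⟩
  have h2 : ∑ a ∈ F.level n, (if a ∈ T then c a else 0) • vec q m h A lo y x a =
      ∑ a ∈ T.filter (fun a => f a = n), c a • vec q m h A lo y x a := by
    symm
    rw [Finset.sum_congr rfl (fun a ha => by rw [← if_pos (Finset.mem_filter.1 ha).1 (t := c a)
      (e := 0)])]
    apply Finset.sum_subset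
    · intro b hb
      obtain ⟨h3, h4⟩ := Finset.mem_filter.1 hb
      exact F.mem_level.2 ⟨(hT b h3).1, h4⟩
    · intro b hb hb'
      rw [if_neg, zero_smul]
      exact fun h3 => hb' (Finset.mem_filter.2 ⟨h3, (F.mem_level.1 hb).2⟩)
  rw [h2]
  have h3 : ∑ a ∈ T.filter (fun a => ¬ f a = n), c a • vec q m h A lo y x a ∈
      family q m h A f lo y x (n + 1) := by
    refine Submodule.sum_mem _ fun a ha => Submodule.smul_mem _ _ ?_
    obtain ⟨h4, h5⟩ := Finset.mem_filter.1 ha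
    have := hT a h4
    exact vec_mem_family this.1 (by omega)
  have := Submodule.add_mem _ h1 h3
  rw [← Finset.sum_filter_add_sum_filter_not T (fun a => f a = n)] at this
  convert this using 1
  abel

theorem IsFrame.shift_sum_sub_mem (F : IsFrame m h A f lo y)
    (hx : ∀ a b, ¬ IsPair h A f a b → x a b = 0) (n : ℕ) (c : ℤ → K) :
    shift K h (∑ a ∈ F.level n, c a • vec q m h A lo y x a) -
      ∑ b ∈ F.level (n + 1), (∑ a ∈ F.level n, c a * transfer h x a b) • vec q m h A lo y x b ∈
      family q m h A f lo y x (n + 2) := by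
  have e : ∑ b ∈ F.level (n + 1), (∑ a ∈ F.level n, c a * transfer h x a b) •
      vec q m h A lo y x b = ∑ a ∈ F.level n, c a • ∑ b ∈ F.level (n + 1),
        transfer h x a b • vec q m h A lo y x b := by
    simp only [Finset.sum_smul, Finset.smul_sum, smul_smul]
    exact Finset.sum_comm
  rw [e, map_sum, ← Finset.sum_sub_distrib]
  refine Submodule.sum_mem _ fun a ha => ?_
  rw [map_smul, ← smul_sub]
  exact Submodule.smul_mem _ _ (F.shift_vec_sub_mem hx ha)

theorem IsFrame.coeff_eq_zero_of_sum_mem (F : IsFrame m h A f lo y) {n : ℕ} {c : ℤ → K}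
    (hc : ∑ a ∈ F.level n, c a • vec q m h A lo y x a ∈ family q m h A f lo y x (n + 1)) :
    ∀ a ∈ F.level n, c a = 0 := by
  by_contra! hne
  obtain ⟨a, ha, -, hl⟩ := F.sum_leads x (q := q) (fun a ha => (F.mem_level.1 ha).1) hne
  have h1 := (F.leads_family hc hl).2
  have h2 := (F.mem_level.1 ha).2
  omega

/-- If `x` is generic, then multiplication by `t` raises the filtration degree by exactly one. -/
theorem IsFrame.IsGeneric.mem_family_succ {F : IsFrame m h A f lo y} (hg : F.IsGeneric x)
    (hx : ∀ a b, ¬ IsPair h A f a b → x a b = 0) {n : ℕ} {v : ℤ → K}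
    (hv : v ∈ family q m h A f lo y x n)
    (hv' : shift K h v ∈ family q m h A f lo y x (n + 2)) :
    v ∈ family q m h A f lo y x (n + 1) := by
  obtain ⟨c, hc⟩ := F.sum_vec_sub_mem hv
  have h1 := F.shift_mem_family hx hc
  rw [map_sub] at h1
  have h2 := Submodule.sub_mem _ (Submodule.sub_mem _ hv' h1) (F.shift_sum_sub_mem (q := q) hx n c)
  rw [sub_sub_cancel, sub_sub_cancel] at h2
  have h3 := hg n c (F.coeff_eq_zero_of_sum_mem h2)
  rwa [Finset.sum_eq_zero (fun a ha => by rw [h3 a ha, zero_smul]), sub_zero] at hc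

variable {σ : K →+* K}

theorem IsFrame.levelSubspace_le_family_of_ge (F : IsFrame m h A f lo y) (hq : q ≠ 0)
    (hσ : ∀ z, σ z = z ^ q) (hx : ∀ a b, ¬ IsPair h A f a b → x a b = 0) {n : ℕ}
    (hn : (y + m - lo).toNat ≤ n) :
    levelSubspace m h σ (family q m h A f lo y x 0) n ≤ family q m h A f lo y x n := by
  obtain ⟨D, hD1, hD2⟩ := F.exists_le_apply n
  refine le_of_leads (F.family_le_levelSubspace hq hσ hx n)
    (F.tail_le_family (D := D) fun a ha => ⟨F.mem_of_le a (by omega), hD2 a ha⟩)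
    ((fun v hv => hv.1 : _ ≤ _).trans (F.family_le 0)) ?_
  rintro v ⟨hv1, hv2⟩ a ha
  have haA := (F.leads_family hv1 ha).1
  have h1 := (F.leads_family hv2 (ha.comp.shift _)).1
  refine ⟨_, vec_mem_family haA ?_, F.vec_leads x haA⟩
  rw [← add_sub_assoc] at h1
  by_cases hay : y ≤ a
  · exact F.le_of_image_mem hay h1
  · have h2 := F.le_of_mem _ h1
    have h3 : (n : ℤ) ≤ n * h := by nlinarith [F.h_pos_int, Int.natCast_nonneg n]
    omega

/-- For large `n` the `n`-th level is the closed span of the `v(a)` with `φ(a) ≥ n`, for any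
parameters. Genericity extends this to all `n`: if `v` is of level `n`, then `t v` is of level
`n + 1`, and multiplication by `t` loses no filtration degree beyond one. -/
theorem IsFrame.IsGeneric.levelSubspace_le_family {F : IsFrame m h A f lo y} (hg : F.IsGeneric x)
    (hq : q ≠ 0) (hσ : ∀ z, σ z = z ^ q) (hx : ∀ a b, ¬ IsPair h A f a b → x a b = 0) (n : ℕ) :
    levelSubspace m h σ (family q m h A f lo y x 0) n ≤ family q m h A f lo y x n := by
  have hL := F.isFunLattice_family (q := q) hx
  -- descending induction on `n`
  have key : ∀ k n : ℕ, (y + m - lo).toNat ≤ n + k →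
      levelSubspace m h σ (family q m h A f lo y x 0) n ≤ family q m h A f lo y x n := by
    intro k
    induction k with
    | zero => intro n hn; exact F.levelSubspace_le_family_of_ge hq hσ hx hn
    | succ k ih =>
      intro n hn v hv
      have h1 := ih (n + 1) (by omega) ((shift_mem_levelSubspace_iff hL hv.1).2 hv)
      have h2 : ∀ i ≤ n, v ∈ family q m h A f lo y x i := by
        intro i
        induction i with
        | zero => intro _; exact hv.1
        | succ i ih' =>
          intro hi
          exact hg.mem_family_succ hx (ih' (by omega)) (family_anti (by omega) h1)
      exact h2 n le_rfl
  exact key _ n (Nat.le_add_left _ _)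

/-- The lattice with parameters `x` has the invariants `(A, φ)` if and only if `x` is generic. -/
theorem IsFrame.hasInvariants_family_iff (F : IsFrame m h A f lo y) (hq : q ≠ 0)
    (hσ : ∀ z, σ z = z ^ q) (hx : ∀ a b, ¬ IsPair h A f a b → x a b = 0) :
    HasInvariants m h σ A f (family q m h A f lo y x 0) ↔ F.IsGeneric x := by
  have hL := F.isFunLattice_family (q := q) hx
  constructor
  · intro hI n c hc
    set w := ∑ a ∈ F.level n, c a • vec q m h A lo y x a with hw
    have h1 := F.shift_sum_sub_mem (q := q) hx n c
    rw [Finset.sum_eq_zero (s := F.level (n + 1)) (fun b hb => by rw [hc b hb, zero_smul]),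
      sub_zero] at h1
    have h2 : w ∈ family q m h A f lo y x 0 := Submodule.sum_mem _ fun a ha =>
      Submodule.smul_mem _ _ (vec_mem_family (F.mem_level.1 ha).1 (Nat.zero_le _))
    have h3 := (shift_mem_levelSubspace_iff (m := m) (σ := σ) (n := n + 1) hL h2).1
      (F.family_le_levelSubspace hq hσ hx _ h1)
    by_contra! hne
    obtain ⟨a, ha, -, hl⟩ := F.sum_leads x (q := q) (fun a ha => (F.mem_level.1 ha).1) hne
    obtain ⟨haA, han⟩ := F.mem_level.1 ha
    have := (hI.level_iff a haA (n + 1)).1 ⟨w, h3, hl⟩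
    omega
  · intro hg
    refine ⟨fun a => ⟨?_, fun ha => ⟨_, vec_mem_family ha (Nat.zero_le _), F.vec_leads x ha⟩⟩,
      fun a ha n => ⟨?_, fun hn => ⟨_, F.family_le_levelSubspace hq hσ hx n
        (vec_mem_family ha hn), F.vec_leads x ha⟩⟩⟩
    · rintro ⟨v, hv, hl⟩
      exact (F.leads_family hv hl).1
    · rintro ⟨v, hv, hl⟩
      exact (F.leads_family (hg.levelSubspace_le_family hq hσ hx n hv) hl).2

/-- The coefficient of `e_{a + d}` in `v(a)` depends only on the parameters at `(a, a + d)` and at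
the pairs that come earlier, when pairs are compared first by the difference and then by the rank
of their members. -/
theorem IsFrame.coef_sub_coef (F : IsFrame m h A f lo y) {R : Type*} [CommRing R]
    {x x' : ℤ → ℤ → R} (hx : ∀ a b, ¬ IsPair h A f a b → x a b = 0)
    (hx' : ∀ a b, ¬ IsPair h A f a b → x' a b = 0) {a : ℤ} (ha : a ∈ A) {d : ℕ}
    (heq : ∀ a' ∈ A, ∀ d', (d' < d ∨ d' = d ∧ rank m h lo y a' < rank m h lo y a) →
      x a' (a' + d') = x' a' (a' + d')) :
    coef q m h A lo y x d a - coef q m h A lo y x' d a = x a (a + d) - x' a (a + d) := by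
  generalize hp : toLex (d, rank m h lo y a) = p
  induction p using WellFoundedLT.induction generalizing d a with
  | _ p ih =>
  subst hp
  have hxx : ∀ a, x a a = x' a a := fun a => by
    rw [hx a a fun h => h.2.2.1.false, hx' a a fun h => h.2.2.1.false]
  have ih1 : ∀ d' < d, ∀ a ∈ A, coef q m h A lo y x d' a = coef q m h A lo y x' d' a := by
    intro d' hd' a' ha'
    have := ih (toLex (d', rank m h lo y a')) (Prod.Lex.toLex_lt_toLex.2 (Or.inl hd')) ha'
      (fun a'' ha'' d'' h'' => heq a'' ha'' d'' (Or.inl (by omega))) rfl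
    rwa [heq a' ha' d' (Or.inl hd'), sub_self, sub_eq_zero] at this
  have ih2 : ∀ a' ∈ A, rank m h lo y a' < rank m h lo y a →
      coef q m h A lo y x d a' = coef q m h A lo y x' d a' := by
    intro a' ha' hlt
    have := ih (toLex (d, rank m h lo y a')) (Prod.Lex.toLex_lt_toLex.2 (Or.inr ⟨rfl, hlt⟩)) ha'
      (fun a'' ha'' d'' h'' => heq a'' ha'' d'' (by omega)) rfl
    rwa [heq a' ha' d (Or.inr ⟨rfl, hlt⟩), sub_self, sub_eq_zero] at this
  have hsum : ∑ b ∈ Finset.Ioc a (a + d), x a b * coef q m h A lo y x (a + d - b).toNat b -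
      ∑ b ∈ Finset.Ioc a (a + d), x' a b * coef q m h A lo y x' (a + d - b).toNat b =
      x a (a + d) - x' a (a + d) := by
    rcases Nat.eq_zero_or_pos d with rfl | hd
    · simp [hxx]
    rw [← Finset.sum_Ioo_add_eq_sum_Ioc (by omega), ← Finset.sum_Ioo_add_eq_sum_Ioc (by omega)]
    have hmid : ∑ b ∈ Finset.Ioo a (a + d), x a b * coef q m h A lo y x (a + d - b).toNat b =
        ∑ b ∈ Finset.Ioo a (a + d), x' a b * coef q m h A lo y x' (a + d - b).toNat b := by
      refine Finset.sum_congr rfl fun b hb => ?_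
      obtain ⟨h1, h2⟩ := Finset.mem_Ioo.1 hb
      by_cases hp : IsPair h A f a b
      · rw [ih1 (a + d - b).toNat (by omega) b hp.2.1]
        congr 1
        have := heq a ha (b - a).toNat (Or.inl (by omega))
        rwa [show a + ((b - a).toNat : ℤ) = b by omega] at this
      · rw [hx a b hp, hx' a b hp, zero_mul, zero_mul]
    rw [hmid, add_sub_add_left_eq_sub, sub_self, Int.toNat_zero]
    by_cases hp : IsPair h A f a (a + d)
    · rw [F.coef_zero hp.2.1, F.coef_zero hp.2.1, mul_one, mul_one]
    · rw [hx _ _ hp, hx' _ _ hp, zero_mul, zero_mul]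
  obtain ⟨h1, h2, h3⟩ := F.coef_eq (q := q) (x := x) ha d
  obtain ⟨h1', h2', h3'⟩ := F.coef_eq (q := q) (x := x') ha d
  by_cases c1 : a - h ∈ A
  · rw [h1 c1, h1' c1, ih2 _ c1 (F.rank_sub c1), add_sub_add_left_eq_sub, hsum]
  · by_cases c2 : a = y
    · rw [h2 c2, h2' c2, add_sub_add_left_eq_sub, hsum]
    · rw [h3 c1 c2, h3' c1 c2, ih2 _ (F.mem_of_le _ (F.sourceOf_mem a).1)
        (F.rank_sourceOf ha c1 c2), add_sub_add_left_eq_sub, hsum]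

/-- The element `v(a)` up to `e_{a + d}`, in its dependence on the parameter at `(a, a + d)`. -/
theorem IsFrame.vec_sub_vec_mem (F : IsFrame m h A f lo y)
    {x x' : ℤ → ℤ → K} (hx : ∀ a b, ¬ IsPair h A f a b → x a b = 0)
    (hx' : ∀ a b, ¬ IsPair h A f a b → x' a b = 0) {a : ℤ} (ha : a ∈ A) {d : ℕ}
    (heq : ∀ a' ∈ A, ∀ d', (d' < d ∨ d' = d ∧ rank m h lo y a' < rank m h lo y a) →
      x a' (a' + d') = x' a' (a' + d')) :
    vec q m h A lo y x a - vec q m h A lo y x' a -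
      Pi.single (a + d) (x a (a + d) - x' a (a + d)) ∈ tail K (a + d + 1) := by
  intro n hn
  rw [Pi.sub_apply, Pi.sub_apply]
  rcases lt_or_ge n a with h1 | h1
  · rw [vec_of_lt q x h1, vec_of_lt q x' h1, Pi.single_eq_of_ne (by omega)]; simp
  · obtain ⟨e, he⟩ := Int.eq_ofNat_of_zero_le (a := n - a) (by omega)
    obtain rfl : n = a + e := by omega
    rw [vec_add, vec_add, F.coef_sub_coef hx hx' ha (fun a' ha' d' hd' => heq a' ha' d' (by omega))]
    rcases eq_or_lt_of_le (show e ≤ d by omega) with rfl | h2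
    · simp
    · rw [heq a ha e (Or.inl h2), Pi.single_eq_of_ne (by omega)]; simp

/-- Different parameters define different lattices in the stratum. -/
theorem IsFrame.eq_of_family_eq (F : IsFrame m h A f lo y) (hq : q ≠ 0)
    (hσ : ∀ z, σ z = z ^ q) {x x' : ℤ → ℤ → K} (hx : ∀ a b, ¬ IsPair h A f a b → x a b = 0)
    (hx' : ∀ a b, ¬ IsPair h A f a b → x' a b = 0) (hg : F.IsGeneric x)
    (he : family q m h A f lo y x 0 = family q m h A f lo y x' 0) : x = x' := by
  have key : ∀ p : ℕ ×ₗ ℕ, ∀ a ∈ A, ∀ d, toLex (d, rank m h lo y a) = p →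
      x a (a + d) = x' a (a + d) := by
    intro p
    induction p using WellFoundedLT.induction with
    | _ p ih =>
    rintro a ha d rfl
    by_cases hp : IsPair h A f a (a + d)
    · by_contra hne
      -- otherwise the difference of the two elements has its leading term at `a + d`
      have h1 : ∀ x'' : ℤ → ℤ → K, (∀ a b, ¬ IsPair h A f a b → x'' a b = 0) →
          family q m h A f lo y x 0 = family q m h A f lo y x'' 0 →
          vec q m h A lo y x'' a ∈ levelSubspace m h σ (family q m h A f lo y x 0) (f a) := by
        intro x'' hx'' he
        rw [he]
        exact F.family_le_levelSubspace hq hσ hx'' _ (vec_mem_family ha le_rfl)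
      have h2 := Submodule.sub_mem _ (h1 x hx rfl) (h1 x' hx' he)
      have h3 := F.vec_sub_vec_mem (q := q) hx hx' ha (d := d) fun a' ha' d' hd' =>
        ih _ (Prod.Lex.toLex_lt_toLex.2 hd') a' ha' d' rfl
      have h4 : Leads (Pi.single (a + d) (x a (a + d) - x' a (a + d)) : ℤ → K) (a + d) :=
        ⟨by simpa using sub_ne_zero.2 hne, fun n hn => Pi.single_eq_of_ne hn.ne _⟩
      have h5 := h4.congr (by rw [← neg_sub]; exact Submodule.neg_mem _ h3)
      have hI := (F.hasInvariants_family_iff hq hσ hx).2 hg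
      have := (hI.level_iff _ hp.2.1 (f a)).1 ⟨_, h2, h5⟩
      have := hp.2.2.2.1
      omega
    · rw [hx _ _ hp, hx' _ _ hp]
  funext a b
  by_cases hp : IsPair h A f a b
  · have := key _ a hp.1 (b - a).toNat rfl
    rwa [show a + ((b - a).toNat : ℤ) = b by have := hp.2.2.1; omega] at this
  · rw [hx a b hp, hx' a b hp]

end Generic

/-! ### The parameters of a given lattice -/

section Recovery

variable {K : Type*} [Field K] {m h : ℕ} {A : Set ℤ} {f : ℤ → ℕ} {lo y : ℤ} {q : ℕ}
  {σ : K →+* K} {L : Submodule K (ℤ → K)}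

theorem HasInvariants.le_tail (hI : HasInvariants m h σ A f L) (F : IsFrame m h A f lo y)
    (hL : IsFunLattice h L) : L ≤ tail K lo := by
  intro v hv
  obtain ⟨D, hD⟩ := hL.exists_le
  by_cases h0 : v = 0
  · rw [h0]; exact Submodule.zero_mem _
  · obtain ⟨a, ha⟩ := exists_leads (hD hv) h0
    have := F.le_of_mem a ((hI.leads_iff a).1 ⟨v, hv, ha⟩)
    exact fun n hn => ha.2 n (by omega)

theorem tail_le_of_leads (hL : ∃ D, tail K D ≤ L) {D : ℤ} (hD : ∀ a, D ≤ a → ∃ v ∈ L, Leads v a) :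
    tail K D ≤ L := by
  obtain ⟨D', hD'⟩ := hL
  refine (le_of_leads (D := D) (D' := max D D') (inf_le_right (a := L) (b := tail K D))
    (le_inf ((tail_anti (le_max_right _ _)).trans hD') (tail_anti (le_max_left _ _)))
    le_rfl ?_).trans inf_le_left
  intro v hv a ha
  have haD : D ≤ a := by
    by_contra hlt
    exact ha.1 (hv a (by omega))
  obtain ⟨w, hw, hw'⟩ := hD a haD
  exact ⟨w, ⟨hw, fun n hn => hw'.2 n (by omega)⟩, hw'⟩

theorem HasInvariants.tail_le (hI : HasInvariants m h σ A f L) (F : IsFrame m h A f lo y)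
    (hL : IsFunLattice h L) : tail K y ≤ L :=
  tail_le_of_leads hL.exists_ge fun a ha => (hI.leads_iff a).2 (F.mem_of_le a ha)

theorem HasInvariants.level_zero (hI : HasInvariants m h σ A f L) (hL : IsFunLattice h L) :
    levelSubspace m h σ L 0 = L := by
  refine le_antisymm (fun v hv => hv.1) ?_
  obtain ⟨D, hD⟩ := hL.exists_le
  obtain ⟨D', hD'⟩ := exists_tail_le_levelSubspace (m := m) (σ := σ) hL 0
  refine le_of_leads (fun v hv => hv.1) hD' hD fun v hv a ha => ?_
  exact (hI.level_iff a ((hI.leads_iff a).1 ⟨v, hv, ha⟩) 0).2 (Nat.zero_le _)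

/-- An element that lies in the `l`-th level up to `e_b`, and in the `n`-th level below `e_b`,
lies in the `n`-th level up to `e_b`, unless `l ≤ φ(b) < n`. -/
theorem HasInvariants.mem_sup_tail_succ (hI : HasInvariants m h σ A f L) (hL : IsFunLattice h L)
    {w : ℤ → K} {l n : ℕ} (hln : l ≤ n) {b : ℤ}
    (h1 : w ∈ levelSubspace m h σ L l ⊔ tail K (b + 1))
    (h2 : w ∈ levelSubspace m h σ L n ⊔ tail K b) (hb : b ∈ A → l ≤ f b → n ≤ f b) :
    w ∈ levelSubspace m h σ L n ⊔ tail K (b + 1) := by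
  obtain ⟨u', hu', r', hr', rfl⟩ := Submodule.mem_sup.1 h1
  obtain ⟨u, hu, r, hr, he⟩ := Submodule.mem_sup.1 h2
  have h3 : u' - u ∈ levelSubspace m h σ L l :=
    Submodule.sub_mem _ hu' (levelSubspace_anti hL hln hu)
  have h4 : r = (u' - u) + r' := by rw [sub_add_eq_add_sub, ← he]; simp
  have h5 : u' - u ∈ tail K b := by
    have := Submodule.sub_mem _ hr (tail_anti (by omega) hr' : r' ∈ tail K b)
    rwa [h4, add_sub_cancel_right] at this
  rcases mem_tail_succ_or_leads h5 with h6 | h6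
  · refine Submodule.mem_sup.2 ⟨u, hu, r, ?_, he⟩
    rw [h4]
    exact Submodule.add_mem _ h6 hr'
  · have hbA := (hI.leads_iff b).1 ⟨_, h3.1, h6⟩
    have hlb := (hI.level_iff b hbA l).1 ⟨_, h3, h6⟩
    obtain ⟨w, hw, hw'⟩ := (hI.level_iff b hbA n).2 (hb hbA hlb)
    have h7 := hw'.sub_smul_mem h5
    refine Submodule.mem_sup.2 ⟨u + ((u' - u) b / w b) • w,
      Submodule.add_mem _ hu (Submodule.smul_mem _ _ hw), _, Submodule.add_mem _ h7 hr', ?_⟩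
    abel

open Classical in
/-- The parameters of the lattice `L`, chosen one after the other in the order of the differences
`b - a` and of the ranks of the `a`: the parameter at `(a, b)` is such that `v(a)` belongs
up to `e_b` to the elements `v` of `L` with `t ^ (-φ(a)) b σ(v) ∈ L`. -/
noncomputable def recovered {K : Type*} [Field K] (q m h : ℕ) (A : Set ℤ) (f : ℤ → ℕ) (lo y : ℤ)
    (σ : K →+* K) (L : Submodule K (ℤ → K)) (a b : ℤ) : K :=
  if IsPair h A f a b then
    Classical.epsilon fun ξ : K => vec q m h A lo y (fun a' b' =>
      if a' = a ∧ b' = b then ξ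
      else if _ : ((b' - a').toNat < (b - a).toNat ∨ (b' - a').toNat = (b - a).toNat ∧
        rank m h lo y a' < rank m h lo y a) then recovered q m h A f lo y σ L a' b' else 0) a ∈
          levelSubspace m h σ L (f a) ⊔ tail K (b + 1)
  else 0
termination_by ((b - a).toNat, rank m h lo y a)
decreasing_by exact Prod.lex_def.2 ‹_›

theorem recovered_of_not_isPair (a b : ℤ) (hp : ¬ IsPair h A f a b) :
    recovered q m h A f lo y σ L a b = 0 := by
  rw [recovered, if_neg hp]

/-- At a pair `(a, a + d)` a suitable value of the parameter exists: it removes the coefficient at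
`e_{a + d}` of the difference from an element of the right level. -/
theorem IsFrame.vec_recovered_mem (F : IsFrame m h A f lo y) {a : ℤ} {d : ℕ}
    (hp : IsPair h A f a (a + d))
    (h0 : vec q m h A lo y (recovered q m h A f lo y σ L) a ∈
      levelSubspace m h σ L (f a) ⊔ tail K (a + d)) :
    vec q m h A lo y (recovered q m h A f lo y σ L) a ∈
      levelSubspace m h σ L (f a) ⊔ tail K (a + d + 1) := by
  classical
  let X := recovered q m h A f lo y σ L
  let Z : K → ℤ → ℤ → K := fun ξ a' b' =>
      if a' = a ∧ b' = a + d then ξ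
      else if ((b' - a').toNat < (a + d - a).toNat ∨ (b' - a').toNat = (a + d - a).toNat ∧
        rank m h lo y a' < rank m h lo y a) then X a' b' else 0
  have hX : ∀ a b, ¬ IsPair h A f a b → X a b = 0 := recovered_of_not_isPair
  have hZ : ∀ ξ a b, ¬ IsPair h A f a b → Z ξ a b = 0 := by
    intro ξ a' b' hp'
    simp only [Z]
    split_ifs with h1 h2
    · rw [h1.1, h1.2] at hp'; exact (hp' hp).elim
    · exact hX _ _ hp'
    · rfl
  have hZa : ∀ ξ, Z ξ a (a + d) = ξ := fun ξ => by simp [Z]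
  have heq : ∀ ξ, ∀ a' ∈ A, ∀ d' : ℕ, (d' < d ∨ d' = d ∧ rank m h lo y a' < rank m h lo y a) →
      Z ξ a' (a' + d') = X a' (a' + d') := by
    intro ξ a' _ d' hd'
    simp only [Z]
    rw [if_neg, if_pos]
    · simpa using hd'
    · rintro ⟨rfl, h2⟩
      have : d' = d := by omega
      subst this
      rcases hd' with h3 | h3
      · exact h3.false
      · exact h3.2.false
  have hdiff := fun ξ => F.vec_sub_vec_mem (q := q) (hZ ξ) hX hp.1 (heq ξ)
  simp only [hZa] at hdiff
  have hXab : X a (a + d) = Classical.epsilon fun ξ : K => vec q m h A lo y (Z ξ) a ∈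
      levelSubspace m h σ L (f a) ⊔ tail K (a + d + 1) := by
    simp only [X]
    rw [recovered, if_pos hp]
    rfl
  have hex : ∃ ξ : K, vec q m h A lo y (Z ξ) a ∈
      levelSubspace m h σ L (f a) ⊔ tail K (a + d + 1) := by
    obtain ⟨u, hu, r, hr, he⟩ := Submodule.mem_sup.1 h0
    refine ⟨X a (a + d) - r (a + d), ?_⟩
    have h1 := hdiff (X a (a + d) - r (a + d))
    rw [sub_sub_cancel_left] at h1
    have h2 : r + Pi.single (a + d) (-(r (a + d))) ∈ tail K (a + d + 1) := by
      intro n hn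
      rcases eq_or_lt_of_le (show n ≤ a + d by omega) with rfl | h3
      · simp
      · rw [Pi.add_apply, hr n h3, Pi.single_eq_of_ne h3.ne, add_zero]
    refine Submodule.mem_sup.2 ⟨u, hu, _, Submodule.add_mem _ h1 h2, ?_⟩
    change _ = vec q m h A lo y X a at he
    rw [← he]
    abel
  have hspec := Classical.epsilon_spec hex
  rw [← hXab] at hspec
  have h1 := hdiff (X a (a + d))
  rw [sub_self, Pi.single_zero, sub_zero] at h1
  have := Submodule.sub_mem _ hspec (Submodule.mem_sup_right
    (S := levelSubspace m h σ L (f a)) h1)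
  rwa [sub_sub_cancel] at this

/-- With the recovered parameters, `v(a)` belongs to the level `φ(a)` up to any given exponent. If
`(a, a + d)` is not a pair, there is no parameter to choose, but the terms of which `v(a)` is
composed belong to the level `φ(a - h) + 1`, or to `L` if `a - h` is not in `A`, and no element of
`A` at `a + d` has a level between this one and `φ(a)`. -/
theorem HasInvariants.vec_recovered_mem_sup (hI : HasInvariants m h σ A f L)
    (F : IsFrame m h A f lo y) (hL : IsFunLattice h L) (hq : q ≠ 0) (hσ : ∀ z, σ z = z ^ q)
    {a : ℤ} (ha : a ∈ A) (d : ℕ) :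
    vec q m h A lo y (recovered q m h A f lo y σ L) a ∈
      levelSubspace m h σ L (f a) ⊔ tail K (a + d + 1) := by
  classical
  generalize hp : toLex (d, rank m h lo y a) = p
  induction p using WellFoundedLT.induction generalizing d a with
  | _ p ih =>
  subst hp
  have hpow : ∀ v : ℤ → K, v ^ q = σ ∘ v := fun v => by funext n; simp [hσ]
  set X := recovered q m h A f lo y σ L with hXdef
  have hX : ∀ a b, ¬ IsPair h A f a b → X a b = 0 := recovered_of_not_isPair
  have ih1 : ∀ d' < d, ∀ a ∈ A, vec q m h A lo y X a ∈
      levelSubspace m h σ L (f a) ⊔ tail K (a + d' + 1) := fun d' hd' a ha =>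
    ih (toLex (d', rank m h lo y a)) (Prod.Lex.toLex_lt_toLex.2 (Or.inl hd')) ha d' rfl
  have ih2 : ∀ a' ∈ A, rank m h lo y a' < rank m h lo y a → vec q m h A lo y X a' ∈
      levelSubspace m h σ L (f a') ⊔ tail K (a' + d + 1) := fun a' ha' hlt =>
    ih (toLex (d, rank m h lo y a')) (Prod.Lex.toLex_lt_toLex.2 (Or.inr ⟨rfl, hlt⟩)) ha' d rfl
  have h0 : vec q m h A lo y X a ∈ levelSubspace m h σ L (f a) ⊔ tail K (a + d) := by
    rcases Nat.eq_zero_or_pos d with rfl | hd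
    · exact Submodule.mem_sup_right fun n hn => vec_of_lt q X (by simpa using hn)
    · have := ih1 (d - 1) (by omega) a ha
      rwa [show a + ((d - 1 : ℕ) : ℤ) + 1 = a + d by omega] at this
  by_cases hp : IsPair h A f a (a + d)
  · exact F.vec_recovered_mem hp h0
  -- the level of the elements from which `v(a)` is composed
  let l : ℕ := if a - h ∈ A then f (a - h) + 1 else 0
  have hl : l ≤ f a := by
    simp only [l]
    split_ifs with h1
    · simpa using F.succ_le _ h1
    · exact Nat.zero_le _
  have hpair : ∀ b, IsPair h A f a b → l ≤ f b := by
    intro b hb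
    simp only [l]
    split_ifs with h1
    · exact hb.2.2.2.2 h1
    · exact Nat.zero_le _
  have hsum : ∑ b ∈ F.partners a, X a b • vec q m h A lo y X b ∈
      levelSubspace m h σ L l ⊔ tail K (a + d + 1) := by
    refine Submodule.sum_mem _ fun b hb => Submodule.smul_mem _ _ ?_
    have hb' := F.mem_partners.1 hb
    have h1 : b ≠ a + d := fun h => hp (h ▸ hb')
    rcases lt_or_gt_of_ne h1 with h2 | h2
    · have h3 := ih1 (d - 1) (by have := hb'.2.2.1; omega) b hb'.2.1
      exact (sup_le_sup (levelSubspace_anti hL (hpair b hb')) (tail_anti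
        (by have := hb'.2.2.1; omega)) : _ ≤ levelSubspace m h σ L l ⊔ tail K (a + d + 1)) h3
    · exact Submodule.mem_sup_right fun n hn => vec_of_lt q X (by omega)
  refine hI.mem_sup_tail_succ hL hl ?_ h0 fun hb hlb => ?_
  · by_cases c1 : a - h ∈ A
    · rw [F.vec_of_sub_mem hX ha c1]
      refine Submodule.add_mem _ ?_ hsum
      obtain ⟨u, hu, r, hr, he⟩ := Submodule.mem_sup.1 (ih2 _ c1 (F.rank_sub c1))
      rw [← he, map_add]
      have h1 : l = f (a - h) + 1 := if_pos c1
      rw [h1]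
      refine Submodule.add_mem_sup ((shift_mem_levelSubspace_iff hL hu.1).2 hu) ?_
      exact tail_anti (by omega) (shift_mem_tail hr h)
    · have h1 : l = 0 := if_neg c1
      rw [h1, hI.level_zero hL] at hsum ⊢
      by_cases c2 : a = y
      · rw [c2] at hsum ⊢
        rw [F.vec_top hX]
        refine Submodule.add_mem _ (Submodule.mem_sup_left (hI.tail_le F hL fun n hn => ?_)) hsum
        exact Pi.single_eq_of_ne hn.ne _
      · have hsA := F.mem_of_le _ (F.sourceOf_mem (m := m) a).1
        rw [F.vec_of_sub_notMem hq hX ha c1 c2, hpow]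
        refine Submodule.add_mem _ ?_ hsum
        obtain ⟨u, hu, r, hr, he⟩ := Submodule.mem_sup.1 (ih2 _ hsA (F.rank_sourceOf ha c1 c2))
        have h2 : σ ∘ (u + r) = σ ∘ u + σ ∘ r := by funext n; simp
        rw [← he, h2, map_add]
        refine Submodule.add_mem_sup hu.2 ?_
        have h3 := F.image_sourceOf ha c1
        exact tail_anti (by linarith) (shift_mem_tail (comp_mem_tail hr) _)
  · by_contra hlt
    apply hp
    rcases Nat.eq_zero_or_pos d with rfl | hd
    · simp at hlt
    · refine ⟨ha, hb, by omega, by omega, fun c1 => ?_⟩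
      have h1 : l = f (a - h) + 1 := if_pos c1
      omega

theorem HasInvariants.vec_recovered_mem_level (hI : HasInvariants m h σ A f L)
    (F : IsFrame m h A f lo y) (hL : IsFunLattice h L) (hq : q ≠ 0) (hσ : ∀ z, σ z = z ^ q)
    {a : ℤ} (ha : a ∈ A) : vec q m h A lo y (recovered q m h A f lo y σ L) a ∈
      levelSubspace m h σ L (f a) := by
  obtain ⟨D, hD⟩ := exists_tail_le_levelSubspace (m := m) (σ := σ) hL (f a)
  have h1 := hI.vec_recovered_mem_sup F hL hq hσ ha (D - a).toNat
  rwa [sup_eq_left.2] at h1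
  exact (tail_anti (by omega)).trans hD

/-- Each lattice with the invariants `(A, φ)` belongs to the family. -/
theorem HasInvariants.eq_family (hI : HasInvariants m h σ A f L)
    (F : IsFrame m h A f lo y) (hL : IsFunLattice h L) (hq : q ≠ 0) (hσ : ∀ z, σ z = z ^ q) :
    L = family q m h A f lo y (recovered q m h A f lo y σ L) 0 := by
  have h2 : family q m h A f lo y (recovered q m h A f lo y σ L) 0 ≤ L := by
    intro v hv
    obtain ⟨D, hD⟩ := hL.exists_ge
    refine (sup_le (Submodule.span_le.2 ?_) hD : _ ≤ L) (mem_family.1 hv D)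
    rintro _ ⟨a, ha, rfl⟩
    exact (hI.vec_recovered_mem_level F hL hq hσ ha.1).1
  refine le_antisymm (le_of_leads h2 F.tail_le (hI.le_tail F hL) fun v hv a ha => ?_) h2
  have haA := (hI.leads_iff a).1 ⟨v, hv, ha⟩
  exact ⟨_, vec_mem_family haA (Nat.zero_le _), F.vec_leads _ haA⟩

end Recovery

/-! ### Matrices that depend on parameters -/

section Parameters

variable {K : Type*} [Field K] {P : Type*} [CommRing P] [Algebra K P]

/-- A matrix `T` over a `K`-algebra that is injective at a `K`-valued point has a multiple `B * T`
by a constant matrix `B` whose determinant does not vanish at this point. -/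
theorem exists_det_ne_zero {ι κ : Type*} [Fintype ι] [Fintype κ] [DecidableEq κ]
    (T : Matrix ι κ P) (χ : P →ₐ[K] K)
    (hT : ∀ c : κ → K, (∀ i, ∑ j, χ (T i j) * c j = 0) → c = 0) :
    ∃ B : Matrix κ ι K, χ (B.map (algebraMap K P) * T).det ≠ 0 := by
  classical
  have hinj : Function.Injective (Matrix.toLin' (T.map χ)) := by
    rw [injective_iff_map_eq_zero]
    intro c hc
    apply hT
    intro i
    exact congrFun hc i
  obtain ⟨g, hg⟩ := LinearMap.exists_leftInverse_of_injective _ (LinearMap.ker_eq_bot.2 hinj)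
  refine ⟨LinearMap.toMatrix' g, ?_⟩
  have h1 : LinearMap.toMatrix' g * T.map χ = 1 := by
    conv_lhs => rw [← LinearMap.toMatrix'_toLin' (T.map χ)]
    rw [← LinearMap.toMatrix'_comp, hg, LinearMap.toMatrix'_id]
  have h2 : (((LinearMap.toMatrix' g).map (algebraMap K P)) * T).map χ = 1 := by
    rw [← h1]
    ext i j
    simp [Matrix.mul_apply]
  rw [AlgHom.map_det, AlgHom.mapMatrix_apply, h2, Matrix.det_one]
  exact one_ne_zero

theorem eq_zero_of_det_ne_zero {ι κ : Type*} [Fintype ι] [Fintype κ] [DecidableEq κ]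
    {T : Matrix ι κ P} {χ : P →ₐ[K] K} {B : Matrix κ ι K}
    (hB : χ (B.map (algebraMap K P) * T).det ≠ 0) {c : κ → K}
    (hc : ∀ i, ∑ j, χ (T i j) * c j = 0) : c = 0 := by
  rw [AlgHom.map_det, AlgHom.mapMatrix_apply] at hB
  refine Matrix.eq_zero_of_mulVec_eq_zero hB ?_
  have h1 : (B.map (algebraMap K P) * T).map χ = B * T.map χ := by
    ext i j
    simp [Matrix.mul_apply]
  have h2 : (T.map χ).mulVec c = 0 := funext hc
  rw [h1, ← Matrix.mulVec_mulVec, h2, Matrix.mulVec_zero]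

/-- Cramer's rule for `B * T` instead of a square matrix. -/
theorem det_smul_eq_of_sum_eq {ι κ : Type*} [Fintype ι] [Fintype κ] [DecidableEq κ]
    (T : Matrix ι κ P) (B : Matrix κ ι K) (b : ι → P) (χ : P →ₐ[K] K) {c : κ → K}
    (hc : ∀ i, ∑ j, χ (T i j) * c j = χ (b i)) (j : κ) :
    χ (B.map (algebraMap K P) * T).det * c j =
      χ (((B.map (algebraMap K P) * T).adjugate.mulVec ((B.map (algebraMap K P)).mulVec b)) j) := by
  set M := B.map (algebraMap K P) * T with hM
  have h1 : M.map χ = B * T.map χ := by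
    ext i j
    simp [hM, Matrix.mul_apply]
  have h2 : (T.map χ).mulVec c = fun i => χ (b i) := funext hc
  have h3 : (M.map χ).mulVec c = fun i => χ ((B.map (algebraMap K P)).mulVec b i) := by
    rw [h1, ← Matrix.mulVec_mulVec, h2]
    funext i
    simp [Matrix.mulVec, dotProduct]
  have h4 := congrArg (fun v => (M.map χ).adjugate.mulVec v j) h3
  simp only [Matrix.mulVec_mulVec, Matrix.adjugate_mul, Matrix.smul_mulVec, Matrix.one_mulVec,
    Pi.smul_apply, smul_eq_mul] at h4
  rw [AlgHom.map_det, AlgHom.mapMatrix_apply, h4]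
  have h5 : (M.map χ).adjugate = M.adjugate.map χ := by
    rw [← AlgHom.mapMatrix_apply, ← AlgHom.mapMatrix_apply, AlgHom.map_adjugate]
  rw [h5]
  simp [Matrix.mulVec, dotProduct]

end Parameters

/-! ### The set of generic parameters -/

section Open

variable {m h : ℕ} {A : Set ℤ} {f : ℤ → ℕ} {lo y : ℤ}

/-- Multiplication by `t` is injective in the degrees in which `φ` increases by exactly one from `a`
to `a + h`, since then the matrix of its coefficients contains an identity matrix. -/
theorem IsFrame.injective_of_succ {R : Type*} [CommRing R] (F : IsFrame m h A f lo y) {n : ℕ}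
    (hn : ∀ a ∈ F.level n, f (a + h) = f a + 1) {x : ℤ → ℤ → R}
    (hx : ∀ a b, ¬ IsPair h A f a b → x a b = 0) {c : ℤ → R}
    (hc : ∀ b ∈ F.level (n + 1), ∑ a ∈ F.level n, c a * transfer h x a b = 0) :
    ∀ a ∈ F.level n, c a = 0 := by
  intro a ha
  obtain ⟨haA, han⟩ := F.mem_level.1 ha
  have h1 := hc (a + h) (F.mem_level.2 ⟨F.add_mem a haA, by rw [hn a ha, han]⟩)
  rw [Finset.sum_eq_single a] at h1
  · rw [transfer, if_pos rfl, hx, sub_zero, mul_one] at h1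
    · exact h1
    · exact fun h => h.2.2.1.false
  · intro a' ha' hne
    have hA' := (F.mem_level.1 ha').1
    rw [transfer, if_neg (by omega), hx, sub_zero, mul_zero]
    apply IsFrame.not_isPair <;> rw [add_sub_cancel_right]
    · exact hA'
    · exact hn a' ha'
  · exact fun h => (h ha).elim

theorem IsFrame.isGeneric_of_cyclic {R : Type*} [CommRing R] (F : IsFrame m h A f lo y)
    (hcyc : ∀ a ∈ A, f (a + h) = f a + 1) {x : ℤ → ℤ → R}
    (hx : ∀ a b, ¬ IsPair h A f a b → x a b = 0) : F.IsGeneric x :=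
  fun _ _ hc => F.injective_of_succ (fun a ha => hcyc a (F.mem_level.1 ha).1) hx hc

/-- There is a generic system of parameters: if `a + h` is not the successor of `a`, then the
parameter at `a + h` and the successor of `a` is one, and all others are zero. With this choice,
multiplication by `t` maps the class of `v(a)` in the graded space to the class of `v(b)` up to
sign, where `b` is the successor of `a`. -/
theorem IsFrame.exists_isGeneric (F : IsFrame m h A f lo y) {g : ℤ → ℤ}
    (hg : IsSuccessor h A f g) (R : Type*) [CommRing R] : ∃ x : ℤ → ℤ → R,
      (∀ a b, ¬ IsPair h A f a b → x a b = 0) ∧ F.IsGeneric x := by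
  classical
  refine ⟨fun a b => if a - h ∈ A ∧ f a ≠ f (a - h) + 1 ∧ b = g (a - h) then 1 else 0,
    fun a b hab => if_neg ?_, fun n c hc a ha => ?_⟩
  · rintro ⟨h1, h2, rfl⟩
    have := hg.isPair F.add_mem F.succ_le h1 (by rwa [sub_add_cancel])
    rw [sub_add_cancel] at this
    exact hab this
  · obtain ⟨haA, han⟩ := F.mem_level.1 ha
    have h1 := hc (g a) (F.mem_level.2 ⟨hg.mem a haA, by rw [hg.apply_eq a haA, han]⟩)
    rw [Finset.sum_eq_single a] at h1
    · rw [transfer] at h1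
      simp only [add_sub_cancel_right] at h1
      by_cases h2 : f (a + h) = f a + 1
      · rw [if_pos (hg.eq_add a haA h2), if_neg (fun h3 => h3.2.1 h2)] at h1
        simpa using h1
      · rw [if_neg (hg.add_lt a haA h2).ne', if_pos ⟨haA, h2, trivial⟩] at h1
        simpa using h1
    · intro a' ha' hne
      obtain ⟨hA', han'⟩ := F.mem_level.1 ha'
      have h3 : g a ≠ g a' := fun h => hne (hg.injOn haA hA' h).symm
      rw [transfer, if_neg, if_neg, sub_zero, mul_zero]
      · rw [add_sub_cancel_right]
        exact fun h => h3 h.2.2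
      · intro h4
        have h5 := hg.apply_eq a haA
        rw [h4, han, ← han'] at h5
        exact h3 (h4.trans (hg.eq_add a' hA' h5).symm)
    · exact fun h => (h ha).elim

/-- Genericity is an open condition. -/
theorem IsFrame.IsGeneric.exists_ne_zero {F : IsFrame m h A f lo y} {K : Type*} [Field K]
    {P : Type*} [CommRing P] [Algebra K P] {x : ℤ → ℤ → P}
    (hx : ∀ a b, ¬ IsPair h A f a b → x a b = 0) {χ : P →ₐ[K] K}
    (hg : F.IsGeneric fun a b => χ (x a b)) :
    ∃ p : P, χ p ≠ 0 ∧ ∀ χ' : P →ₐ[K] K, χ' p ≠ 0 → F.IsGeneric fun a b => χ' (x a b) := by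
  classical
  -- only finitely many degrees matter
  obtain ⟨N, hN⟩ := ((Set.finite_Icc lo y).image f).bddAbove
  have hlarge : ∀ n, N < n → ∀ a ∈ F.level n, f (a + h) = f a + 1 := by
    intro n hn a ha
    obtain ⟨haA, han⟩ := F.mem_level.1 ha
    refine F.apply_add ?_
    by_contra hlt
    have := hN ⟨a, ⟨F.le_of_mem a haA, by omega⟩, rfl⟩
    omega
  have htr : ∀ (χ : P →ₐ[K] K) a b, transfer h (fun a b => χ (x a b)) a b =
      χ (transfer h x a b) := by
    intro χ a b
    simp only [transfer, map_sub]
    split_ifs <;> simp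
  let T : ∀ n, Matrix (F.level (n + 1)) (F.level n) P := fun n b a => transfer h x a b
  have hT : ∀ n, ∃ B : Matrix (F.level n) (F.level (n + 1)) K,
      χ (B.map (algebraMap K P) * T n).det ≠ 0 := by
    intro n
    refine exists_det_ne_zero (T n) χ fun c hc => ?_
    funext a
    have := hg n (fun a => if ha : a ∈ F.level n then c ⟨a, ha⟩ else 0) (fun b hb => ?_) a a.2
    · simpa using this
    · rw [← Finset.sum_coe_sort (F.level n), ← hc ⟨b, hb⟩]
      refine Finset.sum_congr rfl fun a _ => ?_
      simp only [htr, a.2, dite_true, T]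
      ring
  choose B hB using hT
  refine ⟨∏ n ∈ Finset.range (N + 1), ((B n).map (algebraMap K P) * T n).det, ?_, ?_⟩
  · rw [map_prod]
    exact Finset.prod_ne_zero_iff.2 fun n _ => hB n
  · intro χ' hχ' n c hc
    by_cases hn : N < n
    · exact F.injective_of_succ (hlarge n hn) (fun a b hab => by rw [hx a b hab, map_zero]) hc
    · rw [map_prod] at hχ'
      have h1 := Finset.prod_ne_zero_iff.1 hχ' n (Finset.mem_range.2 (by omega))
      have h2 := eq_zero_of_det_ne_zero h1 (c := fun a => c a) ?_
      · intro a ha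
        exact congrFun h2 ⟨a, ha⟩
      · intro b
        rw [← hc b b.2, ← Finset.sum_coe_sort (F.level n)]
        refine Finset.sum_congr rfl fun a _ => ?_
        simp only [htr, T]
        ring

end Open

/-! ### Coordinates with respect to the `e_i` -/

section Coordinates

variable {R : Type*} [CommRing R] {h : ℕ}

theorem powerSeries_smul_apply (g : PowerSeries R) (v : Fin h → LaurentSeries R) (r : Fin h) :
    (g • v) r = HahnSeries.ofPowerSeries ℤ R g * v r := by
  rw [Pi.smul_apply, Algebra.smul_def, LaurentSeries.coe_algebraMap]

theorem X_pow_smul (n : ℕ) (v : Fin h → LaurentSeries R) :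
    (PowerSeries.X ^ n : PowerSeries R) • v =
      (HahnSeries.single (n : ℤ) (1 : R) : LaurentSeries R) • v := by
  funext r
  rw [powerSeries_smul_apply, HahnSeries.ofPowerSeries_X_pow]
  rfl

variable [NeZero h]

/-- The function that maps `i` to the coefficient of `v` at `e_i`. -/
def coord (v : Fin h → LaurentSeries R) (i : ℤ) : R :=
  (v (Fin.ofNat h (i % h).toNat)).coeff (i / h)

theorem coord_apply (v : Fin h → LaurentSeries R) (r : Fin h) (n : ℤ) :
    coord v (r + h * n) = (v r).coeff n := by
  have hh : (0 : ℤ) < h := by exact_mod_cast NeZero.pos h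
  have h1 : ((r : ℤ) + h * n) % h = r := by
    rw [Int.add_mul_emod_self_left]
    exact Int.emod_eq_of_lt (by omega) (by exact_mod_cast r.2)
  have h2 : ((r : ℤ) + h * n) / h = n := by
    rw [Int.add_mul_ediv_left _ _ hh.ne', Int.ediv_eq_zero_of_lt (by omega) (by exact_mod_cast r.2),
      zero_add]
  rw [coord, h1, h2]
  congr 2
  ext
  simp

variable (h) in
theorem exists_eq_add_mul (i : ℤ) : ∃ (r : Fin h) (n : ℤ), i = r + h * n := by
  have hh : (0 : ℤ) < h := by exact_mod_cast NeZero.pos h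
  have h1 := Int.emod_nonneg i hh.ne'
  have h2 := Int.emod_lt_of_pos i hh
  refine ⟨⟨(i % h).toNat, by omega⟩, i / h, ?_⟩
  have := Int.emod_add_mul_ediv i h
  simp only
  rw [Int.toNat_of_nonneg h1]
  omega

theorem coord_injective : Function.Injective (coord (R := R) (h := h)) := by
  intro v w hvw
  funext r
  ext n
  rw [← coord_apply, ← coord_apply, hvw]

@[simp] theorem coord_add (v w : Fin h → LaurentSeries R) : coord (v + w) = coord v + coord w := rfl

theorem coord_C_smul (c : R) (v : Fin h → LaurentSeries R) :
    coord ((PowerSeries.C c : PowerSeries R) • v) = c • coord v := by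
  funext i
  rw [coord, powerSeries_smul_apply, HahnSeries.ofPowerSeries_C, HahnSeries.C_mul_eq_smul]
  rfl

theorem coord_single_smul (n : ℤ) (v : Fin h → LaurentSeries R) :
    coord ((HahnSeries.single n (1 : R) : LaurentSeries R) • v) = shift R (n * h) (coord v) := by
  funext i
  obtain ⟨r, j, rfl⟩ := exists_eq_add_mul h i
  rw [coord_apply, shift_apply, show (r : ℤ) + h * j - n * h = r + h * (j - n) by ring, coord_apply,
    Pi.smul_apply, smul_eq_mul, HahnSeries.coeff_single_mul, one_mul]

theorem coord_X_smul (v : Fin h → LaurentSeries R) :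
    coord ((PowerSeries.X : PowerSeries R) • v) = shift R h (coord v) := by
  have := X_pow_smul 1 v
  rw [pow_one] at this
  rw [this, coord_single_smul]
  simp

theorem exists_coord_eq (w : ℤ → R) (hw : ∃ D, ∀ n < D, w n = 0) :
    ∃ v : Fin h → LaurentSeries R, coord v = w := by
  have hh : (0 : ℤ) < h := by exact_mod_cast NeZero.pos h
  obtain ⟨D, hD⟩ := hw
  have hb : ∀ r : Fin h, BddBelow (Function.support fun n : ℤ => w (r + h * n)) := by
    intro r
    refine ⟨-|D| - h, fun n hn => ?_⟩
    by_contra hlt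
    refine hn (hD _ ?_)
    have h1 := r.2
    have h2 := neg_abs_le D
    nlinarith [abs_nonneg D]
  refine ⟨fun r => HahnSeries.ofSuppBddBelow _ (hb r), ?_⟩
  funext i
  obtain ⟨r, n, rfl⟩ := exists_eq_add_mul h i
  rw [coord_apply]
  rfl

theorem exists_coord_eq_zero (v : Fin h → LaurentSeries R) : ∃ D, ∀ n < D, coord v n = 0 := by
  have hh : (0 : ℤ) < h := by exact_mod_cast NeZero.pos h
  have h1 : ∀ r : Fin h, ∃ D : ℤ, ∀ n < D, (v r).coeff n = 0 := by
    intro r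
    refine ⟨(v r).order, fun n hn => HahnSeries.coeff_eq_zero_of_lt_order hn⟩
  choose D hD using h1
  obtain ⟨M, hM⟩ := (Set.finite_range D).bddBelow
  refine ⟨h * M, fun i hi => ?_⟩
  obtain ⟨r, n, rfl⟩ := exists_eq_add_mul h i
  rw [coord_apply]
  apply hD
  have h2 : M ≤ D r := hM ⟨r, rfl⟩
  by_contra h3
  have : M ≤ n := by omega
  nlinarith [r.2]

theorem coord_smul_eq_zero (g : PowerSeries R) {v : Fin h → LaurentSeries R} {D : ℤ}
    (hv : ∀ n < D, coord v n = 0) : ∀ n < D, coord (g • v) n = 0 := by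
  have hh : (0 : ℤ) < h := by exact_mod_cast NeZero.pos h
  intro i hi
  obtain ⟨r, n, rfl⟩ := exists_eq_add_mul h i
  rw [coord_apply, powerSeries_smul_apply, HahnSeries.coeff_mul]
  refine Finset.sum_eq_zero fun p hp => ?_
  obtain ⟨-, -, h3⟩ := Finset.mem_antidiagonal.1 hp
  by_cases h0 : 0 ≤ p.1
  · rw [← coord_apply, hv, mul_zero]
    nlinarith
  · have : (HahnSeries.ofPowerSeries ℤ R g).coeff p.1 = 0 := by
      have := PowerSeries.coeff_coe (f := g) p.1
      rwa [if_pos (by omega)] at this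
    rw [this, zero_mul]

theorem coord_laurentMap {R' : Type*} [CommRing R'] (g : R →+* R') (v : Fin h → LaurentSeries R) :
    coord (fun r => laurentMap g (v r)) = g ∘ coord v := rfl

end Coordinates

/-! ### The function space of a lattice over a field -/

section FunctionSpace

variable {K : Type u} [Field K] {h : ℕ} [NeZero h]

theorem coord_mem_tail {v : Fin h → LaurentSeries K} (g : PowerSeries K) {D : ℤ}
    (hv : coord v ∈ tail K D) : coord (g • v) ∈ tail K D :=
  coord_smul_eq_zero g hv

/-- Stability under `t` implies stability under power series in `t`. -/
theorem IsFunLattice.coord_smul_mem {L : Submodule K (ℤ → K)} (hL : IsFunLattice h L)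
    {v : Fin h → LaurentSeries K} (hv : coord v ∈ L) (g : PowerSeries K) : coord (g • v) ∈ L := by
  obtain ⟨D, hD⟩ := hL.exists_ge
  have key : ∀ N : ℕ, ∀ (g : PowerSeries K) (v : Fin h → LaurentSeries K), coord v ∈ L →
      coord v ∈ tail K (D - N * h) → coord (g • v) ∈ L := by
    intro N
    induction N with
    | zero =>
      intro g v _ hv
      exact hD (coord_mem_tail g (by simpa using hv))
    | succ N ih =>
      intro g v hv hv'
      rw [g.eq_shift_mul_X_add_const, add_smul, mul_smul, coord_add, coord_C_smul]
      refine L.add_mem (ih _ _ ?_ ?_) (L.smul_mem _ hv)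
      · rw [coord_X_smul]; exact hL.shift_mem _ hv
      · rw [coord_X_smul]
        have := shift_mem_tail hv' h
        rwa [show D - ((N + 1 : ℕ) : ℤ) * h + h = D - N * h by push_cast; ring] at this
  obtain ⟨D', hD'⟩ := exists_coord_eq_zero v
  refine key (D - D').toNat g v hv (tail_anti ?_ hD')
  have h1 : (1 : ℤ) ≤ h := by exact_mod_cast NeZero.pos h
  have h2 : D - D' ≤ (D - D').toNat := Int.self_le_toNat _
  nlinarith [Int.natCast_nonneg (D - D').toNat]

/-- The space of the coordinate functions of the elements of a lattice. -/
def funSpace (M : Submodule (PowerSeries K) (Fin h → LaurentSeries K)) :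
    Submodule K (ℤ → K) where
  carrier := {w | ∃ v ∈ M, coord v = w}
  add_mem' := by
    rintro _ _ ⟨v, hv, rfl⟩ ⟨w, hw, rfl⟩
    exact ⟨v + w, M.add_mem hv hw, rfl⟩
  zero_mem' := ⟨0, M.zero_mem, rfl⟩
  smul_mem' := by
    rintro c _ ⟨v, hv, rfl⟩
    exact ⟨_, M.smul_mem _ hv, coord_C_smul c v⟩

theorem mem_funSpace {M : Submodule (PowerSeries K) (Fin h → LaurentSeries K)} {w : ℤ → K} :
    w ∈ funSpace M ↔ ∃ v ∈ M, coord v = w := Iff.rfl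

theorem coord_mem_funSpace {M : Submodule (PowerSeries K) (Fin h → LaurentSeries K)}
    {v : Fin h → LaurentSeries K} : coord v ∈ funSpace M ↔ v ∈ M :=
  mem_funSpace.trans ⟨fun ⟨_, hw, he⟩ => coord_injective he ▸ hw, fun hv => ⟨v, hv, rfl⟩⟩

theorem funSpace_injective : Function.Injective (funSpace (K := K) (h := h)) := by
  intro M M' hM
  ext v
  rw [← coord_mem_funSpace, hM, coord_mem_funSpace]

theorem IsLattice.exists_span {R : Type*} [CommRing R] {h : ℕ}
    {Λ : Submodule (PowerSeries R) (Fin h → LaurentSeries R)} (hΛ : IsLattice Λ) :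
    ∃ (k : ℕ) (p : Fin k → Fin h → LaurentSeries R),
      Submodule.span (PowerSeries R) (Set.range p) = Λ := by
  obtain ⟨k, p, _, hp, -⟩ := hΛ.exists_dual
  exact ⟨k, p, hp⟩

theorem IsLattice.isFunLattice {M : Submodule (PowerSeries K) (Fin h → LaurentSeries K)}
    (hM : IsLattice M) : IsFunLattice h (funSpace M) where
  shift_mem w hw := by
    obtain ⟨v, hv, rfl⟩ := mem_funSpace.1 hw
    exact mem_funSpace.2 ⟨_, M.smul_mem _ hv, coord_X_smul v⟩
  exists_le := by
    obtain ⟨k, p, rfl⟩ := hM.exists_span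
    choose D hD using fun i => exists_coord_eq_zero (p i)
    obtain ⟨D', hD'⟩ := (Set.finite_range D).bddBelow
    refine ⟨D', fun w hw => ?_⟩
    obtain ⟨v, hv, rfl⟩ := mem_funSpace.1 hw
    clear hw
    induction hv using Submodule.span_induction with
    | mem x hx =>
      obtain ⟨i, rfl⟩ := hx
      exact tail_anti (hD' ⟨i, rfl⟩) (hD i)
    | zero => exact Submodule.zero_mem _
    | add x y _ _ hx hy => rw [coord_add]; exact Submodule.add_mem _ hx hy
    | smul c x _ hx => exact coord_mem_tail c hx
  exists_ge := by
    have hh : (0 : ℤ) < h := by exact_mod_cast NeZero.pos h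
    choose n hn using fun r : Fin h => exists_pow_smul_mem hM.span_eq_top (Pi.single r 1)
    obtain ⟨N, hN⟩ := (Set.finite_range n).bddAbove
    refine ⟨h * N, fun w hw => ?_⟩
    obtain ⟨v, rfl⟩ := exists_coord_eq (h := h) w ⟨_, hw⟩
    refine coord_mem_funSpace.2 ?_
    have hv : v = ∑ r, (PowerSeries.mk fun j => (v r).coeff (n r + j)) •
        ((PowerSeries.X ^ n r : PowerSeries K) • (Pi.single r 1 : Fin h → LaurentSeries K)) := by
      funext s
      rw [Finset.sum_apply, Finset.sum_eq_single s]
      · rw [powerSeries_smul_apply, X_pow_smul, Pi.smul_apply, Pi.single_eq_same, smul_eq_mul,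
          mul_one]
        ext j
        rw [HahnSeries.coeff_mul_single, mul_one]
        have := PowerSeries.coeff_coe
          (f := PowerSeries.mk fun j => (v s).coeff (n s + j)) (j - n s)
        rw [this]
        split_ifs with h1
        · rw [← coord_apply]
          apply hw
          have h2 : n s ≤ N := hN ⟨s, rfl⟩
          have h3 : j + 1 ≤ N := by omega
          nlinarith [s.2]
        · rw [PowerSeries.coeff_mk]
          congr 1
          omega
      · intro r _ hr
        rw [powerSeries_smul_apply, X_pow_smul, Pi.smul_apply, Pi.single_eq_of_ne hr.symm]
        simp
      · simp
    rw [hv]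
    exact Submodule.sum_mem _ fun r _ => M.smul_mem _ (hn r)

theorem isLeast_eSupport_iff {v : Fin h → LaurentSeries K} {a : ℤ} :
    IsLeast (eSupport v) a ↔ Leads (coord v) a := by
  have h1 : ∀ i, i ∈ eSupport v ↔ coord v i ≠ 0 := by
    intro i
    constructor
    · rintro ⟨r, n, rfl, hn⟩
      rwa [coord_apply]
    · intro hi
      obtain ⟨r, n, rfl⟩ := exists_eq_add_mul h i
      exact ⟨r, n, rfl, by rwa [coord_apply] at hi⟩
  constructor
  · rintro ⟨h2, h3⟩
    refine ⟨(h1 a).1 h2, fun n hn => ?_⟩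
    by_contra h4
    have := h3 ((h1 n).2 h4)
    omega
  · rintro ⟨h2, h3⟩
    refine ⟨(h1 a).2 h2, fun n hn => ?_⟩
    by_contra h4
    exact (h1 n).1 hn (h3 n (by omega))

variable (k : Type v) [Field k] [Fintype k] [Algebra k K] (m : ℕ)

/-- The Frobenius of `K`. -/
noncomputable def frob (K : Type u) [Field K] [Algebra k K] : K →+* K :=
  (FiniteField.frobeniusAlgHom k K : K →+* K)

theorem frob_apply (z : K) : frob k K z = z ^ Fintype.card k := rfl

theorem coord_bσ (v : Fin h → LaurentSeries K) :
    coord (bσ k m v) = shift K m (frob k K ∘ coord v) := by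
  have hh : (0 : ℤ) < h := by exact_mod_cast NeZero.pos h
  funext i
  obtain ⟨s, n, rfl⟩ := exists_eq_add_mul h i
  obtain ⟨r, j, hj⟩ := exists_eq_add_mul h ((s : ℤ) + h * n - m)
  rw [shift_apply, hj, Function.comp_apply, coord_apply, coord_apply, bσ, Matrix.mulVec, dotProduct]
  have hmod : ∀ r' : Fin h, ((r' : ℕ) + m) % h = s ↔ r' = r := by
    intro r'
    have h1 : (((r : ℕ) + m : ℕ) : ℤ) = s + h * (n - j) := by push_cast; linarith
    have h2 : ((r : ℕ) + m) % h = s := by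
      have : ((((r : ℕ) + m) % h : ℕ) : ℤ) = s := by
        rw [Int.natCast_mod, h1, Int.add_mul_emod_self_left]
        exact Int.emod_eq_of_lt (by omega) (by exact_mod_cast s.2)
      exact_mod_cast this
    constructor
    · intro h3
      have h4 : (r' : ℕ) ≡ r [MOD h] := Nat.ModEq.add_right_cancel' m (h3.trans h2.symm)
      exact Fin.ext (h4.eq_of_lt_of_lt r'.2 r.2)
    · rintro rfl; exact h2
  have hdiv : ((((r : ℕ) + m) / h : ℕ) : ℤ) = n - j := by
    have h1 : (((r : ℕ) + m : ℕ) : ℤ) = s + h * (n - j) := by push_cast; linarith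
    rw [Int.natCast_div, h1, Int.add_mul_ediv_left _ _ hh.ne',
      Int.ediv_eq_zero_of_lt (by omega) (by exact_mod_cast s.2), zero_add]
  rw [Finset.sum_eq_single r]
  · rw [bMatrix, Matrix.of_apply, if_pos ((hmod r).2 rfl), HahnSeries.coeff_single_mul, one_mul,
      hdiv, sub_sub_cancel]
    rfl
  · intro r' _ hr'
    rw [bMatrix, Matrix.of_apply, if_neg (mt (hmod r').1 hr'), zero_mul]
  · simp

theorem mem_phiSet_iff (M : Gr h K) (a : ℤ) (n : ℕ) : n ∈ phiSet k m M a ↔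
    ∃ v ∈ levelSubspace m h (frob k K) (funSpace M.1) n, Leads v a := by
  have h1 : ∀ v, coord ((HahnSeries.single (-(n : ℤ)) (1 : K) : LaurentSeries K) • bσ k m v) =
      shift K (m - n * h) (frob k K ∘ coord (h := h) v) := by
    intro v
    rw [coord_single_smul, coord_bσ, shift_shift]
    congr 2; ring
  constructor
  · rintro ⟨v, hv, hl, hb⟩
    refine ⟨coord v, ⟨coord_mem_funSpace.2 hv, ?_⟩, isLeast_eSupport_iff.1 hl⟩
    rw [← h1]
    exact coord_mem_funSpace.2 hb
  · rintro ⟨w, ⟨hw, hb⟩, hl⟩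
    obtain ⟨v, hv, rfl⟩ := mem_funSpace.1 hw
    rw [← h1, coord_mem_funSpace] at hb
    exact ⟨v, hv, isLeast_eSupport_iff.2 hl, hb⟩

theorem mem_semiModuleOf_iff (M : Gr h K) (a : ℤ) : a ∈ semiModuleOf M ↔
    ∃ v ∈ funSpace M.1, Leads v a := by
  constructor
  · rintro ⟨v, hv, hl⟩
    exact ⟨_, coord_mem_funSpace.2 hv, isLeast_eSupport_iff.1 hl⟩
  · rintro ⟨w, hw, hl⟩
    obtain ⟨v, hv, rfl⟩ := mem_funSpace.1 hw
    exact ⟨v, hv, isLeast_eSupport_iff.2 hl⟩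

theorem IsExtendedSemiModule.mem_stratum_iff {μ : Fin h → ℕ} {A : Set ℤ} {φ : ℤ → WithBot ℕ}
    (hA : IsExtendedSemiModule m h μ A φ) (M : Gr h K) : M ∈ stratum k m A φ ↔
      HasInvariants m h (frob k K) A (fun a => (φ a).unbotD 0) (funSpace M.1) := by
  have hL := M.2.isFunLattice
  have hdown : ∀ a n n', n ≤ n' → n' ∈ phiSet k m M a → n ∈ phiSet k m M a := by
    intro a n n' hn hn'
    rw [mem_phiSet_iff] at hn' ⊢
    obtain ⟨v, hv, hl⟩ := hn'
    exact ⟨v, levelSubspace_anti hL hn hv, hl⟩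
  constructor
  · rintro ⟨h1, h2⟩
    refine ⟨fun a => by rw [← mem_semiModuleOf_iff, h1], fun a ha n => ?_⟩
    rw [← mem_phiSet_iff]
    have hφ := congrFun h2 a
    have hbdd : BddAbove (phiSet k m M a) := by
      obtain ⟨lo, hlo⟩ := hA.normalized.bddBelow
      refine ⟨(a + m - lo).toNat, fun n hn => ?_⟩
      obtain ⟨v, hv, hl⟩ := (mem_phiSet_iff k m M a n).1 hn
      have h3 : a + (m - n * h) ∈ A := by
        rw [← h1, mem_semiModuleOf_iff]
        exact ⟨_, hv.2, hl.comp.shift _⟩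
      have h4 := hlo h3
      have h5 : (1 : ℤ) ≤ h := by exact_mod_cast NeZero.pos h
      have h6 : (n : ℤ) ≤ n * h := by nlinarith [Int.natCast_nonneg n]
      omega
    rw [phiOf] at hφ
    split_ifs at hφ with hne
    · have h3 : sSup (phiSet k m M a) = (φ a).unbotD 0 := by rw [← hφ]; rfl
      rw [← h3]
      exact ⟨fun hn => le_csSup hbdd hn, fun hn => hdown a n _ hn (Nat.sSup_mem hne hbdd)⟩
    · exact ((hA.eq_bot_iff a).1 hφ.symm ha).elim
  · rintro ⟨h1, h2⟩
    refine ⟨Set.ext fun a => by rw [mem_semiModuleOf_iff, h1], funext fun a => ?_⟩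
    rw [phiOf]
    by_cases ha : a ∈ A
    · have h3 : phiSet k m M a = Set.Iic ((φ a).unbotD 0) := by
        ext n
        rw [mem_phiSet_iff, h2 a ha]
        rfl
      rw [h3, if_pos Set.nonempty_Iic, csSup_Iic, ← hA.coe_unbotD ha]
    · rw [if_neg, (hA.eq_bot_iff a).2 ha]
      rintro ⟨n, hn⟩
      obtain ⟨v, hv, hl⟩ := (mem_phiSet_iff k m M a n).1 hn
      exact ha ((h1 a).1 ⟨v, hv.1, hl⟩)

end FunctionSpace

/-! ### Base change of lattices -/

section BaseChange

variable {R R' R'' : Type*} [CommRing R] [CommRing R'] [CommRing R''] {h : ℕ}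

theorem latticeBaseChange_span {ι : Type*} (g : R →+* R') (p : ι → Fin h → LaurentSeries R) :
    latticeBaseChange g (Submodule.span (PowerSeries R) (Set.range p)) =
      Submodule.span (PowerSeries R') (Set.range fun i r => laurentMap g (p i r)) := by
  apply le_antisymm
  · rw [latticeBaseChange, Submodule.span_le]
    rintro _ ⟨v, hv, rfl⟩
    rw [SetLike.mem_coe] at hv ⊢
    beta_reduce
    induction hv using Submodule.span_induction with
    | mem x hx =>
      obtain ⟨j, rfl⟩ := hx
      exact Submodule.subset_span ⟨j, rfl⟩
    | zero =>
      have : (fun i => laurentMap g ((0 : Fin h → LaurentSeries R) i)) = 0 := by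
        funext r; simp
      rw [this]
      exact Submodule.zero_mem _
    | add x y _ _ hx hy =>
      have : (fun i => laurentMap g ((x + y) i)) =
          (fun i => laurentMap g (x i)) + fun i => laurentMap g (y i) := by
        funext r; simp
      rw [this]
      exact Submodule.add_mem _ hx hy
    | smul c x _ hx =>
      have : (fun i => laurentMap g ((c • x) i)) =
          PowerSeries.map g c • fun i => laurentMap g (x i) := by
        funext r
        rw [Pi.smul_apply, Pi.smul_apply, Algebra.smul_def, Algebra.smul_def, map_mul,
          laurentMap_algebraMap]
      rw [this]
      exact Submodule.smul_mem _ _ hx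
  · rw [Submodule.span_le]
    rintro _ ⟨i, rfl⟩
    exact Submodule.subset_span ⟨p i, Submodule.subset_span ⟨i, rfl⟩, rfl⟩

theorem laurentMap_comp (g : R →+* R') (g' : R' →+* R'') (x : LaurentSeries R) :
    laurentMap g' (laurentMap g x) = laurentMap (g'.comp g) x := by
  ext; rfl

theorem Gr.map_map {h : ℕ} {R R' R'' : Type u} [CommRing R] [CommRing R'] [CommRing R'']
    (g : R →+* R') (g' : R' →+* R'') (Λ : Gr h R) : (Λ.map g).map g' = Λ.map (g'.comp g) := by
  obtain ⟨k, p, hp⟩ := Λ.2.exists_span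
  apply Subtype.ext
  simp only [Gr.map]
  rw [← hp, latticeBaseChange_span, latticeBaseChange_span, latticeBaseChange_span]
  simp only [laurentMap_comp]

end BaseChange

/-! ### The family of lattices over the parameter space -/

section Universal

variable {m h : ℕ} {A : Set ℤ} {f : ℤ → ℕ} {lo y : ℤ} {q : ℕ}

theorem IsFrame.exists_generator (F : IsFrame m h A f lo y) (r : Fin h) :
    ∃ n : ℤ, (r : ℤ) + h * n ∈ A ∧ ∀ j, (r : ℤ) + h * j ∈ A → n ≤ j := by
  have hh := F.h_pos_int
  refine Int.exists_least_of_bdd (P := fun n => (r : ℤ) + h * n ∈ A)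
    ⟨-|lo| - h, fun j hj => ?_⟩ ⟨|y|, F.mem_of_le _ ?_⟩
  · have h1 := F.le_of_mem _ hj
    have h2 := neg_abs_le lo
    have h3 := abs_nonneg lo
    by_contra hlt
    have h4 : j + 1 ≤ -|lo| - h := by omega
    nlinarith [r.2]
  · have h2 := le_abs_self y
    have h3 := abs_nonneg y
    nlinarith

variable {P : Type*} [CommRing P]

theorem isLattice_of_isUnit_det {G : Matrix (Fin h) (Fin h) (PowerSeries P)} (hdet : IsUnit G.det)
    (ν : Fin h → ℤ) :
    IsLattice (Submodule.span (PowerSeries P) (Set.range fun r s : Fin h =>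
      (HahnSeries.single (ν r) (1 : P) : LaurentSeries P) *
        HahnSeries.ofPowerSeries ℤ P (G r s))) := by
  have hG1 : G * G⁻¹ = 1 := Matrix.mul_nonsing_inv G hdet
  have hG2 : G⁻¹ * G = 1 := Matrix.nonsing_inv_mul G hdet
  have hT : ∀ n n' : ℤ, (HahnSeries.single n (1 : P) : LaurentSeries P) *
      (HahnSeries.single n' (1 : P) : LaurentSeries P) = HahnSeries.single (n + n') (1 : P) :=
    fun n n' => by simp [HahnSeries.single_mul_single]
  have hT0 : (HahnSeries.single (0 : ℤ) (1 : P) : LaurentSeries P) = 1 := rfl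
  refine isLattice_of_dual _ (fun i s => HahnSeries.single (-ν i) (1 : P) *
    HahnSeries.ofPowerSeries ℤ P (G⁻¹ s i)) ?_ ?_
  · intro r s
    have h1 : ∀ i, (HahnSeries.single (-ν i) (1 : P) : LaurentSeries P) *
        HahnSeries.ofPowerSeries ℤ P (G⁻¹ s i) * (HahnSeries.single (ν i) (1 : P) *
        HahnSeries.ofPowerSeries ℤ P (G i r)) =
        HahnSeries.ofPowerSeries ℤ P (G⁻¹ s i * G i r) := by
      intro i
      rw [map_mul, mul_mul_mul_comm, hT, neg_add_cancel, hT0, one_mul]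
    simp only [h1]
    rw [← map_sum, ← Matrix.mul_apply, hG2, Matrix.one_apply]
    by_cases hrs : r = s
    · rw [if_pos hrs, if_pos hrs.symm, map_one]
    · rw [if_neg hrs, if_neg (Ne.symm hrs), map_zero]
  · intro i j
    refine ⟨if j = i then 1 else 0, ?_⟩
    have h1 : ∀ s, (HahnSeries.single (-ν i) (1 : P) : LaurentSeries P) *
        HahnSeries.ofPowerSeries ℤ P (G⁻¹ s i) * (HahnSeries.single (ν j) (1 : P) *
        HahnSeries.ofPowerSeries ℤ P (G j s)) = HahnSeries.single (-ν i + ν j) (1 : P) *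
        HahnSeries.ofPowerSeries ℤ P (G j s * G⁻¹ s i) := by
      intro s
      rw [map_mul, mul_mul_mul_comm, hT, mul_comm (HahnSeries.ofPowerSeries ℤ P (G j s))]
    simp only [dotProduct, h1]
    rw [← Finset.mul_sum, ← map_sum, ← Matrix.mul_apply, hG1, Matrix.one_apply,
      LaurentSeries.coe_algebraMap]
    by_cases hij : j = i
    · subst hij
      rw [if_pos rfl, neg_add_cancel, hT0, one_mul]
    · rw [if_neg hij, map_zero, mul_zero]

variable [NeZero h]

theorem coord_single_mul_mk {a : ℤ → P} {r : Fin h} {n : ℤ} (ha : ∀ i < (r : ℤ) + h * n, a i = 0) :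
    coord (fun s : Fin h => (HahnSeries.single n (1 : P) : LaurentSeries P) *
      HahnSeries.ofPowerSeries ℤ P (PowerSeries.mk fun j => a (s + h * (n + j)))) = a := by
  have hh : (0 : ℤ) < h := by exact_mod_cast NeZero.pos h
  funext i
  obtain ⟨s, j, rfl⟩ := exists_eq_add_mul h i
  rw [coord_apply, HahnSeries.coeff_single_mul, one_mul]
  have h1 := PowerSeries.coeff_coe (f := PowerSeries.mk fun j : ℕ => a (s + h * (n + j))) (j - n)
  rw [h1]
  split_ifs with h2
  · have h3 : j + 1 ≤ n := by omega
    refine (ha _ ?_).symm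
    nlinarith [s.2]
  · rw [PowerSeries.coeff_mk]
    congr 3
    omega

/-- The lattice over `P` that is generated by the elements `v(a)` for `a ∈ A \ (h + A)`. -/
theorem IsFrame.exists_isLattice (F : IsFrame m h A f lo y) (x : ℤ → ℤ → P) :
    ∃ (p : Fin h → Fin h → LaurentSeries P) (g : Fin h → ℤ),
      IsLattice (Submodule.span (PowerSeries P) (Set.range p)) ∧
      (∀ r, g r ∈ A ∧ coord (p r) = vec q m h A lo y x (g r)) ∧
      ∀ a ∈ A, ∃ (r : Fin h) (n : ℕ), a = g r + n * h := by
  have hh := F.h_pos_int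
  choose ν hν hν' using F.exists_generator
  let G : Matrix (Fin h) (Fin h) (PowerSeries P) := fun r s =>
    PowerSeries.mk fun j => vec q m h A lo y x (r + h * ν r) (s + h * (ν r + j))
  have hG : ∀ r s, (PowerSeries.constantCoeff (R := P)).mapMatrix G r s =
      vec q m h A lo y x (r + h * ν r) (s + h * ν r) := by
    intro r s
    rw [RingHom.mapMatrix_apply, Matrix.map_apply,
      ← PowerSeries.coeff_zero_eq_constantCoeff_apply, PowerSeries.coeff_mk, Nat.cast_zero,
      add_zero]
  have hdet : IsUnit G.det := by
    rw [PowerSeries.isUnit_iff_constantCoeff, RingHom.map_det]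
    have h1 : ((PowerSeries.constantCoeff (R := P)).mapMatrix G).det = 1 := by
      rw [Matrix.det_of_isUpperTriangular]
      · refine Finset.prod_eq_one fun r _ => ?_
        rw [hG]
        exact F.vec_self (hν r)
      · intro r s hsr
        rw [hG]
        have : (s : ℤ) < r := by exact_mod_cast hsr
        exact vec_of_lt _ _ (by omega)
    rw [h1]
    exact isUnit_one
  refine ⟨_, fun r => r + h * ν r, isLattice_of_isUnit_det hdet ν, fun r => ⟨hν r, ?_⟩,
    fun a ha => ?_⟩
  · exact coord_single_mul_mk fun i hi => vec_of_lt _ _ hi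
  · obtain ⟨r, j, rfl⟩ := exists_eq_add_mul h a
    have := hν' r j ha
    refine ⟨r, (j - ν r).toNat, ?_⟩
    rw [Int.toNat_of_nonneg (by omega)]
    ring

/-- The lattices with parameters `x` form an algebraic family: there is a lattice over the ring of
the parameters that specializes to them. -/
theorem IsFrame.exists_universal {P : Type u} [CommRing P] (F : IsFrame m h A f lo y)
    {x : ℤ → ℤ → P} (hx : ∀ a b, ¬ IsPair h A f a b → x a b = 0) :
    ∃ Λ : Gr h P, ∀ (K : Type u) [Field K] (χ : P →+* K),
      funSpace (Λ.map χ).1 = family q m h A f lo y (fun a b => χ (x a b)) 0 := by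
  obtain ⟨p, g, hp, hg, hA⟩ := F.exists_isLattice (q := q) x
  refine ⟨⟨_, hp⟩, fun K _ χ => ?_⟩
  have hx' : ∀ a b, ¬ IsPair h A f a b → χ (x a b) = 0 := fun a b hab => by
    rw [hx a b hab, map_zero]
  have hM := (Gr.map χ (⟨_, hp⟩ : Gr h P)).2.isFunLattice
  have hspan : (Gr.map χ (⟨_, hp⟩ : Gr h P)).1 =
      Submodule.span (PowerSeries K) (Set.range fun i r => laurentMap χ (p i r)) :=
    latticeBaseChange_span χ p
  have hgen : ∀ r, coord (fun s => laurentMap χ (p r s)) =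
      vec q m h A lo y (fun a b => χ (x a b)) (g r) := by
    intro r
    rw [coord_laurentMap, (hg r).2]
    funext n
    exact (vec_map q x χ (g r) n).symm
  rw [hspan] at hM ⊢
  have hle : funSpace (Submodule.span (PowerSeries K) (Set.range fun i r => laurentMap χ (p i r))) ≤
      family q m h A f lo y (fun a b => χ (x a b)) 0 := by
    intro w hw
    obtain ⟨v, hv, rfl⟩ := mem_funSpace.1 hw
    clear hw
    induction hv using Submodule.span_induction with
    | mem v hv =>
      obtain ⟨r, rfl⟩ := hv
      beta_reduce
      rw [hgen]
      exact vec_mem_family (hg r).1 (Nat.zero_le _)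
    | zero => exact Submodule.zero_mem _
    | add v w _ _ hv hw => exact Submodule.add_mem _ hv hw
    | smul c v _ hv => exact (F.isFunLattice_family hx').coord_smul_mem hv c
  refine le_antisymm hle ?_
  obtain ⟨D, hD⟩ := hM.exists_ge
  refine le_of_leads hle hD (F.family_le 0) fun v hv a ha => ?_
  obtain ⟨r, n, rfl⟩ := hA a (F.leads_family hv ha).1
  refine ⟨_, hM.shift_mul_mem n (coord_mem_funSpace.2 (Submodule.subset_span ⟨r, rfl⟩)), ?_⟩
  beta_reduce
  rw [hgen]
  exact (F.vec_leads _ (hg r).1).shift _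

end Universal

/-! ### The Zariski topologies -/

section ZariskiTopology

variable {K : Type u} [Field K]

theorem isOpen_zariskiPoints_iff {R : Type u} [CommRing R] [Algebra K R] {s : Set (R →ₐ[K] K)} :
    @IsOpen _ (zariskiPoints K R) s ↔
      ∀ y ∈ s, ∃ r : R, y r ≠ 0 ∧ ∀ y' : R →ₐ[K] K, y' r ≠ 0 → y' ∈ s := by
  let := zariskiPoints K R
  have hb : TopologicalSpace.IsTopologicalBasis
      (Set.range fun r : R => {y : R →ₐ[K] K | y r ≠ 0}) := by
    refine ⟨?_, ?_, rfl⟩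
    · rintro _ ⟨r, rfl⟩ _ ⟨r', rfl⟩ y ⟨h1, h2⟩
      refine ⟨_, ⟨r * r', rfl⟩, ?_, ?_⟩
      · have h3 : y (r * r') ≠ 0 := by rw [map_mul]; exact mul_ne_zero h1 h2
        exact h3
      · intro y' hy'
        have h3 : y' r * y' r' ≠ 0 := by rw [← map_mul]; exact hy'
        exact ⟨left_ne_zero_of_mul h3, right_ne_zero_of_mul h3⟩
    · refine Set.eq_univ_of_forall fun y => ⟨_, ⟨1, rfl⟩, ?_⟩
      have h3 : y 1 ≠ 0 := by rw [map_one]; exact one_ne_zero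
      exact h3
  rw [hb.isOpen_iff]
  refine forall₂_congr fun y _ => ?_
  constructor
  · rintro ⟨_, ⟨r, rfl⟩, h1, h2⟩
    exact ⟨r, h1, fun y' hy' => h2 hy'⟩
  · rintro ⟨r, h1, h2⟩
    exact ⟨_, ⟨r, rfl⟩, h1, fun y' hy' => h2 y' hy'⟩

theorem isOpen_ne_zero {R : Type u} [CommRing R] [Algebra K R] (r : R) :
    @IsOpen _ (zariskiPoints K R) {y | y r ≠ 0} :=
  TopologicalSpace.isOpen_generateFrom_of_mem ⟨r, rfl⟩

theorem Gr.isOpen_iff {h : ℕ} {s : Set (Gr h K)} :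
    IsOpen s ↔ ∀ (R : Type u) [CommRing R] [Algebra K R] [Algebra.FiniteType K R] (Λ : Gr h R)
      (y : R →ₐ[K] K), Λ.map (y : R →+* K) ∈ s →
      ∃ r : R, y r ≠ 0 ∧ ∀ y' : R →ₐ[K] K, y' r ≠ 0 → Λ.map (y' : R →+* K) ∈ s := by
  rw [Gr.zariski]
  simp only [isOpen_iSup_iff, isOpen_coinduced]
  exact forall_congr' fun R => forall_congr' fun _ => forall_congr' fun _ => forall_congr' fun _ =>
    forall_congr' fun Λ => isOpen_zariskiPoints_iff

theorem Gr.continuous_map {h : ℕ} {R : Type u} [CommRing R] [Algebra K R] [Algebra.FiniteType K R]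
    (Λ : Gr h R) :
    @Continuous _ _ (zariskiPoints K R) _ fun y : R →ₐ[K] K => Λ.map (y : R →+* K) := by
  let := zariskiPoints K R
  refine continuous_def.2 fun s hs => ?_
  exact isOpen_zariskiPoints_iff.2 fun y hy => Gr.isOpen_iff.1 hs R Λ y hy

/-- A subset of a locally closed subset `S` is open in `S` if its inverse image in each family of
lattices is open in the inverse image of `S`. -/
theorem Gr.isOpen_preimage_val {h : ℕ} {S : Set (Gr h K)} (hS : IsLocallyClosed S) {Z : Set S}
    (hZ : ∀ (R : Type u) [CommRing R] [Algebra K R] [Algebra.FiniteType K R] (Λ : Gr h R)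
      (y : R →ₐ[K] K) (hy : Λ.map (y : R →+* K) ∈ S), ⟨_, hy⟩ ∈ Z → ∃ r : R, y r ≠ 0 ∧
        ∀ (y' : R →ₐ[K] K) (hy' : Λ.map (y' : R →+* K) ∈ S), y' r ≠ 0 → ⟨_, hy'⟩ ∈ Z) :
    IsOpen Z := by
  obtain ⟨O, C, hO, hC, rfl⟩ := hS
  -- the union of `Z` with the complement of `C` in `O` is open
  refine isOpen_induced_iff.2 ⟨{M | M ∈ O ∧ ∀ hM : M ∈ O ∩ C, ⟨M, hM⟩ ∈ Z}, ?_, ?_⟩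
  · refine Gr.isOpen_iff.2 fun R _ _ _ Λ y hy => ?_
    obtain ⟨r, hr, hr'⟩ := Gr.isOpen_iff.1 hO R Λ y hy.1
    by_cases hyC : Λ.map (y : R →+* K) ∈ C
    · obtain ⟨r₁, hr₁, hr₁'⟩ := hZ R Λ y ⟨hy.1, hyC⟩ (hy.2 _)
      refine ⟨r * r₁, by rw [map_mul]; exact mul_ne_zero hr hr₁, fun y' hy' => ?_⟩
      rw [map_mul] at hy'
      exact ⟨hr' y' (left_ne_zero_of_mul hy'), fun hM => hr₁' y' hM (right_ne_zero_of_mul hy')⟩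
    · obtain ⟨r₁, hr₁, hr₁'⟩ := Gr.isOpen_iff.1 hC.isOpen_compl R Λ y hyC
      refine ⟨r * r₁, by rw [map_mul]; exact mul_ne_zero hr hr₁, fun y' hy' => ?_⟩
      rw [map_mul] at hy'
      exact ⟨hr' y' (left_ne_zero_of_mul hy'),
        fun hM => (hr₁' y' (right_ne_zero_of_mul hy') hM.2).elim⟩
  · ext ⟨M, hM⟩
    exact ⟨fun h => h.2 hM, fun h => ⟨hM.1, fun _ => h⟩⟩

end ZariskiTopology

/-! ### Equations for the elements of a lattice in a family -/

section Equations

variable {K : Type u} [Field K] {h : ℕ}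

/-- Membership in the base change of a lattice, tested with a dual system of vectors. -/
theorem mem_map_iff_of_dual {R : Type*} [CommRing R] (g : R →+* K) {k : ℕ}
    {p w : Fin k → Fin h → LaurentSeries R}
    (hpw : ∀ r s, ∑ i, w i s * p i r = if r = s then 1 else 0)
    (hint : ∀ i j, ∃ a : PowerSeries R, w i ⬝ᵥ p j = algebraMap _ _ a)
    (v : Fin h → LaurentSeries K) :
    v ∈ latticeBaseChange g (Submodule.span (PowerSeries R) (Set.range p)) ↔
      ∀ i, ∀ n < 0, ((fun r => laurentMap g (w i r)) ⬝ᵥ v).coeff n = 0 := by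
  have hrange : ∀ z : LaurentSeries K, (∀ n < 0, z.coeff n = 0) ↔
      ∃ a : PowerSeries K, z = algebraMap _ _ a := by
    intro z
    constructor
    · intro hz
      refine ⟨PowerSeries.mk fun n => z.coeff n, ?_⟩
      ext n
      rw [LaurentSeries.coe_algebraMap]
      have := PowerSeries.coeff_coe (f := PowerSeries.mk fun n : ℕ => z.coeff n) n
      refine Eq.trans ?_ this.symm
      split_ifs with hn
      · exact hz n hn
      · rw [PowerSeries.coeff_mk, ← Int.eq_natAbs_of_nonneg (not_lt.1 hn)]
    · rintro ⟨a, rfl⟩ n hn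
      rw [LaurentSeries.coe_algebraMap]
      exact (PowerSeries.coeff_coe (f := a) n).trans (if_pos hn)
  simp only [hrange]
  rw [latticeBaseChange_span]
  constructor
  · intro hv i
    induction hv using Submodule.span_induction with
    | mem x hx =>
      obtain ⟨j, rfl⟩ := hx
      obtain ⟨a, ha⟩ := hint i j
      refine ⟨PowerSeries.map g a, ?_⟩
      rw [← laurentMap_algebraMap, ← ha]
      simp [dotProduct]
    | zero => exact ⟨0, by simp⟩
    | add x y _ _ hx hy =>
      obtain ⟨a, ha⟩ := hx
      obtain ⟨b, hb⟩ := hy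
      exact ⟨a + b, by rw [map_add, ← ha, ← hb, dotProduct_add]⟩
    | smul c x _ hx =>
      obtain ⟨a, ha⟩ := hx
      refine ⟨c * a, ?_⟩
      rw [map_mul, ← ha, ← algebraMap_smul (LaurentSeries K) c x, dotProduct_smul, smul_eq_mul]
  · intro hv
    choose a ha using hv
    have hrec : v = ∑ i, a i • fun r => laurentMap g (p i r) := by
      funext r
      have h2 : ∀ i, (a i • fun r => laurentMap g (p i r)) r =
          (∑ s, laurentMap g (w i s) * v s) * laurentMap g (p i r) := by
        intro i
        rw [Pi.smul_apply, Algebra.smul_def, ← ha]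
        rfl
      simp only [Finset.sum_apply, h2, Finset.sum_mul]
      rw [Finset.sum_comm]
      have : ∀ s, ∑ i, laurentMap g (w i s) * v s * laurentMap g (p i r) =
          (if r = s then 1 else 0) * v s := by
        intro s
        have h1 := congrArg (laurentMap g) (hpw r s)
        rw [map_sum] at h1
        simp only [map_mul] at h1
        rw [apply_ite (laurentMap g), map_one, map_zero] at h1
        rw [← h1, Finset.sum_mul]
        exact Finset.sum_congr rfl fun i _ => by ring
      simp [this]
    rw [hrec]
    exact Submodule.sum_mem _ fun i _ => Submodule.smul_mem _ _ (Submodule.subset_span ⟨i, rfl⟩)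

/-- The functions with support in `[a, D)`. -/
def window (K : Type*) [Field K] (a D : ℤ) : Submodule K (ℤ → K) where
  carrier := {v | ∀ n, n ∉ Finset.Ico a D → v n = 0}
  add_mem' ha hb n hn := by simp [ha n hn, hb n hn]
  zero_mem' n _ := rfl
  smul_mem' c v hv n hn := by simp [hv n hn]

variable [NeZero h]

theorem eq_sum_single {a D : ℤ} {v : Fin h → LaurentSeries K} (hv : coord v ∈ window K a D) :
    v = ∑ s ∈ Finset.Ico a D, Pi.single (Fin.ofNat h (s % h).toNat)
      (HahnSeries.single (s / h) (coord v s) : LaurentSeries K) := by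
  have hh : (0 : ℤ) < h := by exact_mod_cast NeZero.pos h
  have h1 : ∀ s : ℤ, coord (Pi.single (Fin.ofNat h (s % h).toNat)
      (HahnSeries.single (s / h) (coord v s) : LaurentSeries K)) = Pi.single s (coord v s) := by
    intro s
    funext i
    rw [coord]
    by_cases his : i = s
    · subst his
      simp
    · rw [Pi.single_eq_of_ne his]
      by_cases hr : Fin.ofNat h (i % h).toNat = Fin.ofNat h (s % h).toNat
      · have hmod : i % h = s % h := by
          have h2 := congrArg Fin.val hr
          simp only [Fin.ofNat] at h2
          have h3 := Int.emod_lt_of_pos i hh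
          have h4 := Int.emod_lt_of_pos s hh
          have h5 := Int.emod_nonneg i hh.ne'
          have h6 := Int.emod_nonneg s hh.ne'
          rw [Nat.mod_eq_of_lt (by omega), Nat.mod_eq_of_lt (by omega)] at h2
          omega
        rw [hr, Pi.single_eq_same, HahnSeries.coeff_single_of_ne]
        intro hdiv
        apply his
        rw [← Int.emod_add_mul_ediv i h, ← Int.emod_add_mul_ediv s h, hmod, hdiv]
      · rw [Pi.single_eq_of_ne hr, HahnSeries.coeff_zero]
  have hadd : ∀ T : Finset ℤ, coord (∑ s ∈ T, Pi.single (Fin.ofNat h (s % h).toNat)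
      (HahnSeries.single (s / h) (coord v s) : LaurentSeries K)) =
      ∑ s ∈ T, Pi.single s (coord v s) := by
    intro T
    induction T using Finset.cons_induction with
    | empty => rfl
    | cons s T hs ih => rw [Finset.sum_cons, Finset.sum_cons, coord_add, ih, h1]
  apply coord_injective
  rw [hadd]
  funext n
  rw [Finset.sum_apply]
  by_cases hn : n ∈ Finset.Ico a D
  · rw [Finset.sum_eq_single n (fun s _ hs => Pi.single_eq_of_ne hs.symm _) (fun h => (h hn).elim),
      Pi.single_eq_same]
  · rw [hv n hn]
    refine (Finset.sum_eq_zero fun s hs => Pi.single_eq_of_ne ?_ _).symm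
    rintro rfl
    exact hn hs

/-- The condition that a function with support in `[a, D)` belongs to the lattice at the point `y`
of a family is given by finitely many linear equations whose coefficients are algebraic in `y`. -/
theorem exists_equations {R : Type u} [CommRing R] [Algebra K R] (Λ : Gr h R) (a D : ℤ) :
    ∃ (ι : Type) (_ : Fintype ι) (τ : ι → ℤ → R), ∀ (y : R →ₐ[K] K), ∀ v ∈ window K a D,
      v ∈ funSpace (Λ.map (y : R →+* K)).1 ↔ ∀ i, ∑ s ∈ Finset.Ico a D, y (τ i s) * v s = 0 := by
  have hh : (0 : ℤ) < h := by exact_mod_cast NeZero.pos h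
  obtain ⟨k, p, w, hp, hpw, hint⟩ := Λ.2.exists_dual
  let ω : Fin k → ℤ → ℤ → R := fun i n s =>
    (w i (Fin.ofNat h (s % h).toNat)).coeff (n - s / h)
  have hω : ∀ i n (r : Fin h) (j : ℤ), ω i n (r + h * j) = (w i r).coeff (n - j) := by
    intro i n r j
    have h1 : ((r : ℤ) + h * j) % h = r := by
      rw [Int.add_mul_emod_self_left]
      exact Int.emod_eq_of_lt (by omega) (by exact_mod_cast r.2)
    have h2 : ((r : ℤ) + h * j) / h = j := by
      rw [Int.add_mul_ediv_left _ _ hh.ne', Int.ediv_eq_zero_of_lt (by omega)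
        (by exact_mod_cast r.2), zero_add]
    simp only [ω, h1, h2]
    congr 2
    ext
    simp
  -- only finitely many `n` give a nontrivial equation
  have hfin : ∃ N : ℤ, ∀ i, ∀ s ∈ Finset.Ico a D, ∀ n < N, ω i n s = 0 := by
    have h1 : ∀ x : Fin k × Finset.Ico a D, ∃ N : ℤ, ∀ n < N, ω x.1 n x.2 = 0 := by
      rintro ⟨i, s⟩
      refine ⟨(w i (Fin.ofNat h ((s : ℤ) % h).toNat)).order + (s : ℤ) / h, fun n hn => ?_⟩
      have h2 : n - (s : ℤ) / h < (w i (Fin.ofNat h ((s : ℤ) % h).toNat)).order := by omega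
      exact HahnSeries.coeff_eq_zero_of_lt_order h2
    choose N hN using h1
    obtain ⟨N', hN'⟩ := (Set.finite_range N).bddBelow
    exact ⟨N', fun i s hs n hn => hN (i, ⟨s, hs⟩) n (hn.trans_le (hN' ⟨_, rfl⟩))⟩
  obtain ⟨N, hN⟩ := hfin
  refine ⟨Fin k × Finset.Ico N 0, inferInstance, fun i s => ω i.1 i.2 s, fun y v hv => ?_⟩
  obtain ⟨v, rfl⟩ := exists_coord_eq (h := h) v ⟨a, fun n hn => hv n (by simp; omega)⟩
  rw [coord_mem_funSpace]
  have hkey : ∀ i n, ((fun r => laurentMap (y : R →+* K) (w i r)) ⬝ᵥ v).coeff n =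
      ∑ s ∈ Finset.Ico a D, y (ω i n s) * coord v s := by
    intro i n
    conv_lhs => rw [eq_sum_single hv, dotProduct_sum, HahnSeries.coeff_sum]
    refine Finset.sum_congr rfl fun s _ => ?_
    rw [dotProduct_single, HahnSeries.coeff_mul_single]
    rfl
  have hmap : (Λ.map (y : R →+* K)).1 =
      latticeBaseChange (y : R →+* K) (Submodule.span (PowerSeries R) (Set.range p)) := by
    rw [hp]; rfl
  rw [hmap, mem_map_iff_of_dual (y : R →+* K) hpw hint]
  simp only [hkey]
  constructor
  · rintro h1 ⟨i, n⟩
    exact h1 i n (Finset.mem_Ico.1 n.2).2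
  · intro h1 i n hn
    by_cases hnN : N ≤ n
    · exact h1 (i, ⟨n, Finset.mem_Ico.2 ⟨hnN, hn⟩⟩)
    · refine Finset.sum_eq_zero fun s hs => ?_
      rw [hN i s hs n (by omega), map_zero, zero_mul]

end Equations

/-! ### Semicontinuity of dimensions -/

section Semicontinuity

variable {K : Type u} [Field K] {h : ℕ}

theorem eq_sum_of_mem_window {a D : ℤ} {v : ℤ → K} (hv : v ∈ window K a D) :
    v = ∑ s ∈ Finset.Ico a D, v s • (Pi.single s 1 : ℤ → K) := by
  funext n
  rw [Finset.sum_apply]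
  by_cases hn : n ∈ Finset.Ico a D
  · rw [Finset.sum_eq_single n _ fun h => (h hn).elim]
    · simp
    · intro s _ hs
      rw [Pi.smul_apply, Pi.single_eq_of_ne hs.symm, smul_zero]
  · rw [hv n hn]
    refine (Finset.sum_eq_zero fun s hs => ?_).symm
    rw [Pi.smul_apply, Pi.single_eq_of_ne, smul_zero]
    rintro rfl
    exact hn hs

instance (a D : ℤ) : FiniteDimensional K (window K a D) := by
  have h1 : window K a D ≤
      Submodule.span K ((fun s : ℤ => (Pi.single s 1 : ℤ → K)) '' (Finset.Ico a D)) := by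
    intro v hv
    rw [eq_sum_of_mem_window hv]
    exact Submodule.sum_mem _ fun s hs =>
      Submodule.smul_mem _ _ (Submodule.subset_span ⟨s, hs, rfl⟩)
  have := FiniteDimensional.span_of_finite K
    ((Finset.finite_toSet (Finset.Ico a D)).image fun s : ℤ => (Pi.single s 1 : ℤ → K))
  exact Submodule.finiteDimensional_of_le h1

/-- A subspace has dimension at most `d` if and only if `d` linear forms suffice to separate its
elements from zero. -/
theorem finrank_le_iff_exists {V : Type*} [AddCommGroup V] [Module K V] (E : Submodule K V)
    [FiniteDimensional K E] (d : ℕ) : Module.finrank K E ≤ d ↔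
      ∃ ℓ : V →ₗ[K] (Fin d → K), ∀ v ∈ E, ℓ v = 0 → v = 0 := by
  constructor
  · intro hd
    let b := Module.finBasis K E
    obtain ⟨ℓ, hℓ⟩ := LinearMap.exists_extend (LinearMap.pi fun i : Fin d =>
      if hi : (i : ℕ) < Module.finrank K E then b.coord ⟨i, hi⟩ else 0)
    refine ⟨ℓ, fun v hv hv0 => ?_⟩
    have h1 : b.repr ⟨v, hv⟩ = 0 := by
      ext e
      have h2 := congrFun (LinearMap.congr_fun hℓ ⟨v, hv⟩) ⟨e, e.2.trans_le hd⟩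
      simpa [hv0] using h2.symm
    simpa using b.repr.map_eq_zero_iff.1 h1
  · rintro ⟨ℓ, hℓ⟩
    have h1 : Function.Injective (ℓ.comp E.subtype) := by
      rw [injective_iff_map_eq_zero]
      intro v hv
      exact Subtype.ext (hℓ v v.2 hv)
    simpa using LinearMap.finrank_le_finrank_of_injective h1

/-- The leading exponents of a space of functions are the places where the dimensions of its
intersections with the windows jump. -/
theorem exists_leads_iff_finrank_lt {E : Submodule K (ℤ → K)} {a D : ℤ} (hE : tail K D ≤ E)
    (haD : a < D) : (∃ v ∈ E, Leads v a) ↔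
      Module.finrank K (E ⊓ window K (a + 1) D : Submodule K (ℤ → K)) <
        Module.finrank K (E ⊓ window K a D : Submodule K (ℤ → K)) := by
  have : FiniteDimensional K (E ⊓ window K a D : Submodule K (ℤ → K)) :=
    Submodule.finiteDimensional_of_le inf_le_right
  have hle : E ⊓ window K (a + 1) D ≤ E ⊓ window K a D := by
    refine inf_le_inf_left _ fun v hv n hn => hv n ?_
    simp only [Finset.mem_Ico] at hn ⊢
    omega
  constructor
  · rintro ⟨v, hv, hva, hlt⟩
    refine Submodule.finrank_lt_finrank_of_lt (lt_of_le_of_ne hle fun he => ?_)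
    let w : ℤ → K := fun n => if n < D then v n else 0
    have hw : w ∈ E ⊓ window K a D := by
      constructor
      · have h1 : v - w ∈ tail K D := fun n hn => by simp [w, hn]
        have := E.sub_mem hv (hE h1)
        rwa [sub_sub_cancel] at this
      · intro n hn
        simp only [Finset.mem_Ico, not_and, not_lt] at hn
        by_cases h1 : n < D
        · simp only [w, h1, if_true]
          exact hlt n (by by_contra h2; have := hn (by omega); omega)
        · simp [w, h1]
    rw [← he] at hw
    have := hw.2 a (by simp)
    simp only [w, haD, if_true] at this
    exact hva this
  · intro hlt
    by_contra hno
    push Not at hno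
    refine hlt.ne' (congrArg (fun E : Submodule K (ℤ → K) => Module.finrank K E)
      (le_antisymm (fun v hv => ⟨hv.1, ?_⟩) hle))
    have h1 : v ∈ tail K a := fun n hn => hv.2 n (by simp; omega)
    rcases mem_tail_succ_or_leads h1 with h2 | h2
    · intro n hn
      by_cases h3 : n < a + 1
      · exact h2 n h3
      · refine hv.2 n ?_
        simp only [Finset.mem_Ico] at hn ⊢
        omega
    · exact (hno v hv.1 h2).elim

variable [NeZero h] {q : ℕ} {σ : K →+* K}

/-- The condition that a function `v` with support in `[a, D)` belongs to the `n`-th level of the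
lattice at the point `y` of a family is given by finitely many linear equations in the values of
`σ ∘ v`. To this end, the equations for `v` to belong to the lattice are raised to the `q`-th
power. -/
theorem exists_level_equations (hσ : ∀ z, σ z = z ^ q) {R : Type u} [CommRing R] [Algebra K R]
    (Λ : Gr h R) (m n : ℕ) (a D : ℤ) :
    ∃ (ι : Type) (_ : Fintype ι) (τ : ι → ℤ → R), ∀ (y : R →ₐ[K] K), ∀ v ∈ window K a D,
      v ∈ levelSubspace m h σ (funSpace (Λ.map (y : R →+* K)).1) n ↔
        ∀ i, ∑ s ∈ Finset.Ico a D, y (τ i s) * σ (v s) = 0 := by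
  set j : ℤ := m - n * h with hj
  obtain ⟨ι₁, _, τ₁, h₁⟩ := exists_equations (K := K) Λ a D
  obtain ⟨ι₂, _, τ₂, h₂⟩ := exists_equations (K := K) Λ (a + j) (D + j)
  refine ⟨ι₁ ⊕ ι₂, inferInstance, Sum.elim (fun i s => τ₁ i s ^ q) fun i s => τ₂ i (s + j),
    fun y v hv => ?_⟩
  have h3 : shift K j (σ ∘ v) ∈ window K (a + j) (D + j) := by
    intro n hn
    rw [shift_apply, Function.comp_apply, hv, map_zero]
    simp only [Finset.mem_Ico] at hn ⊢
    omega
  rw [mem_levelSubspace, ← hj, h₁ y v hv, h₂ y _ h3, Sum.forall]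
  refine and_congr (forall_congr' fun i => ?_) (forall_congr' fun i => ?_)
  · rw [← map_eq_zero σ, map_sum]
    simp only [map_mul, hσ (y _), Sum.elim_inl, map_pow]
  · rw [← Finset.sum_Ico_add']
    simp only [Sum.elim_inr, shift_apply, add_sub_cancel_right, Function.comp_apply]

/-- The dimensions of the levels in a window are upper semicontinuous: linear forms that separate
the elements of this space from zero at one point, together with the equations of the space, make up
a matrix that is injective there, hence also where a suitable determinant does not vanish. -/
theorem isOpen_finrank_le (hσ : ∀ z, σ z = z ^ q) (hσ' : Function.Surjective σ) (m n : ℕ)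
    (a D : ℤ) (d : ℕ) : IsOpen {M : Gr h K | Module.finrank K
      (levelSubspace m h σ (funSpace M.1) n ⊓ window K a D : Submodule K (ℤ → K)) ≤ d} := by
  have hfin : ∀ E : Submodule K (ℤ → K),
      FiniteDimensional K (E ⊓ window K a D : Submodule K (ℤ → K)) :=
    fun E => Submodule.finiteDimensional_of_le inf_le_right
  refine Gr.isOpen_iff.2 fun R _ _ _ Λ y hy => ?_
  obtain ⟨ι, _, τ, hτ⟩ := exists_level_equations hσ Λ m n a D
  obtain ⟨ℓ, hℓ⟩ := (finrank_le_iff_exists _ d).1 hy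
  have hℓ' : ∀ v ∈ window K a D, ∀ e,
      σ (ℓ v e) = ∑ s ∈ Finset.Ico a D, σ (ℓ (Pi.single s 1) e) * σ (v s) := by
    intro v hv e
    conv_lhs => rw [eq_sum_of_mem_window hv]
    rw [map_sum, Finset.sum_apply, map_sum]
    refine Finset.sum_congr rfl fun s _ => ?_
    rw [map_smul, Pi.smul_apply, smul_eq_mul, map_mul, mul_comm]
  let T : Matrix (ι ⊕ Fin d) (Finset.Ico a D) R := fun i s =>
    Sum.elim (fun i => τ i s) (fun e => algebraMap K R (σ (ℓ (Pi.single (s : ℤ) 1) e))) i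
  obtain ⟨B, hB⟩ := exists_det_ne_zero T y fun c hc => by
    choose c' hc' using fun s => hσ' (c s)
    let v : ℤ → K := fun s => if hs : s ∈ Finset.Ico a D then c' ⟨s, hs⟩ else 0
    have hv : v ∈ window K a D := fun s hs => dif_neg hs
    have hvc : ∀ s : Finset.Ico a D, σ (v s) = c s := fun s => by
      simp only [v, s.2, dite_true, hc']
    have hsum : ∀ g : ℤ → K, ∑ s ∈ Finset.Ico a D, g s * σ (v s) =
        ∑ s : Finset.Ico a D, g s * c s := by
      intro g
      rw [← Finset.sum_coe_sort (Finset.Ico a D)]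
      simp only [hvc]
    have hv0 : v = 0 := by
      refine hℓ v ⟨(hτ y v hv).2 fun i => ?_, hv⟩ (funext fun e => ?_)
      · rw [hsum]
        exact hc (Sum.inl i)
      · rw [Pi.zero_apply, ← map_eq_zero σ, hℓ' v hv, hsum]
        have := hc (Sum.inr e)
        simpa [T] using this
    funext s
    rw [← hvc, hv0]
    simp
  refine ⟨_, hB, fun y' hy' => (finrank_le_iff_exists _ d).2 ⟨ℓ, fun v hv hv0 => ?_⟩⟩
  have h1 := eq_zero_of_det_ne_zero hy' (c := fun s => σ (v s)) fun i => by
    rw [Finset.sum_coe_sort (Finset.Ico a D) fun s => y' (Sum.elim (fun i => τ i s)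
      (fun e => algebraMap K R (σ (ℓ (Pi.single (s : ℤ) 1) e))) i) * σ (v s)]
    rcases i with i | e
    · exact (hτ y' v hv.2).1 hv.1 i
    · simp only [Sum.elim_inr, AlgHom.commutes, Algebra.algebraMap_self, RingHom.id_apply]
      rw [← hℓ' v hv.2, hv0, Pi.zero_apply, map_zero]
  rw [eq_sum_of_mem_window hv.2]
  refine Finset.sum_eq_zero fun s hs => ?_
  have h2 := congrFun h1 ⟨s, hs⟩
  rw [Pi.zero_apply, map_eq_zero] at h2
  rw [h2, zero_smul]

theorem isClosed_le_finrank (hσ : ∀ z, σ z = z ^ q) (hσ' : Function.Surjective σ) (m n : ℕ)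
    (a D : ℤ) (d : ℕ) : IsClosed {M : Gr h K | d ≤ Module.finrank K
      (levelSubspace m h σ (funSpace M.1) n ⊓ window K a D : Submodule K (ℤ → K))} := by
  rcases d with _ | d
  · simp
  · rw [← isOpen_compl_iff]
    convert isOpen_finrank_le (h := h) hσ hσ' m n a D d using 1
    ext M
    simp

theorem isClosed_funSpace_le_tail (D : ℤ) : IsClosed {M : Gr h K | funSpace M.1 ≤ tail K D} := by
  rw [← isOpen_compl_iff]
  refine Gr.isOpen_iff.2 fun R _ _ _ Λ y hy => ?_
  obtain ⟨k, p, hp⟩ := Λ.2.exists_span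
  have hmap : ∀ y : R →ₐ[K] K, (Λ.map (y : R →+* K)).1 =
      Submodule.span (PowerSeries K) (Set.range fun i r => laurentMap (y : R →+* K) (p i r)) := by
    intro y
    rw [← latticeBaseChange_span, hp]
    rfl
  by_cases hr : ∃ i, ∃ n < D, y (coord (p i) n) ≠ 0
  · obtain ⟨i, n, hn, hr⟩ := hr
    refine ⟨_, hr, fun y' hy' hle => hy' ?_⟩
    have h1 : coord (fun r => laurentMap (y' : R →+* K) (p i r)) ∈ tail K D := by
      apply hle
      rw [coord_mem_funSpace, hmap]
      exact Submodule.subset_span ⟨i, rfl⟩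
    exact h1 n hn
  · push Not at hr
    refine (hy fun w hw => ?_).elim
    obtain ⟨v, hv, rfl⟩ := mem_funSpace.1 hw
    rw [hmap] at hv
    clear hw
    induction hv using Submodule.span_induction with
    | mem v hv =>
      obtain ⟨i, rfl⟩ := hv
      exact fun n hn => hr i n hn
    | zero => exact Submodule.zero_mem _
    | add v w _ _ hv hw => exact Submodule.add_mem _ hv hw
    | smul c v _ hv => exact coord_mem_tail c hv

theorem isClosed_tail_le_funSpace (D : ℤ) : IsClosed {M : Gr h K | tail K D ≤ funSpace M.1} := by
  have h1 : {M : Gr h K | tail K D ≤ funSpace M.1} =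
      ⋂ b : Set.Ici D, {M : Gr h K | (Pi.single (b : ℤ) 1 : ℤ → K) ∈ funSpace M.1} := by
    ext M
    simp only [Set.mem_iInter]
    constructor
    · intro hM b
      refine hM fun n hn => Pi.single_eq_of_ne ?_ _
      have := b.2
      rw [Set.mem_Ici] at this
      omega
    · intro hM
      refine tail_le_of_leads M.2.isFunLattice.exists_ge fun a ha => ⟨_, hM ⟨a, ha⟩, ?_, ?_⟩
      · simp
      · exact fun n hn => Pi.single_eq_of_ne hn.ne _
  rw [h1]
  refine isClosed_iInter fun b => ?_
  rw [← isOpen_compl_iff]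
  refine Gr.isOpen_iff.2 fun R _ _ _ Λ y hy => ?_
  obtain ⟨ι, _, τ, hτ⟩ := exists_equations (K := K) Λ b (b + 1)
  have h2 : ∀ y : R →ₐ[K] K, (Pi.single (b : ℤ) 1 : ℤ → K) ∈ funSpace (Λ.map (y : R →+* K)).1 ↔
      ∀ i, y (τ i b) = 0 := by
    intro y
    have h3 : (Pi.single (b : ℤ) 1 : ℤ → K) ∈ window K b (b + 1) := by
      intro n hn
      refine Pi.single_eq_of_ne ?_ _
      rintro rfl
      simp at hn
    rw [hτ y _ h3]
    have h4 : Finset.Ico (b : ℤ) (b + 1) = {(b : ℤ)} := by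
      ext n
      simp only [Finset.mem_Ico, Finset.mem_singleton]
      omega
    simp [h4]
  simp only [Set.mem_compl_iff, Set.mem_ofPred_eq, h2, not_forall] at hy ⊢
  obtain ⟨i, hi⟩ := hy
  exact ⟨_, hi, fun y' hy' => ⟨i, hy'⟩⟩

end Semicontinuity

/-! ### Local closedness of the strata -/

section LocallyClosed

variable {K : Type u} [Field K] {m h : ℕ} {A : Set ℤ} {f : ℤ → ℕ} {lo y : ℤ} {q : ℕ}
  {σ : K →+* K}

theorem tail_le_levelSubspace {L : Submodule K (ℤ → K)} (hL : tail K y ≤ L) {n : ℕ} {D : ℤ}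
    (hD : y + n * h ≤ D) : tail K D ≤ levelSubspace m h σ L n := by
  have h1 : (0 : ℤ) ≤ n * h := by positivity
  refine fun v hv => ⟨hL (tail_anti (by omega) hv), hL ?_⟩
  exact tail_anti (by omega) (shift_mem_tail (comp_mem_tail hv) _)

/-- With `y - lo` in place of `m`, the level `0` of a lattice between `tail K y` and `tail K lo` is
the lattice itself, so that statements on levels apply to the lattice. -/
theorem levelSubspace_eq_self {L : Submodule K (ℤ → K)} (h1 : tail K y ≤ L) (h2 : L ≤ tail K lo) :
    levelSubspace (y - lo).toNat h σ L 0 = L := by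
  refine le_antisymm (fun v hv => hv.1) fun v hv => ⟨hv, h1 ?_⟩
  refine tail_anti ?_ (shift_mem_tail (comp_mem_tail (h2 hv)) _)
  have := Int.self_le_toNat (y - lo)
  push_cast
  omega

theorem finrank_inf_window_le {E : Submodule K (ℤ → K)} (a D : ℤ) :
    Module.finrank K (E ⊓ window K a D : Submodule K (ℤ → K)) ≤
      Module.finrank K (E ⊓ window K (a + 1) D : Submodule K (ℤ → K)) + 1 := by
  have : ∀ a, FiniteDimensional K (E ⊓ window K a D : Submodule K (ℤ → K)) := fun a =>
    Submodule.finiteDimensional_of_le inf_le_right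
  obtain ⟨ℓ, hℓ⟩ := (finrank_le_iff_exists (E ⊓ window K (a + 1) D) _).1 le_rfl
  refine (finrank_le_iff_exists _ _).2
    ⟨LinearMap.pi (Fin.cons (LinearMap.proj a) fun i => (LinearMap.proj i).comp ℓ),
      fun v hv hv0 => hℓ v ⟨hv.1, fun n hn => ?_⟩ (funext fun i => ?_)⟩
  · by_cases hna : n = a
    · subst hna
      simpa using congrFun hv0 0
    · refine hv.2 n ?_
      simp only [Finset.mem_Ico] at hn ⊢
      omega
  · simpa using congrFun hv0 i.succ

/-- Spaces with the same leading exponents have the same dimensions in the windows. -/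
theorem finrank_inf_window_eq {E E' : Submodule K (ℤ → K)} {D : ℤ} (hE : tail K D ≤ E)
    (hE' : tail K D ≤ E') {a : ℤ}
    (hl : ∀ b, a ≤ b → b < D → ((∃ v ∈ E, Leads v b) ↔ ∃ v ∈ E', Leads v b)) (haD : a ≤ D) :
    Module.finrank K (E ⊓ window K a D : Submodule K (ℤ → K)) =
      Module.finrank K (E' ⊓ window K a D : Submodule K (ℤ → K)) := by
  induction a, haD using Int.leInductionDown with
  | base =>
    have h1 : window K D D = ⊥ := by
      rw [eq_bot_iff]
      intro v hv
      exact funext fun n => hv n (by simp)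
    rw [h1, inf_bot_eq, inf_bot_eq]
  | pred a ha ih =>
    have h1 := hl (a - 1) le_rfl (by omega)
    rw [exists_leads_iff_finrank_lt hE (by omega), exists_leads_iff_finrank_lt hE' (by omega),
      sub_add_cancel, ih fun b hb => hl b (by omega)] at h1
    have h2 := finrank_inf_window_le (E := E) (a - 1) D
    have h3 := finrank_inf_window_le (E := E') (a - 1) D
    have h4 : ∀ E : Submodule K (ℤ → K),
        Module.finrank K (E ⊓ window K a D : Submodule K (ℤ → K)) ≤
        Module.finrank K (E ⊓ window K (a - 1) D : Submodule K (ℤ → K)) := by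
      intro E
      have : FiniteDimensional K (E ⊓ window K (a - 1) D : Submodule K (ℤ → K)) :=
        Submodule.finiteDimensional_of_le inf_le_right
      refine Submodule.finrank_mono (inf_le_inf_left _ fun v hv n hn => hv n ?_)
      simp only [Finset.mem_Ico] at hn ⊢
      omega
    have h5 := h4 E
    have h6 := h4 E'
    rw [sub_add_cancel] at h2 h3
    rw [ih fun b hb => hl b (by omega)] at h2 h5
    omega

/-- For lattices between `tail K y` and `tail K lo`, the invariants are determined by finitely many
of their values. -/
theorem IsFrame.hasInvariants_of_leads_iff (F : IsFrame m h A f lo y)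
    (hσ : Function.Surjective σ) {L : Submodule K (ℤ → K)} (hL : IsFunLattice h L)
    (h1 : tail K y ≤ L) (h2 : L ≤ tail K lo) {N : ℕ} (hN : ∀ a, a < y → a ∈ A → f a ≤ N)
    (h3 : ∀ a, lo ≤ a → a < y → ((∃ v ∈ L, Leads v a) ↔ a ∈ A))
    (h4 : ∀ a, a < y → a ∈ A → ∀ n ≤ N + 1,
      (∃ v ∈ levelSubspace m h σ L n, Leads v a) ↔ n ≤ f a) :
    HasInvariants m h σ A f L := by
  have hl : ∀ a, (∃ v ∈ L, Leads v a) ↔ a ∈ A := by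
    intro a
    rcases lt_or_ge a lo with ha | ha
    · refine iff_of_false ?_ fun h => ?_
      · rintro ⟨v, hv, hv'⟩
        exact hv'.1 (h2 hv a ha)
      · have := F.le_of_mem a h
        omega
    rcases lt_or_ge a y with ha' | ha'
    · exact h3 a ha ha'
    · refine iff_of_true ⟨Pi.single a 1, h1 fun n hn => Pi.single_eq_of_ne (by omega) _, ?_, ?_⟩
        (F.mem_of_le a ha')
      · simp
      · exact fun n hn => Pi.single_eq_of_ne hn.ne _
  refine ⟨hl, fun a ha n => ?_⟩
  rcases lt_or_ge a y with ha' | ha'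
  · by_cases hn : n ≤ N + 1
    · exact h4 a ha' ha n hn
    · have := hN a ha' ha
      refine iff_of_false ?_ (by omega)
      rintro ⟨v, hv, hv'⟩
      have := (h4 a ha' ha (N + 1) le_rfl).1
        ⟨v, levelSubspace_anti hL (not_le.1 hn).le hv, hv'⟩
      omega
  · constructor
    · rintro ⟨v, hv, hv'⟩
      refine F.le_of_image_mem ha' ?_
      have := (hl _).1 ⟨_, hv.2, hv'.comp.shift _⟩
      rwa [← add_sub_assoc] at this
    · intro hn
      obtain ⟨w, hw, hw'⟩ := (hl (a + m - f a * h)).2 (F.image_mem a ha)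
      choose s hs using hσ
      let v : ℤ → K := fun i => s (w (i + (m - f a * h)))
      have h5 : shift K (m - f a * h) (σ ∘ v) = w := by
        funext i
        simp only [shift_apply, Function.comp_apply, v, hs]
        congr 1
        ring
      have h6 : ∀ i < a, v i = 0 := by
        intro i hi
        rw [← map_eq_zero σ]
        simp only [v, hs]
        exact hw'.2 _ (by omega)
      refine ⟨v, levelSubspace_anti hL hn ⟨h1 fun i hi => h6 i (by omega), by rwa [h5]⟩, ?_, h6⟩
      rw [← map_ne_zero σ]
      simp only [v, hs]
      convert hw'.1 using 2
      ring

/-- The lattices with given invariants form a locally closed subset: between two fixed lattices,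
the invariants are determined by the dimensions of finitely many spaces, all of them upper
semicontinuous. -/
theorem IsFrame.isLocallyClosed [NeZero h] (F : IsFrame m h A f lo y) (hσ : ∀ z, σ z = z ^ q)
    (hσ' : Function.Surjective σ) :
    IsLocallyClosed {M : Gr h K | HasInvariants m h σ A f (funSpace M.1)} := by
  rcases Set.eq_empty_or_nonempty {M : Gr h K | HasInvariants m h σ A f (funSpace M.1)} with
    he | ⟨M₀, hM₀⟩
  · rw [he]; exact isClosed_empty.isLocallyClosed
  obtain ⟨N, hN⟩ := ((Set.finite_Icc lo y).image f).bddAbove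
  have hN' : ∀ a, a < y → a ∈ A → f a ≤ N := fun a ha haA =>
    hN ⟨a, ⟨F.le_of_mem a haA, ha.le⟩, rfl⟩
  set D : ℤ := y + (N + 1 : ℕ) * h with hD
  have hyD : y ≤ D := by have : (0 : ℤ) ≤ (N + 1 : ℕ) * h := by positivity
                         omega
  let dim : (ℕ × ℕ) × ℤ → Gr h K → ℕ := fun t M => Module.finrank K
    (levelSubspace t.1.1 h σ (funSpace M.1) t.1.2 ⊓ window K t.2 D : Submodule K (ℤ → K))
  let T : Finset ((ℕ × ℕ) × ℤ) :=
    (insert ((y - lo).toNat, 0) ((Finset.range (N + 2)).image fun n => (m, n))) ×ˢ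
      Finset.Icc lo y
  have hT₁ : ∀ a, lo ≤ a → a ≤ y → (((y - lo).toNat, 0), a) ∈ T := fun a h1 h2 => by
    simp [T, h1, h2]
  have hT₂ : ∀ a, lo ≤ a → a ≤ y → ∀ n ≤ N + 1, ((m, n), a) ∈ T := fun a h1 h2 n hn => by
    simp only [T, Finset.mem_product, Finset.mem_insert, Finset.mem_image, Finset.mem_range,
      Finset.mem_Icc]
    exact ⟨Or.inr ⟨n, by omega, rfl⟩, h1, h2⟩
  have hT₃ : ∀ t ∈ T, (t.1 = ((y - lo).toNat, 0) ∨ ∃ n ≤ N + 1, t.1 = (m, n)) ∧ t.2 ≤ y := by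
    rintro ⟨t, a⟩ ht
    simp only [T, Finset.mem_product, Finset.mem_insert, Finset.mem_image, Finset.mem_range,
      Finset.mem_Icc] at ht
    rcases ht with ⟨rfl | ⟨n, hn, rfl⟩, ha⟩
    · exact ⟨Or.inl rfl, ha.2⟩
    · exact ⟨Or.inr ⟨n, by omega, rfl⟩, ha.2⟩
  clear_value T
  have hM₀' := M₀.2.isFunLattice
  have h1₀ := HasInvariants.tail_le hM₀ F hM₀'
  have h2₀ := HasInvariants.le_tail hM₀ F hM₀'
  have htail : ∀ M : Gr h K, tail K y ≤ funSpace M.1 → ∀ m' n, n ≤ N + 1 →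
      tail K D ≤ levelSubspace m' h σ (funSpace M.1) n := by
    intro M hM m' n hn
    refine tail_le_levelSubspace hM ?_
    have h5 : (n : ℤ) ≤ (N + 1 : ℕ) := by exact_mod_cast hn
    have h6 : (0 : ℤ) ≤ h := by positivity
    have := mul_le_mul_of_nonneg_right h5 h6
    omega
  have hkey : {M : Gr h K | HasInvariants m h σ A f (funSpace M.1)} =
      (⋂ t ∈ T, {M | dim t M ≤ dim t M₀}) ∩
      (({M | tail K y ≤ funSpace M.1} ∩ {M | funSpace M.1 ≤ tail K lo}) ∩
        ⋂ t ∈ T, {M | dim t M₀ ≤ dim t M}) := by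
    ext M
    have hM := M.2.isFunLattice
    simp only [Set.mem_inter_iff, Set.mem_iInter, Set.mem_ofPred_eq]
    constructor
    · intro hI
      have h1 := hI.tail_le F hM
      have h2 := hI.le_tail F hM
      have heq : ∀ t ∈ T, dim t M = dim t M₀ := by
        rintro ⟨⟨m', n⟩, a⟩ ht
        obtain ⟨ht, ha⟩ := hT₃ _ ht
        have hn : n ≤ N + 1 := by
          rcases ht with ht | ⟨n', hn', ht⟩
          · have := congrArg Prod.snd ht
            dsimp only at this
            omega
          · have := congrArg Prod.snd ht
            dsimp only at this
            omega
        refine finrank_inf_window_eq (htail M h1 m' n hn) (htail M₀ h1₀ m' n hn)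
          (fun a _ _ => ?_) (by dsimp only at ha; omega)
        rcases ht with ht | ⟨n', hn', ht⟩
        · obtain ⟨rfl, rfl⟩ := Prod.mk.inj ht
          rw [levelSubspace_eq_self h1 h2, levelSubspace_eq_self h1₀ h2₀, hI.leads_iff,
            hM₀.leads_iff]
        · obtain ⟨rfl, rfl⟩ := Prod.mk.inj ht
          by_cases haA : a ∈ A
          · rw [hI.level_iff a haA, hM₀.level_iff a haA]
          · refine iff_of_false ?_ ?_
            · rintro ⟨v, hv, hv'⟩
              exact haA ((hI.leads_iff a).1 ⟨v, hv.1, hv'⟩)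
            · rintro ⟨v, hv, hv'⟩
              exact haA ((hM₀.leads_iff a).1 ⟨v, hv.1, hv'⟩)
      exact ⟨fun t ht => (heq t ht).le, ⟨h1, h2⟩, fun t ht => (heq t ht).ge⟩
    · rintro ⟨h3, ⟨h1, h2⟩, h4⟩
      have heq : ∀ t ∈ T, dim t M = dim t M₀ := fun t ht => (h3 t ht).antisymm (h4 t ht)
      have htrans : ∀ m' n a, n ≤ N + 1 → a < y → ((m', n), a) ∈ T → ((m', n), a + 1) ∈ T →
          ((∃ v ∈ levelSubspace m' h σ (funSpace M.1) n, Leads v a) ↔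
            ∃ v ∈ levelSubspace m' h σ (funSpace M₀.1) n, Leads v a) := by
        intro m' n a hn ha h5 h6
        rw [exists_leads_iff_finrank_lt (htail M h1 m' n hn) (by omega),
          exists_leads_iff_finrank_lt (htail M₀ h1₀ m' n hn) (by omega)]
        have h7 := heq ((m', n), a) h5
        have h8 := heq ((m', n), a + 1) h6
        simp only [dim] at h7 h8
        rw [h7, h8]
      refine F.hasInvariants_of_leads_iff hσ' hM h1 h2 hN' (fun a ha ha' => ?_)
        fun a ha haA n hn => ?_
      · have := htrans (y - lo).toNat 0 a (Nat.zero_le _) ha' (hT₁ a ha ha'.le)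
          (hT₁ (a + 1) (by omega) (by omega))
        rw [levelSubspace_eq_self h1 h2, levelSubspace_eq_self h1₀ h2₀] at this
        rw [this]
        exact hM₀.leads_iff a
      · have hlo := F.le_of_mem a haA
        rw [htrans m n a hn ha (hT₂ a hlo ha.le n hn) (hT₂ (a + 1) (by omega) (by omega) n hn)]
        exact hM₀.level_iff a haA n
  rw [hkey]
  refine ⟨_, _, ?_, ?_, rfl⟩
  · exact isOpen_biInter_finset fun t _ => isOpen_finrank_le hσ hσ' t.1.1 t.1.2 t.2 D (dim t M₀)
  · exact ((isClosed_tail_le_funSpace y).inter (isClosed_funSpace_le_tail lo)).inter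
      (isClosed_biInter fun t _ => isClosed_le_finrank hσ hσ' t.1.1 t.1.2 t.2 D (dim t M₀))

end LocallyClosed

/-! ### Functions that are algebraic up to Frobenius -/

section Radicial

variable {K : Type*} [Field K] {R : Type*} [CommRing R] [Algebra K R] {Y : Type*} {q : ℕ}
  {σ : K →+* K}

theorem iterate_frobenius_map (hσ : ∀ z, σ z = z ^ q) (n : ℕ) (y : R →ₐ[K] K) (r : R) :
    σ^[n] (y r) = y (r ^ q ^ n) := by
  induction n with
  | zero => simp
  | succ n ih => rw [Function.iterate_succ_apply', ih, hσ, ← map_pow, ← pow_mul, pow_succ]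

/-- For a set `Y` of `K`-valued points of `Spec R`, given by `ev`, and a point `t₀` of `Y`, this is
the algebra of the functions `g` on `Y` for which some power `g ^ (q ^ N)` is, up to a denominator
that does not vanish at `t₀`, given by an element of `R`. -/
def radicialAlgebra (hσ : ∀ z, σ z = z ^ q) (ev : Y → R →ₐ[K] K) (t₀ : Y) :
    Subalgebra K (Y → K) :=
  have key : ∀ {g : Y → K} {N : ℕ} {r a : R}, ev t₀ r ≠ 0 →
      (∀ t, σ^[N] (g t) * ev t r = ev t a) → ∀ n, ev t₀ (r ^ q ^ n) ≠ 0 ∧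
        ∀ t, σ^[n + N] (g t) * ev t (r ^ q ^ n) = ev t (a ^ q ^ n) := by
    intro g N r a hr h n
    refine ⟨by rw [map_pow]; exact pow_ne_zero _ hr, fun t => ?_⟩
    rw [Function.iterate_add_apply, ← iterate_frobenius_map hσ, ← iterate_frobenius_map hσ, ← h t,
      iterate_map_mul]
  { carrier := {g | ∃ (N : ℕ) (r a : R), ev t₀ r ≠ 0 ∧ ∀ t, σ^[N] (g t) * ev t r = ev t a}
    mul_mem' := by
      rintro g g' ⟨N, r, a, hr, h⟩ ⟨N', r', a', hr', h'⟩
      obtain ⟨h1, h2⟩ := key hr h N'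
      obtain ⟨h3, h4⟩ := key hr' h' N
      refine ⟨N' + N, r ^ q ^ N' * r' ^ q ^ N, a ^ q ^ N' * a' ^ q ^ N,
        (map_mul (ev t₀) _ _).trans_ne (mul_ne_zero h1 h3), fun t => ?_⟩
      rw [map_mul, map_mul, ← h2, ← h4, Pi.mul_apply, iterate_map_mul, add_comm N N']
      ring
    add_mem' := by
      rintro g g' ⟨N, r, a, hr, h⟩ ⟨N', r', a', hr', h'⟩
      obtain ⟨h1, h2⟩ := key hr h N'
      obtain ⟨h3, h4⟩ := key hr' h' N
      refine ⟨N' + N, r ^ q ^ N' * r' ^ q ^ N, a ^ q ^ N' * r' ^ q ^ N + a' ^ q ^ N * r ^ q ^ N',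
        (map_mul (ev t₀) _ _).trans_ne (mul_ne_zero h1 h3), fun t => ?_⟩
      rw [map_add, map_mul, map_mul, map_mul, ← h2, ← h4, Pi.add_apply, iterate_map_add,
        add_comm N N']
      ring
    algebraMap_mem' := fun c => ⟨0, 1, algebraMap K R c, by simp, fun t => by simp⟩ }

variable {hσ : ∀ z, σ z = z ^ q} {ev : Y → R →ₐ[K] K} {t₀ : Y}

theorem mem_radicialAlgebra {g : Y → K} : g ∈ radicialAlgebra hσ ev t₀ ↔
    ∃ (N : ℕ) (r a : R), ev t₀ r ≠ 0 ∧ ∀ t, σ^[N] (g t) * ev t r = ev t a := Iff.rfl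

theorem eval_mem_radicialAlgebra (r : R) : (fun t => ev t r) ∈ radicialAlgebra hσ ev t₀ :=
  mem_radicialAlgebra.2 ⟨0, 1, r, by simp, fun t => by simp⟩

theorem mem_radicialAlgebra_of_frobenius {g : Y → K}
    (hg : (fun t => σ (g t)) ∈ radicialAlgebra hσ ev t₀) : g ∈ radicialAlgebra hσ ev t₀ := by
  obtain ⟨N, r, a, hr, h⟩ := hg
  exact ⟨N + 1, r, a, hr, h⟩

theorem frobenius_mem_radicialAlgebra {g : Y → K}
    (hg : g ∈ radicialAlgebra hσ ev t₀) : (fun t => σ (g t)) ∈ radicialAlgebra hσ ev t₀ := by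
  have h1 : (fun t => σ (g t)) = g ^ q := funext fun t => hσ _
  rw [h1]
  exact pow_mem hg q

theorem mem_radicialAlgebra_of_mul {d g : Y → K} (hd : d ∈ radicialAlgebra hσ ev t₀)
    (hd₀ : d t₀ ≠ 0) (hdg : d * g ∈ radicialAlgebra hσ ev t₀) : g ∈ radicialAlgebra hσ ev t₀ := by
  obtain ⟨N, r, a, hr, h⟩ := hd
  obtain ⟨N', r', a', hr', h'⟩ := hdg
  -- the power of `g` is `(a' ^ (q ^ N) r ^ (q ^ N')) / (a ^ (q ^ N') r' ^ (q ^ N))`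
  refine ⟨N + N', a ^ q ^ N' * r' ^ q ^ N, a' ^ q ^ N * r ^ q ^ N', ?_, fun t => ?_⟩
  · have h1 : ev t₀ a ≠ 0 := by
      rw [← h]
      refine mul_ne_zero ?_ hr
      have h2 := iterate_frobenius_map (R := K) hσ N (AlgHom.id K K) (d t₀)
      simp only [AlgHom.id_apply] at h2
      rw [h2]
      exact pow_ne_zero _ hd₀
    rw [map_mul, map_pow, map_pow]
    exact mul_ne_zero (pow_ne_zero _ h1) (pow_ne_zero _ hr')
  · simp only [map_mul, ← iterate_frobenius_map hσ, ← h, ← h', iterate_map_mul, Pi.mul_apply]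
    simp only [← Function.iterate_add_apply]
    rw [add_comm N' N]
    ring

/-- A function of this kind that does not vanish at `t₀` does not vanish in a neighbourhood. -/
theorem exists_ne_zero_of_mem_radicialAlgebra {g : Y → K} (hg : g ∈ radicialAlgebra hσ ev t₀)
    (hg₀ : g t₀ ≠ 0) : ∃ r : R, ev t₀ r ≠ 0 ∧ ∀ t, ev t r ≠ 0 → g t ≠ 0 := by
  obtain ⟨N, r, a, hr, h⟩ := hg
  have h2 : ∀ z, σ^[N] z = z ^ q ^ N := fun z => by
    simpa using iterate_frobenius_map (R := K) hσ N (AlgHom.id K K) z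
  refine ⟨a, ?_, fun t ht h0 => ?_⟩
  · rw [← h, h2]
    exact mul_ne_zero (pow_ne_zero _ hg₀) hr
  · rw [← h, h0, iterate_map_zero, zero_mul] at ht
    exact ht rfl

/-- The solution of a system of linear equations with coefficients in the algebra belongs to it if
the solution at `t₀` is unique. -/
theorem mem_radicialAlgebra_of_linear {ι κ : Type*} [Fintype ι] [Fintype κ] [DecidableEq κ]
    (T : ι → κ → R) {b : ι → Y → K} (hb : ∀ i, b i ∈ radicialAlgebra hσ ev t₀) {c : κ → Y → K}
    (hc : ∀ t i, ∑ j, ev t (T i j) * c j t = b i t)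
    (hT : ∀ c : κ → K, (∀ i, ∑ j, ev t₀ (T i j) * c j = 0) → c = 0) (j : κ) :
    c j ∈ radicialAlgebra hσ ev t₀ := by
  let 𝓡 := radicialAlgebra hσ ev t₀
  let T' : Matrix ι κ 𝓡 := fun i j => ⟨fun t => ev t (T i j), eval_mem_radicialAlgebra _⟩
  let χ : Y → 𝓡 →ₐ[K] K := fun t => (Pi.evalAlgHom K (fun _ : Y => K) t).comp 𝓡.val
  obtain ⟨B, hB⟩ := exists_det_ne_zero T' (χ t₀) hT
  refine mem_radicialAlgebra_of_mul (B.map (algebraMap K 𝓡) * T').det.2 hB ?_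
  have h1 : ((B.map (algebraMap K 𝓡) * T').det : Y → K) * c j =
      (((B.map (algebraMap K 𝓡) * T').adjugate.mulVec
        ((B.map (algebraMap K 𝓡)).mulVec fun i => ⟨b i, hb i⟩)) j : Y → K) :=
    funext fun t => det_smul_eq_of_sum_eq T' B (fun i => ⟨b i, hb i⟩) (χ t) (hc t) j
  rw [h1]
  exact SetLike.coe_mem _

end Radicial

/-! ### The parameters are algebraic up to Frobenius -/

section Parameters

/-- Elimination of the coefficients between `n` and `D` at the leading exponents of elements
of `E`. -/
theorem exists_eliminated {K : Type*} [Field K] {E : Submodule K (ℤ → K)} {n D : ℤ} (hnD : n < D)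
    (hE : tail K D ≤ E) {κ : Set ℤ} (hκ : ∀ c, n < c → c < D → c ∉ κ → ∃ u ∈ E, Leads u c)
    {v : ℤ → K} (hv : v ∈ E) :
    ∃ w ∈ E, (∀ c ≤ n, w c = v c) ∧ (∀ c, n < c → c ∉ κ → w c = 0) ∧ ∀ c, D ≤ c → w c = 0 := by
  have key : ∀ e : ℕ, n + 1 + e ≤ D → ∃ w ∈ E, (∀ c ≤ n, w c = v c) ∧
      ∀ c, n < c → c < n + 1 + e → c ∉ κ → w c = 0 := by
    intro e
    induction e with
    | zero => exact fun _ => ⟨v, hv, fun _ _ => rfl, fun c h1 h2 => by omega⟩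
    | succ e ih =>
      intro he
      push_cast at he ⊢
      obtain ⟨w, hw, h1, h2⟩ := ih (by omega)
      by_cases hc : n + 1 + e ∈ κ
      · refine ⟨w, hw, h1, fun c h3 h4 h5 => h2 c h3 ?_ h5⟩
        by_contra h6
        have : c = n + 1 + e := by omega
        exact h5 (this ▸ hc)
      · obtain ⟨u, hu, hu'⟩ := hκ (n + 1 + e) (by omega) (by omega) hc
        refine ⟨w - (w (n + 1 + e) / u (n + 1 + e)) • u, E.sub_mem hw (E.smul_mem _ hu),
          fun c h3 => ?_, fun c h3 h4 h5 => ?_⟩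
        · simp [hu'.2 c (by omega), h1 c h3]
        · rcases eq_or_ne c (n + 1 + e) with rfl | h6
          · simp [hu'.1]
          · simp [hu'.2 c (by omega), h2 c h3 (by omega) h5]
  obtain ⟨w, hw, h1, h2⟩ := key (D - (n + 1)).toNat (by omega)
  refine ⟨fun c => if c < D then w c else 0, ?_, fun c hc => ?_, fun c h3 h4 => ?_, fun c hc => ?_⟩
  · have h3 : w - (fun c => if c < D then w c else 0) ∈ tail K D := fun c hc => by simp [hc]
    have := E.sub_mem hw (hE h3)
    rwa [sub_sub_cancel] at this
  · simp only [if_pos (show c < D by omega), h1 c hc]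
  · beta_reduce
    split_ifs with h5
    · exact h2 c h3 (by omega) h4
    · rfl
  · simp only [if_neg (show ¬ c < D by omega)]

variable {K : Type u} [Field K] {m h : ℕ} [NeZero h] {A : Set ℤ} {f : ℤ → ℕ} {lo y : ℤ} {q : ℕ}
  {σ : K →+* K} {R : Type u} [CommRing R] [Algebra K R] {Λ : Gr h R} {Y : Type*}
  {ev : Y → R →ₐ[K] K} {t₀ : Y}

/-- A coefficient of the elements `v(a)` that cannot be changed by elements of the same level is
determined by linear equations for its `q`-th power. -/
theorem IsFrame.coef_mem_of_level_lt (F : IsFrame m h A f lo y) (hq : q ≠ 0)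
    (hσ : ∀ z, σ z = z ^ q) (hσ' : Function.Surjective σ)
    (hY : ∀ t, HasInvariants m h σ A f (funSpace (Λ.map (ev t : R →+* K)).1))
    {a : ℤ} (ha : a ∈ A) {d : ℕ} (hd : a + d ∈ A → f (a + d) < f a)
    (hlt : ∀ d' < d, (fun t => coef q m h A lo y
      (recovered q m h A f lo y σ (funSpace (Λ.map (ev t : R →+* K)).1)) d' a) ∈
        radicialAlgebra hσ ev t₀) :
    (fun t => coef q m h A lo y
      (recovered q m h A f lo y σ (funSpace (Λ.map (ev t : R →+* K)).1)) d a) ∈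
        radicialAlgebra hσ ev t₀ := by
  classical
  let L : Y → Submodule K (ℤ → K) := fun t => funSpace (Λ.map (ev t : R →+* K)).1
  have hL : ∀ t, IsFunLattice h (L t) := fun t => (Λ.map (ev t : R →+* K)).2.isFunLattice
  let X : Y → ℤ → ℤ → K := fun t => recovered q m h A f lo y σ (L t)
  let E : Y → Submodule K (ℤ → K) := fun t => levelSubspace m h σ (L t) (f a)
  obtain ⟨D, hD, haD⟩ : ∃ D, (∀ t, tail K D ≤ E t) ∧ a + d < D :=
    ⟨max (y + f a * h) (a + d + 1), fun t =>
      tail_le_levelSubspace ((hY t).tail_le F (hL t)) (le_max_left _ _), by omega⟩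
  let κ : Finset ℤ := (Finset.Ico (a + d) D).filter fun c => c ∈ A → f c < f a
  have hκ : ∀ c, c ∈ κ ↔ (a + d ≤ c ∧ c < D) ∧ (c ∈ A → f c < f a) := by
    intro c
    simp only [κ, Finset.mem_filter, Finset.mem_Ico]
  have hw : ∀ t, ∃ w ∈ E t, (∀ c ≤ a + d, w c = vec q m h A lo y (X t) a c) ∧
      (∀ c, a + d < c → c ∉ κ → w c = 0) ∧ ∀ c, D ≤ c → w c = 0 := by
    intro t
    refine exists_eliminated haD (hD t) (κ := κ) (fun c h1 h2 h3 => ?_)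
      ((hY t).vec_recovered_mem_level F (hL t) hq hσ ha)
    have h4 : c ∈ A ∧ f a ≤ f c := by
      by_contra h5
      refine h3 (SetLike.mem_coe.2 ((hκ c).2 ⟨⟨h1.le, h2⟩, fun h6 => ?_⟩))
      by_contra h7
      exact h5 ⟨h6, not_lt.1 h7⟩
    exact ((hY t).level_iff c h4.1 (f a)).2 h4.2
  choose w hwE hw1 hw2 hw3 using hw
  obtain ⟨ι, _, τ, hτ⟩ := exists_level_equations hσ Λ m (f a) a D
  have hsub : κ ⊆ Finset.Ico a D := fun c hc => by
    have := ((hκ c).1 hc).1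
    simp only [Finset.mem_Ico]
    omega
  have hwin : ∀ t, w t ∈ window K a D := by
    intro t c hc
    rw [Finset.mem_Ico, not_and_or, not_le, not_lt] at hc
    rcases hc with hc | hc
    · rw [hw1 t c (by omega), vec_of_lt _ _ hc]
    · exact hw3 t c hc
  have hmain := mem_radicialAlgebra_of_linear (hσ := hσ) (ev := ev) (t₀ := t₀)
    (κ := κ) (fun i s => τ i s)
    (b := fun i t => -∑ s ∈ Finset.Ico a (a + d), ev t (τ i s) * σ (vec q m h A lo y (X t) a s))
    (fun i => ?_) (c := fun s t => σ (w t s)) (fun t i => ?_) (fun c hc => ?_)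
    ⟨a + d, (hκ _).2 ⟨⟨le_rfl, haD⟩, hd⟩⟩
  · refine mem_radicialAlgebra_of_frobenius ?_
    convert hmain using 3 with t
    rw [hw1 t _ le_rfl, vec_add]
  · have h1 : (fun t => -∑ s ∈ Finset.Ico a (a + d), ev t (τ i s) *
        σ (vec q m h A lo y (X t) a s)) = -∑ s ∈ Finset.Ico a (a + d), (fun t => ev t (τ i s)) *
        fun t => σ (vec q m h A lo y (X t) a s) := by
      funext t
      simp
    rw [h1]
    refine neg_mem (sum_mem fun s hs => mul_mem (eval_mem_radicialAlgebra _)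
      (frobenius_mem_radicialAlgebra ?_))
    obtain ⟨d', rfl⟩ := Int.le.dest (Finset.mem_Ico.1 hs).1
    have h2 : d' < d := by have := (Finset.mem_Ico.1 hs).2; omega
    simp only [vec_add]
    exact hlt d' h2
  · have h1 := (hτ (ev t) (w t) (hwin t)).1 (hwE t) i
    rw [← Finset.Ico_union_Ico_eq_Ico (show a ≤ a + d by omega) haD.le,
      Finset.sum_union (Finset.Ico_disjoint_Ico_consecutive _ _ _)] at h1
    have h2 : ∑ s ∈ Finset.Ico a (a + d), ev t (τ i s) * σ (w t s) =
        ∑ s ∈ Finset.Ico a (a + d), ev t (τ i s) * σ (vec q m h A lo y (X t) a s) :=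
      Finset.sum_congr rfl fun s hs => by rw [hw1 t s (Finset.mem_Ico.1 hs).2.le]
    have h3 : ∑ s ∈ Finset.Ico (a + d) D, ev t (τ i s) * σ (w t s) =
        ∑ s ∈ κ, ev t (τ i s) * σ (w t s) := by
      refine (Finset.sum_subset (Finset.filter_subset _ _) fun s hs hs' => ?_).symm
      have h4 := (Finset.mem_Ico.1 hs).1
      rcases h4.eq_or_lt with rfl | h4
      · exact (hs' ((hκ _).2 ⟨⟨le_rfl, haD⟩, hd⟩)).elim
      · rw [hw2 t s h4 hs', map_zero, mul_zero]
    rw [h2, h3] at h1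
    rw [Finset.sum_coe_sort κ fun s => ev t (τ i s) * σ (w t s)]
    linear_combination h1
  · choose c' hc' using fun s => hσ' (c s)
    let v : ℤ → K := fun s => if hs : s ∈ κ then c' ⟨s, hs⟩ else 0
    have hv : ∀ s, s ∉ κ → v s = 0 := fun s hs => dif_neg hs
    have hvc : ∀ s : κ, σ (v s) = c s := fun s => by simp only [v, s.2, dite_true, hc']
    have hvE : v ∈ E t₀ := by
      refine (hτ (ev t₀) v fun s hs => hv s fun h => hs (hsub h)).2 fun i => ?_
      rw [← Finset.sum_subset hsub fun s _ hs => by rw [hv s hs, map_zero, mul_zero],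
        ← Finset.sum_coe_sort κ]
      simp only [hvc]
      exact hc i
    have hv0 : v = 0 := by
      by_contra hne
      obtain ⟨s, hs⟩ := exists_leads (D := a + d) (fun n hn => hv n fun h => by
        have := ((hκ n).1 h).1
        omega) hne
      have hsκ : s ∈ κ := by
        by_contra h
        exact hs.1 (hv s h)
      have hsA := ((hY t₀).leads_iff s).1 ⟨v, hvE.1, hs⟩
      have h1 := ((hY t₀).level_iff s hsA (f a)).1 ⟨v, hvE, hs⟩
      exact absurd (((hκ s).1 hsκ).2 hsA) (not_lt.2 h1)
    funext s
    rw [← hvc, hv0]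
    simp

/-- The coefficients of the elements `v(a)`, and the parameters, belong to the algebra. -/
theorem IsFrame.coef_mem_and_recovered_mem (F : IsFrame m h A f lo y) (hq : q ≠ 0)
    (hσ : ∀ z, σ z = z ^ q) (hσ' : Function.Surjective σ)
    (hY : ∀ t, HasInvariants m h σ A f (funSpace (Λ.map (ev t : R →+* K)).1)) (d : ℕ) (n : ℕ)
    {a : ℤ} (ha : a ∈ A) (hn : rank m h lo y a = n) :
    (fun t => coef q m h A lo y
      (recovered q m h A f lo y σ (funSpace (Λ.map (ev t : R →+* K)).1)) d a) ∈
        radicialAlgebra hσ ev t₀ ∧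
    (fun t => recovered q m h A f lo y σ (funSpace (Λ.map (ev t : R →+* K)).1) a (a + d)) ∈
        radicialAlgebra hσ ev t₀ := by
  induction d using Nat.strong_induction_on generalizing n a with
  | _ d ihd =>
  induction n using Nat.strong_induction_on generalizing a with
  | _ n ihn =>
  set 𝓡 := radicialAlgebra hσ ev t₀ with h𝓡
  let X : Y → ℤ → ℤ → K := fun t =>
    recovered q m h A f lo y σ (funSpace (Λ.map (ev t : R →+* K)).1)
  change (fun t => coef q m h A lo y (X t) d a) ∈ 𝓡 ∧ (fun t => X t a (a + d)) ∈ 𝓡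
  have hX : ∀ t a b, ¬ IsPair h A f a b → X t a b = 0 := fun t => recovered_of_not_isPair
  -- the first summand in the recursion
  obtain ⟨B, hB, hBX⟩ : ∃ B ∈ 𝓡, ∀ t, coef q m h A lo y (X t) d a = B t +
      ∑ b ∈ Finset.Ioc a (a + d), X t a b * coef q m h A lo y (X t) (a + d - b).toNat b := by
    by_cases c1 : a - h ∈ A
    · exact ⟨_, (ihn _ (hn ▸ F.rank_sub c1) c1 rfl).1, fun t => (F.coef_eq ha d).1 c1⟩
    by_cases c2 : a = y
    · refine ⟨algebraMap K (Y → K) (if d = 0 then 1 else 0), 𝓡.algebraMap_mem _, fun t => ?_⟩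
      exact (F.coef_eq ha d).2.1 c2
    · have hsA := F.mem_of_le _ (F.sourceOf_mem (m := m) a).1
      exact ⟨_, pow_mem (ihn _ (hn ▸ F.rank_sourceOf ha c1 c2) hsA rfl).1 q,
        fun t => (F.coef_eq ha d).2.2 c1 c2⟩
  -- the other summands
  obtain ⟨C, hC, hCX⟩ : ∃ C ∈ 𝓡, ∀ t,
      ∑ b ∈ Finset.Ioc a (a + d), X t a b * coef q m h A lo y (X t) (a + d - b).toNat b =
        C t + X t a (a + d) := by
    rcases Nat.eq_zero_or_pos d with rfl | hd
    · refine ⟨0, zero_mem _, fun t => ?_⟩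
      rw [hX t a _ fun h => by have := h.2.2.1; simp at this]
      simp
    · refine ⟨∑ b ∈ Finset.Ioo a (a + d), (fun t => X t a b) *
        fun t => coef q m h A lo y (X t) (a + d - b).toNat b, sum_mem fun b hb => ?_, fun t => ?_⟩
      · obtain ⟨hb1, hb2⟩ := Finset.mem_Ioo.1 hb
        by_cases hbA : b ∈ A
        · obtain ⟨e, rfl⟩ := Int.le.dest hb1.le
          exact mul_mem (ihd e (by omega) _ ha rfl).2 (ihd _ (by omega) _ hbA rfl).1
        · have : (fun t => X t a b) = 0 := funext fun t => hX t a b fun h => hbA h.2.1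
          rw [this, zero_mul]
          exact zero_mem _
      · rw [← Finset.Ioo_insert_right (show a < a + d by omega), Finset.sum_insert (by simp),
          add_comm, Finset.sum_apply]
        congr 1
        by_cases hbA : a + (d : ℤ) ∈ A
        · rw [sub_self, Int.toNat_zero, F.coef_zero hbA, mul_one]
        · rw [hX t a _ fun h => hbA h.2.1, zero_mul]
  by_cases hlt : a + d ∈ A → f (a + d) < f a
  · have h1 := F.coef_mem_of_level_lt (t₀ := t₀) hq hσ hσ' hY ha hlt
      fun d' hd' => (ihd d' hd' _ ha rfl).1
    refine ⟨h1, ?_⟩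
    have h2 : (fun t => X t a (a + d)) = (fun t => coef q m h A lo y (X t) d a) - B - C := by
      funext t
      simp only [Pi.sub_apply, hBX t, hCX t]
      ring
    rw [h2]
    exact sub_mem (sub_mem h1 hB) hC
  · push Not at hlt
    have h0 : ∀ t, X t a (a + d) = 0 := fun t => hX t a _ fun h => (h.2.2.2.1.trans_le hlt.2).false
    refine ⟨?_, ?_⟩
    · have h2 : (fun t => coef q m h A lo y (X t) d a) = B + C := by
        funext t
        rw [hBX t, hCX t, h0, add_zero, Pi.add_apply]
      rw [h2]
      exact 𝓡.add_mem hB hC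
    · simp only [h0]
      exact zero_mem _

theorem IsFrame.recovered_mem (F : IsFrame m h A f lo y) (hq : q ≠ 0)
    (hσ : ∀ z, σ z = z ^ q) (hσ' : Function.Surjective σ)
    (hY : ∀ t, HasInvariants m h σ A f (funSpace (Λ.map (ev t : R →+* K)).1)) (a b : ℤ) :
    (fun t => recovered q m h A f lo y σ (funSpace (Λ.map (ev t : R →+* K)).1) a b) ∈
        radicialAlgebra hσ ev t₀ := by
  by_cases hp : IsPair h A f a b
  · obtain ⟨d, rfl⟩ := Int.le.dest hp.2.2.1.le
    exact (F.coef_mem_and_recovered_mem hq hσ hσ' hY d _ hp.1 rfl).2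
  · simp only [recovered_of_not_isPair _ _ hp]
    exact zero_mem _

end Parameters

/-! ### The parametrization of the stratum -/

section Parametrization

variable {K : Type u} [Field K] {m h : ℕ} {A : Set ℤ} {f : ℤ → ℕ} {lo y : ℤ} {q : ℕ} {σ : K →+* K}
  {ι : Type u} {e : ι → ℤ × ℤ}

open Classical in
/-- The parameters over the polynomial ring whose variables correspond via `e` to the pairs of
indices of the parameters. -/
noncomputable def universalParameter (K : Type u) [Field K] {ι : Type u} (e : ι → ℤ × ℤ) (a b : ℤ) :
    MvPolynomial ι K :=
  if h : ∃ i, e i = (a, b) then MvPolynomial.X h.choose else 0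

theorem universalParameter_apply (he : Function.Injective e) (i : ι) :
    universalParameter K e (e i).1 (e i).2 = MvPolynomial.X i := by
  have h1 : ∃ j, e j = ((e i).1, (e i).2) := ⟨i, rfl⟩
  rw [universalParameter, dif_pos h1]
  exact congrArg _ (he h1.choose_spec)

theorem universalParameter_of_not_isPair (he' : ∀ a b, IsPair h A f a b ↔ (a, b) ∈ Set.range e)
    (a b : ℤ) (hp : ¬ IsPair h A f a b) : universalParameter K e a b = 0 :=
  dif_neg fun h => hp ((he' a b).2 h)

/-- The set of the points of the affine space with generic coordinates. -/
def genericPoints (K : Type u) [Field K] (F : IsFrame m h A f lo y) (e : ι → ℤ × ℤ) :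
    Set (MvPolynomial ι K →ₐ[K] K) :=
  {χ | F.IsGeneric fun a b => χ (universalParameter K e a b)}

/-- The point of the affine space whose coordinates are the parameters of a lattice. -/
noncomputable def parameterPoint (q m h : ℕ) (A : Set ℤ) (f : ℤ → ℕ) (lo y : ℤ) (σ : K →+* K)
    (e : ι → ℤ × ℤ) (L : Submodule K (ℤ → K)) : MvPolynomial ι K →ₐ[K] K :=
  MvPolynomial.aeval fun i => recovered q m h A f lo y σ L (e i).1 (e i).2

theorem parameterPoint_universalParameter (he' : ∀ a b, IsPair h A f a b ↔ (a, b) ∈ Set.range e)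
    (he : Function.Injective e) (L : Submodule K (ℤ → K)) (a b : ℤ) :
    parameterPoint q m h A f lo y σ e L (universalParameter K e a b) =
      recovered q m h A f lo y σ L a b := by
  by_cases hp : IsPair h A f a b
  · obtain ⟨i, hi⟩ := (he' a b).1 hp
    have h1 := universalParameter_apply (K := K) he i
    rw [hi] at h1
    rw [h1, parameterPoint, MvPolynomial.aeval_X, hi]
  · rw [universalParameter_of_not_isPair he' a b hp, map_zero, recovered_of_not_isPair a b hp]

/-- The subset of the affine Grassmannian with given invariants. -/
def invariantStratum (m h : ℕ) [NeZero h] (σ : K →+* K) (A : Set ℤ) (f : ℤ → ℕ) : Set (Gr h K) :=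
  {M | HasInvariants m h σ A f (funSpace M.1)}

variable [NeZero h] {F : IsFrame m h A f lo y} {Λ : Gr h (MvPolynomial ι K)}

/-- If `Λ` is the lattice with universal parameters, then exactly the generic points of the affine
space define lattices in the stratum. -/
theorem map_mem_invariantStratum_iff
    (he' : ∀ a b, IsPair h A f a b ↔ (a, b) ∈ Set.range e)
    (hΛ : ∀ χ : MvPolynomial ι K →+* K, funSpace (Λ.map χ).1 =
      family q m h A f lo y (fun a b => χ (universalParameter K e a b)) 0)
    (hq : q ≠ 0) (hσ : ∀ z, σ z = z ^ q) (χ : MvPolynomial ι K →ₐ[K] K) :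
    Λ.map (χ : MvPolynomial ι K →+* K) ∈ invariantStratum m h σ A f ↔ χ ∈ genericPoints K F e := by
  have hx : ∀ a b, ¬ IsPair h A f a b → χ (universalParameter K e a b) = 0 := fun a b hp => by
    rw [universalParameter_of_not_isPair he' a b hp, map_zero]
  refine Iff.trans ?_ (F.hasInvariants_family_iff hq hσ hx)
  refine iff_of_eq (congrArg (HasInvariants m h σ A f) ?_)
  exact hΛ χ

theorem map_injOn_genericPoints
    (he' : ∀ a b, IsPair h A f a b ↔ (a, b) ∈ Set.range e)
    (hΛ : ∀ χ : MvPolynomial ι K →+* K, funSpace (Λ.map χ).1 =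
      family q m h A f lo y (fun a b => χ (universalParameter K e a b)) 0)
    (he : Function.Injective e) (hq : q ≠ 0) (hσ : ∀ z, σ z = z ^ q)
    {χ χ' : MvPolynomial ι K →ₐ[K] K} (hχ : χ ∈ genericPoints K F e)
    (h1 : Λ.map (χ : MvPolynomial ι K →+* K) = Λ.map (χ' : MvPolynomial ι K →+* K)) : χ = χ' := by
  have hx : ∀ χ : MvPolynomial ι K →ₐ[K] K, ∀ a b, ¬ IsPair h A f a b →
      χ (universalParameter K e a b) = 0 := fun χ a b hp => by
    rw [universalParameter_of_not_isPair he' a b hp, map_zero]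
  have h2 := congrArg (fun M : Gr h K => funSpace M.1) h1
  simp only [hΛ] at h2
  have h3 := F.eq_of_family_eq hq hσ (hx χ) (hx χ') hχ h2
  refine MvPolynomial.algHom_ext fun i => ?_
  have h4 := congrFun (congrFun h3 (e i).1) (e i).2
  simpa only [universalParameter_apply he] using h4

theorem map_parameterPoint
    (he' : ∀ a b, IsPair h A f a b ↔ (a, b) ∈ Set.range e)
    (hΛ : ∀ χ : MvPolynomial ι K →+* K, funSpace (Λ.map χ).1 =
      family q m h A f lo y (fun a b => χ (universalParameter K e a b)) 0)
    (F : IsFrame m h A f lo y) (he : Function.Injective e) (hq : q ≠ 0)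
    (hσ : ∀ z, σ z = z ^ q) {M : Gr h K} (hM : M ∈ invariantStratum m h σ A f) :
    Λ.map (parameterPoint q m h A f lo y σ e (funSpace M.1) : MvPolynomial ι K →+* K) = M := by
  apply Subtype.ext
  apply funSpace_injective
  rw [hΛ]
  have h1 : (fun a b => (parameterPoint q m h A f lo y σ e (funSpace M.1) :
      MvPolynomial ι K →+* K) (universalParameter K e a b)) =
      recovered q m h A f lo y σ (funSpace M.1) := by
    funext a b
    exact parameterPoint_universalParameter he' he _ a b
  rw [h1]
  exact (HasInvariants.eq_family hM F M.2.isFunLattice hq hσ).symm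

/-- The parametrization is a homeomorphism. It is open since the parameters of a lattice are, up to
powers of the Frobenius, algebraic functions of the lattice, and the Frobenius does not change the
Zariski topology. -/
theorem isHomeomorph_parametrization
    (he' : ∀ a b, IsPair h A f a b ↔ (a, b) ∈ Set.range e)
    (hΛ : ∀ χ : MvPolynomial ι K →+* K, funSpace (Λ.map χ).1 =
      family q m h A f lo y (fun a b => χ (universalParameter K e a b)) 0)
    [Finite ι] (he : Function.Injective e) (hq : q ≠ 0)
    (hσ : ∀ z, σ z = z ^ q) (hσ' : Function.Surjective σ)
    (Φ : genericPoints K F e → invariantStratum (K := K) m h σ A f)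
    (hΦ : ∀ χ, (Φ χ : Gr h K) = Λ.map (χ.1 : MvPolynomial ι K →+* K)) :
    letI := zariskiPoints K (MvPolynomial ι K)
    IsHomeomorph Φ := by
  let := zariskiPoints K (MvPolynomial ι K)
  have hinj : Function.Injective Φ := by
    intro χ χ' h1
    refine Subtype.ext (map_injOn_genericPoints he' hΛ he hq hσ χ.2 ?_)
    rw [← hΦ, ← hΦ, h1]
  have hpt : ∀ M : invariantStratum (K := K) m h σ A f,
      ∃ hM : parameterPoint q m h A f lo y σ e (funSpace M.1.1) ∈ genericPoints K F e,
        Φ ⟨_, hM⟩ = M := by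
    intro M
    have h1 := map_parameterPoint he' hΛ F he hq hσ M.2
    have h2 := (map_mem_invariantStratum_iff (F := F) he' hΛ hq hσ _).1 (h1.symm ▸ M.2)
    exact ⟨h2, Subtype.ext ((hΦ _).trans h1)⟩
  refine ⟨?_, ?_, hinj, fun M => ⟨_, (hpt M).2⟩⟩
  · refine continuous_induced_rng.2 ?_
    have h1 : Subtype.val ∘ Φ =
        (fun χ : MvPolynomial ι K →ₐ[K] K => Λ.map (χ : MvPolynomial ι K →+* K)) ∘ Subtype.val :=
      funext hΦ
    rw [h1]
    exact (Gr.continuous_map Λ).comp continuous_subtype_val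
  · intro W hW
    obtain ⟨W', hW', rfl⟩ := hW
    refine Gr.isOpen_preimage_val (F.isLocallyClosed hσ hσ') fun R _ _ _ Λ' y₀ hy₀ hmem => ?_
    obtain ⟨χ, hχ, hχM⟩ := hmem
    obtain ⟨p, hp, hp'⟩ := isOpen_zariskiPoints_iff.1 hW' χ hχ
    let Y := {y : R →ₐ[K] K // Λ'.map (y : R →+* K) ∈ invariantStratum m h σ A f}
    let t₀ : Y := ⟨y₀, hy₀⟩
    let ev : Y → R →ₐ[K] K := Subtype.val
    let g : Y → K := fun t => parameterPoint q m h A f lo y σ e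
      (funSpace (Λ'.map (ev t : R →+* K)).1) p
    have hg : g ∈ radicialAlgebra hσ ev t₀ := by
      let G : ι → radicialAlgebra hσ ev t₀ := fun i =>
        ⟨_, F.recovered_mem (Λ := Λ') hq hσ hσ' Subtype.property (e i).1 (e i).2⟩
      have h1 : g = (MvPolynomial.aeval G p : Y → K) := by
        funext t
        have h2 : ((Pi.evalAlgHom K (fun _ : Y => K) t).comp
            (radicialAlgebra hσ ev t₀).val).comp (MvPolynomial.aeval G) =
            parameterPoint q m h A f lo y σ e (funSpace (Λ'.map (ev t : R →+* K)).1) := by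
          refine MvPolynomial.algHom_ext fun i => ?_
          simp only [AlgHom.comp_apply, parameterPoint, MvPolynomial.aeval_X]
          rfl
        exact (DFunLike.congr_fun h2 p).symm
      rw [h1]
      exact SetLike.coe_mem _
    have hχ₀ : ∀ t : Y, ∀ χ : genericPoints K F e, Φ χ = ⟨_, t.2⟩ → χ.1 p = g t := by
      intro t χ h1
      obtain ⟨h2, h3⟩ := hpt ⟨_, t.2⟩
      rw [hinj (h1.trans h3.symm)]
    obtain ⟨r, hr, hr'⟩ := exists_ne_zero_of_mem_radicialAlgebra hg (by
      rw [← hχ₀ t₀ χ hχM]; exact hp)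
    refine ⟨r, hr, fun y' hy' hr₁ => ?_⟩
    obtain ⟨h3, h4⟩ := hpt ⟨_, hy'⟩
    exact ⟨_, hp' _ (hr' ⟨y', hy'⟩ hr₁), h4⟩

end Parametrization

/-! ### The dimension of an open subset of affine space -/

section Dimension

variable {K : Type u} [Field K]

/-- The point of `Spec R` that underlies a `K`-valued point. -/
def toPrimeSpectrum {R : Type u} [CommRing R] [Algebra K R] (y : R →ₐ[K] K) : PrimeSpectrum R :=
  ⟨RingHom.ker (y : R →+* K), RingHom.ker_isPrime _⟩

theorem isInducing_toPrimeSpectrum {R : Type u} [CommRing R] [Algebra K R] :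
    letI := zariskiPoints K R
    Topology.IsInducing (toPrimeSpectrum (K := K) (R := R)) := by
  let := zariskiPoints K R
  refine ⟨?_⟩
  rw [PrimeSpectrum.isTopologicalBasis_basic_opens.eq_generateFrom, induced_generateFrom_eq,
    ← Set.range_comp]
  rfl

/-- The substitution that fixes the variables in `s` and replaces the others by the coordinates of
the point `χ`, i.e. the restriction of polynomials to the linear subspace of the points that have
the same coordinates as `χ` outside `s`. -/
noncomputable def substitution {ι : Type u} (χ : MvPolynomial ι K →ₐ[K] K) (s : Set ι)
    [DecidablePred (· ∈ s)] : MvPolynomial ι K →ₐ[K] MvPolynomial ι K :=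
  MvPolynomial.aeval fun i =>
    if i ∈ s then MvPolynomial.X i else MvPolynomial.C (χ (MvPolynomial.X i))

variable {ι : Type u} (χ : MvPolynomial ι K →ₐ[K] K) (s : Set ι) [DecidablePred (· ∈ s)]

theorem comp_substitution {χ' : MvPolynomial ι K →ₐ[K] K}
    (h : ∀ i ∉ s, χ' (MvPolynomial.X i) = χ (MvPolynomial.X i)) :
    χ'.comp (substitution χ s) = χ' := by
  refine MvPolynomial.algHom_ext fun i => ?_
  rw [AlgHom.comp_apply, substitution, MvPolynomial.aeval_X]
  split_ifs with hi
  · rfl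
  · rw [h i hi, ← MvPolynomial.algebraMap_eq, AlgHom.commutes]
    rfl

theorem comp_substitution_X (χ' : MvPolynomial ι K →ₐ[K] K) {i : ι} (hi : i ∉ s) :
    χ'.comp (substitution χ s) (MvPolynomial.X i) = χ (MvPolynomial.X i) := by
  rw [AlgHom.comp_apply, substitution, MvPolynomial.aeval_X, if_neg hi,
    ← MvPolynomial.algebraMap_eq, AlgHom.commutes]
  rfl

theorem exists_algHom_ne_zero [Infinite K] {p : MvPolynomial ι K} (hp : p ≠ 0) :
    ∃ χ : MvPolynomial ι K →ₐ[K] K, χ p ≠ 0 := by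
  by_contra hno
  push Not at hno
  exact hp (MvPolynomial.funext fun x => by
    rw [map_zero, ← MvPolynomial.coe_aeval_eq_eval]
    exact hno (MvPolynomial.aeval x))

/-- A polynomial that does not vanish under the substitution is nonzero at some point with the same
coordinates as `χ` outside `s`. -/
theorem exists_mem_linear [Infinite K] {p : MvPolynomial ι K} (hp : substitution χ s p ≠ 0) :
    ∃ χ' : MvPolynomial ι K →ₐ[K] K, χ' p ≠ 0 ∧
      ∀ i ∉ s, χ' (MvPolynomial.X i) = χ (MvPolynomial.X i) := by
  obtain ⟨χ', hχ'⟩ := exists_algHom_ne_zero hp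
  exact ⟨χ'.comp (substitution χ s), hχ', fun i hi => comp_substitution_X χ s χ' hi⟩

/-- The dimension of the space of `K`-valued points of a nonempty open subscheme of affine space. It
is bounded from above by the dimension of the polynomial ring, and from below by the length of a
chain of linear subspaces through a point `χ` of `U`, in which the coordinates are released one
after the other. -/
theorem topologicalKrullDim_open [Infinite K] [Finite ι] {U : Set (MvPolynomial ι K →ₐ[K] K)}
    (hU : @IsOpen _ (zariskiPoints K _) U) (hne : U.Nonempty) :
    letI := zariskiPoints K (MvPolynomial ι K)
    topologicalKrullDim U = (Nat.card ι : WithBot ℕ∞) := by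
  classical
  let := zariskiPoints K (MvPolynomial ι K)
  refine le_antisymm ?_ ?_
  · refine (isInducing_toPrimeSpectrum.comp
      Topology.IsInducing.subtypeVal).topologicalKrullDim_le.trans ?_
    rw [PrimeSpectrum.topologicalKrullDim_eq_ringKrullDim,
      MvPolynomial.ringKrullDim_of_isNoetherianRing, ringKrullDim_eq_zero_of_field, zero_add]
  · obtain ⟨χ, hχ⟩ := hne
    obtain ⟨u, hu, hu'⟩ := isOpen_zariskiPoints_iff.1 hU χ hχ
    have hsubst : ∀ s : Set ι, ∀ χ' : MvPolynomial ι K →ₐ[K] K, ∀ p, χ' p ≠ 0 →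
      (∀ i ∉ s, χ' (MvPolynomial.X i) = χ (MvPolynomial.X i)) → substitution χ s p ≠ 0 := by
      intro s χ' p hp h h0
      have := DFunLike.congr_fun (comp_substitution χ s h) p
      rw [AlgHom.comp_apply, h0, map_zero] at this
      exact hp this.symm
    let Z : Set ι → Set U := fun s =>
      {χ' | ∀ i ∉ s, χ'.1 (MvPolynomial.X i) = χ (MvPolynomial.X i)}
    have hclosed : ∀ s, IsClosed (Z s) := by
      intro s
      have h1 : Z s = ⋂ i : (sᶜ : Set ι), Subtype.val ⁻¹'
          {χ' : MvPolynomial ι K →ₐ[K] K | χ' (MvPolynomial.X (i : ι) -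
            algebraMap K _ (χ (MvPolynomial.X (i : ι)))) ≠ 0}ᶜ := by
        ext χ'
        simp [Z, sub_eq_zero]
      rw [h1]
      exact isClosed_iInter fun i =>
        (isOpen_ne_zero _).isClosed_compl.preimage continuous_subtype_val
    have hirr : ∀ s, IsIrreducible (Z s) := by
      intro s
      refine ⟨⟨⟨χ, hχ⟩, fun _ _ => rfl⟩, ?_⟩
      rintro _ _ ⟨V₁, hV₁, rfl⟩ ⟨V₂, hV₂, rfl⟩ ⟨χ₁, h₁, h₁'⟩ ⟨χ₂, h₂, h₂'⟩
      obtain ⟨p₁, hp₁, hp₁'⟩ := isOpen_zariskiPoints_iff.1 hV₁ χ₁.1 h₁'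
      obtain ⟨p₂, hp₂, hp₂'⟩ := isOpen_zariskiPoints_iff.1 hV₂ χ₂.1 h₂'
      obtain ⟨χ', h3, h4⟩ := exists_mem_linear χ s (p := u * (p₁ * p₂)) (by
        rw [map_mul, map_mul]
        exact mul_ne_zero (hsubst s χ u hu fun _ _ => rfl)
          (mul_ne_zero (hsubst s χ₁ p₁ hp₁ h₁) (hsubst s χ₂ p₂ hp₂ h₂)))
      rw [map_mul, map_mul] at h3
      exact ⟨⟨χ', hu' χ' (left_ne_zero_of_mul h3)⟩, h4,
        hp₁' χ' (left_ne_zero_of_mul (right_ne_zero_of_mul h3)),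
        hp₂' χ' (right_ne_zero_of_mul (right_ne_zero_of_mul h3))⟩
    have hmono : ∀ s s' : Set ι, s ⊂ s' → Z s ⊂ Z s' := by
      intro s s' hs
      obtain ⟨i, hi', hi⟩ := Set.exists_of_ssubset hs
      refine ⟨fun χ' h j hj => h j fun h' => hj (hs.1 h'), fun hle => ?_⟩
      -- a point with a different coordinate at `i`
      let p : MvPolynomial ι K := MvPolynomial.X i - algebraMap K _ (χ (MvPolynomial.X i))
      have hp : substitution χ s' p ≠ 0 := by
        refine hsubst s' (MvPolynomial.aeval fun j =>
          χ (MvPolynomial.X j) + if j = i then 1 else 0) p ?_ fun j hj => ?_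
        · simp [p]
        · have : j ≠ i := fun h => hj (h ▸ hi')
          simp [this]
      obtain ⟨χ', h3, h4⟩ := exists_mem_linear χ s' (p := u * p) (by
        rw [map_mul]
        exact mul_ne_zero (hsubst s' χ u hu fun _ _ => rfl) hp)
      rw [map_mul] at h3
      have h5 := hle (a := ⟨χ', hu' χ' (left_ne_zero_of_mul h3)⟩) h4 i hi
      refine right_ne_zero_of_mul h3 ?_
      simp only [p, map_sub, AlgHom.commutes, Algebra.algebraMap_self, RingHom.id_apply]
      exact sub_eq_zero.2 h5
    let e := Finite.equivFin ι
    let z : LTSeries (TopologicalSpace.IrreducibleCloseds U) :=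
      { length := Nat.card ι
        toFun := fun j => ⟨Z {i | (e i : ℕ) < j}, hirr _, hclosed _⟩
        step := fun j => hmono _ _ ⟨fun i hi => by
          simp only [Set.mem_ofPred_eq, Fin.val_castSucc, Fin.val_succ] at hi ⊢
          omega, fun hle => by
          have h1 := @hle (e.symm j) (by simp)
          simp at h1⟩ }
    exact Order.LTSeries.length_le_krullDim z

end Dimension

/-! ### Points of open subschemes of an affine scheme -/

section Schemes

variable {K : Type u} [Field K] {P : Type u} [CommRing P] [Algebra K P] {T : Scheme.{u}}
  {p : T ⟶ Spec (.of K)} (Ψ : T ≅ Spec (.of P)) (W : (Spec (.of P)).Opens)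

/-- The homomorphism that corresponds to an `R`-valued point of an open subscheme of a scheme
isomorphic to `Spec P`. -/
noncomputable def pointHom (hΨ : Ψ.inv ≫ p = Spec.map (CommRingCat.ofHom (algebraMap K P)))
    {R : Type u} [CommRing R] [Algebra K R]
    (x : Points K ((Ψ.hom ⁻¹ᵁ W).ι ≫ p) R) : P →ₐ[K] R :=
  { (Spec.preimage (x.1 ≫ (Ψ.hom ⁻¹ᵁ W).ι ≫ Ψ.hom)).hom with
    commutes' := by
      have h1 : CommRingCat.ofHom (algebraMap K P) ≫
          Spec.preimage (x.1 ≫ (Ψ.hom ⁻¹ᵁ W).ι ≫ Ψ.hom) = CommRingCat.ofHom (algebraMap K R) := by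
        apply Spec.map_injective
        rw [Spec.map_comp, Spec.map_preimage, ← hΨ]
        refine Eq.trans ?_ x.2
        simp
      exact fun r => congrArg (fun g => g.hom r) h1 }

variable {Ψ W} (hΨ : Ψ.inv ≫ p = Spec.map (CommRingCat.ofHom (algebraMap K P)))

theorem specMap_pointHom {R : Type u} [CommRing R] [Algebra K R]
    (x : Points K ((Ψ.hom ⁻¹ᵁ W).ι ≫ p) R) :
    Spec.map (CommRingCat.ofHom (pointHom Ψ W hΨ x : P →+* R)) =
      x.1 ≫ (Ψ.hom ⁻¹ᵁ W).ι ≫ Ψ.hom :=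
  Spec.map_preimage _

theorem pointHom_map {R R' : Type u} [CommRing R] [Algebra K R] [CommRing R'] [Algebra K R']
    (g : R →ₐ[K] R') (x : Points K ((Ψ.hom ⁻¹ᵁ W).ι ≫ p) R) :
    pointHom Ψ W hΨ (x.map g) = g.comp (pointHom Ψ W hΨ x) := by
  apply AlgHom.coe_ringHom_injective
  have h1 : CommRingCat.ofHom (pointHom Ψ W hΨ (x.map g) : P →+* R') =
      CommRingCat.ofHom (pointHom Ψ W hΨ x : P →+* R) ≫ CommRingCat.ofHom (g : R →+* R') := by
    apply Spec.map_injective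
    rw [Spec.map_comp, specMap_pointHom, specMap_pointHom]
    simp [Points.map]
  exact congrArg CommRingCat.Hom.hom h1

theorem pointHom_injective {R : Type u} [CommRing R] [Algebra K R] :
    Function.Injective (pointHom (R := R) Ψ W hΨ) := by
  intro x x' hx
  apply Subtype.ext
  have h1 := specMap_pointHom hΨ x
  rw [hx, specMap_pointHom hΨ x'] at h1
  rw [← cancel_mono (Ψ.hom ⁻¹ᵁ W).ι, ← cancel_mono Ψ.hom, Category.assoc, Category.assoc]
  exact h1.symm

theorem specMap_apply_bot (χ : P →ₐ[K] K) :
    Spec.map (CommRingCat.ofHom (χ : P →+* K)) (⟨⊥, Ideal.isPrime_bot⟩ : PrimeSpectrum K) =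
      toPrimeSpectrum χ :=
  rfl

theorem toPrimeSpectrum_pointHom_mem (x : Points K ((Ψ.hom ⁻¹ᵁ W).ι ≫ p) K) :
    toPrimeSpectrum (pointHom Ψ W hΨ x) ∈ W := by
  let z : Spec (.of K) := (⟨⊥, Ideal.isPrime_bot⟩ : PrimeSpectrum K)
  have h1 : (x.1 ≫ (Ψ.hom ⁻¹ᵁ W).ι ≫ Ψ.hom) z ∈ W := by
    rw [Scheme.Hom.comp_apply, Scheme.Hom.comp_apply]
    exact (x.1 z).2
  rw [← specMap_pointHom hΨ x] at h1
  exact h1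

theorem exists_pointHom_eq {χ : P →ₐ[K] K} (hχ : toPrimeSpectrum χ ∈ W) :
    ∃ x : Points K ((Ψ.hom ⁻¹ᵁ W).ι ≫ p) K, pointHom Ψ W hΨ x = χ := by
  have hrange : Set.range (Spec.map (CommRingCat.ofHom (χ : P →+* K)) ≫ Ψ.inv) ⊆
      Set.range (Ψ.hom ⁻¹ᵁ W).ι := by
    rintro _ ⟨z, rfl⟩
    rw [Scheme.Opens.range_ι]
    have hz : z = (⟨⊥, Ideal.isPrime_bot⟩ : PrimeSpectrum K) :=
      Subsingleton.elim (α := PrimeSpectrum K) _ _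
    change Ψ.hom ((Spec.map (CommRingCat.ofHom (χ : P →+* K)) ≫ Ψ.inv) z) ∈ W
    rw [← Scheme.Hom.comp_apply, Category.assoc, Ψ.inv_hom_id, Category.comp_id, hz,
      specMap_apply_bot]
    exact hχ
  let x₀ := IsOpenImmersion.lift (Ψ.hom ⁻¹ᵁ W).ι
    (Spec.map (CommRingCat.ofHom (χ : P →+* K)) ≫ Ψ.inv) hrange
  have hx₀ : x₀ ≫ (Ψ.hom ⁻¹ᵁ W).ι = Spec.map (CommRingCat.ofHom (χ : P →+* K)) ≫ Ψ.inv :=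
    IsOpenImmersion.lift_fac _ _ _
  have h1 : x₀ ≫ (Ψ.hom ⁻¹ᵁ W).ι ≫ p = Spec.map (CommRingCat.ofHom (algebraMap K K)) := by
    rw [← Category.assoc, hx₀, Category.assoc, hΨ, ← Spec.map_comp, ← CommRingCat.ofHom_comp,
      χ.comp_algebraMap]
  have h2 : x₀ ≫ (Ψ.hom ⁻¹ᵁ W).ι ≫ Ψ.hom = Spec.map (CommRingCat.ofHom (χ : P →+* K)) := by
    rw [← Category.assoc, hx₀, Category.assoc, Ψ.inv_hom_id, Category.comp_id]
  refine ⟨⟨x₀, h1⟩, AlgHom.coe_ringHom_injective ?_⟩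
  exact congrArg CommRingCat.Hom.hom
    (Spec.map_injective ((specMap_pointHom hΨ ⟨x₀, h1⟩).trans h2))

end Schemes

/-! ### The open subscheme of generic parameters -/

/-- In the cyclic case `φ` increases by exactly one from `a` to `a + h`. -/
theorem IsCyclic.apply_add {m h : ℕ} {A : Set ℤ} {φ : ℤ → WithBot ℕ} (hc : IsCyclic m h A φ)
    (hA : IsSemiModule m h A) (hh : 0 < h) {a : ℤ} (ha : a ∈ A) :
    (φ (a + h)).unbotD 0 = (φ a).unbotD 0 + 1 := by
  have ha' := hA.add_h_mem a ha
  rw [hc a ha, hc _ ha']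
  change maxShift m h A (a + h) = maxShift m h A a + 1
  have h1 := maxShift_spec hA hh ha
  have h2 := maxShift_spec hA hh ha'
  refine le_antisymm ?_ ((h2 _).1 ?_)
  · have h3 := (h2 _).2 le_rfl
    rcases hn : maxShift m h A (a + h) with _ | n
    · omega
    · rw [hn] at h3
      have := (h1 n).1 (by convert h3 using 1; push_cast; ring)
      omega
  · convert (h1 _).2 le_rfl using 1
    push_cast
    ring

/-- The open subset of the spectrum of the polynomial ring whose `K`-valued points are the generic
ones: the union of the basic open subsets whose `K`-valued points are all generic. -/
noncomputable def genericOpens {m h : ℕ} {A : Set ℤ} {f : ℤ → ℕ} {lo y : ℤ} {ι : Type u}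
    (K : Type u) [Field K] (F : IsFrame m h A f lo y) (e : ι → ℤ × ℤ) :
    TopologicalSpace.Opens (PrimeSpectrum (MvPolynomial ι K)) :=
  ⨆ p ∈ {p : MvPolynomial ι K | ∀ χ : MvPolynomial ι K →ₐ[K] K, χ p ≠ 0 → χ ∈ genericPoints K F e},
    PrimeSpectrum.basicOpen p

section Generic

variable {m h : ℕ} {A : Set ℤ} {f : ℤ → ℕ} {lo y : ℤ} {ι : Type u} {K : Type u} [Field K]
  {F : IsFrame m h A f lo y} {e : ι → ℤ × ℤ}

theorem isOpen_genericPoints (he' : ∀ a b, IsPair h A f a b ↔ (a, b) ∈ Set.range e) :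
    @IsOpen _ (zariskiPoints K _) (genericPoints K F e) :=
  isOpen_zariskiPoints_iff.2 fun _ hχ =>
    IsFrame.IsGeneric.exists_ne_zero (universalParameter_of_not_isPair he') hχ

theorem mem_genericOpens_iff {x : PrimeSpectrum (MvPolynomial ι K)} :
    x ∈ genericOpens K F e ↔ ∃ p : MvPolynomial ι K,
      (∀ χ : MvPolynomial ι K →ₐ[K] K, χ p ≠ 0 → χ ∈ genericPoints K F e) ∧ p ∉ x.asIdeal := by
  rw [genericOpens]
  simp only [TopologicalSpace.Opens.mem_iSup, PrimeSpectrum.mem_basicOpen, Set.mem_ofPred_eq,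
    exists_prop]

theorem toPrimeSpectrum_mem_genericOpens_iff
    (he' : ∀ a b, IsPair h A f a b ↔ (a, b) ∈ Set.range e) {χ : MvPolynomial ι K →ₐ[K] K} :
    toPrimeSpectrum χ ∈ genericOpens K F e ↔ χ ∈ genericPoints K F e := by
  refine mem_genericOpens_iff.trans ⟨?_, fun hχ => ?_⟩
  · rintro ⟨p, hp, hp'⟩
    exact hp χ hp'
  · obtain ⟨p, hp, hp'⟩ := isOpen_zariskiPoints_iff.1 (isOpen_genericPoints he') χ hχ
    exact ⟨p, hp', hp⟩

theorem genericOpens_eq_top (h : ∀ χ : MvPolynomial ι K →ₐ[K] K, χ ∈ genericPoints K F e) :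
    genericOpens K F e = ⊤ := by
  refine top_unique fun x _ => mem_genericOpens_iff.2 ⟨1, fun χ _ => h χ, fun h1 => ?_⟩
  exact x.isPrime.ne_top ((Ideal.eq_top_iff_one _).2 h1)

theorem genericPoints_nonempty (he : Function.Injective e)
    (he' : ∀ a b, IsPair h A f a b ↔ (a, b) ∈ Set.range e) {g : ℤ → ℤ} (hg : IsSuccessor h A f g) :
    (genericPoints K F e).Nonempty := by
  obtain ⟨x, hx, hx'⟩ := F.exists_isGeneric hg K
  refine ⟨MvPolynomial.aeval fun i => x (e i).1 (e i).2, ?_⟩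
  have h1 : (fun a b => (MvPolynomial.aeval fun i => x (e i).1 (e i).2 : MvPolynomial ι K →ₐ[K] K)
      (universalParameter K e a b)) = x := by
    funext a b
    by_cases hp : IsPair h A f a b
    · obtain ⟨i, hi⟩ := (he' a b).1 hp
      have h1 := universalParameter_apply (K := K) he i
      rw [hi] at h1
      rw [h1, MvPolynomial.aeval_X, hi]
    · rw [universalParameter_of_not_isPair he' a b hp, map_zero, hx a b hp]
  rw [← h1] at hx'
  exact hx'

end Generic

end SemiModuleStrata

theorem theorem2 {k : Type v} [Field k] [Fintype k] {K : Type u} [Field K] [Algebra k K]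
    [IsAlgClosure k K] (m h : ℕ) (hm : 0 < m) (hh : 0 < h) (hmh : Nat.Coprime m h)
    (μ : Fin h → ℕ) (hμ : Monotone μ) (hμm : ∑ i, μ i = m)
    (A : Set ℤ) (φ : ℤ → WithBot ℕ)
    (hA : SemiModuleStrata.IsExtendedSemiModule m h μ A φ) :
    (∃ (U : (𝔸(ULift.{u} (SemiModuleStrata.pairs h A φ); Spec (.of K))).Opens)
        (f : SemiModuleStrata.MorphismTo K
          (U.ι ≫ (𝔸(ULift.{u} (SemiModuleStrata.pairs h A φ); Spec (.of K)) ↘ Spec (.of K)))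
          (SemiModuleStrata.stratum (h := h) k m A φ)),
      (U : Set 𝔸(ULift.{u} (SemiModuleStrata.pairs h A φ); Spec (.of K))).Nonempty ∧
      Function.Bijective f.onPoints ∧
      (SemiModuleStrata.IsCyclic m h A φ → U = ⊤)) ∧
    IsLocallyClosed (SemiModuleStrata.stratum (K := K) (h := h) k m A φ) ∧
    (SemiModuleStrata.pairs h A φ).Finite ∧
    topologicalKrullDim (SemiModuleStrata.stratum (K := K) (h := h) k m A φ) =
      (((SemiModuleStrata.pairs h A φ).ncard : ℕ∞) : WithBot ℕ∞) := by
  open SemiModuleStrata in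
  have : NeZero h := ⟨hh.ne'⟩
  have : IsAlgClosed K := IsAlgClosure.isAlgClosed k
  have : Infinite K := IsAlgClosed.instInfinite
  obtain ⟨lo, y, F⟩ := hA.exists_frame hh hmh
  obtain ⟨g, hg⟩ := hA.exists_successor
  have hq : Fintype.card k ≠ 0 := Fintype.card_ne_zero
  have hσ : ∀ z, frob k K z = z ^ Fintype.card k := frob_apply k
  have hσ' : Function.Surjective (frob k K) := fun z => by
    obtain ⟨w, hw⟩ := IsAlgClosed.exists_pow_nat_eq z (Nat.pos_of_ne_zero hq)
    exact ⟨w, hw⟩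
  -- both formulations of the invariants describe the same set of lattices
  have hS : stratum (K := K) (h := h) k m A φ =
      invariantStratum m h (frob k K) A fun a => (φ a).unbotD 0 :=
    Set.ext fun M => hA.mem_stratum_iff k m M
  have hfin : (pairs h A φ).Finite := by
    refine F.finite_isPair.subset fun x hx => ?_
    exact (hA.mem_pairs_iff x.1 x.2).1 hx
  have := hfin.to_subtype
  let e : ULift.{u} (pairs h A φ) → ℤ × ℤ := fun i => i.down.1
  have he : Function.Injective e := fun i j hij => ULift.ext _ _ (Subtype.ext hij)
  have he' : ∀ a b, IsPair h A (fun a => (φ a).unbotD 0) a b ↔ (a, b) ∈ Set.range e := by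
    intro a b
    rw [← hA.mem_pairs_iff]
    exact ⟨fun hx => ⟨⟨⟨(a, b), hx⟩⟩, rfl⟩, by rintro ⟨i, hi⟩; rw [← hi]; exact i.down.2⟩
  obtain ⟨Λ, hΛ⟩ := F.exists_universal (q := Fintype.card k)
    (x := universalParameter K e) (universalParameter_of_not_isPair he')
  have hΛ' := hΛ K
  have hmem : ∀ χ : MvPolynomial (ULift.{u} (pairs h A φ)) K →ₐ[K] K,
      Λ.map (χ : MvPolynomial (ULift.{u} (pairs h A φ)) K →+* K) ∈
      invariantStratum m h (frob k K) A (fun a => (φ a).unbotD 0) ↔ χ ∈ genericPoints K F e :=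
    map_mem_invariantStratum_iff he' hΛ' hq hσ
  have hne := genericPoints_nonempty (K := K) (F := F) he he' hg
  let Ψ : 𝔸(ULift.{u} (pairs h A φ); Spec (.of K)) ≅
      Spec (.of (MvPolynomial (ULift.{u} (pairs h A φ)) K)) := AffineSpace.SpecIso _ _
  have hΨ : Ψ.inv ≫ (𝔸(ULift.{u} (pairs h A φ); Spec (.of K)) ↘ Spec (.of K)) =
      Spec.map (CommRingCat.ofHom (algebraMap K (MvPolynomial (ULift.{u} (pairs h A φ)) K))) :=
    AffineSpace.SpecIso_inv_over _
  let W : (Spec (.of (MvPolynomial (ULift.{u} (pairs h A φ)) K))).Opens := genericOpens K F e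
  rw [hS]
  refine ⟨⟨Ψ.hom ⁻¹ᵁ W, ⟨fun R _ _ x => Λ.map (pointHom Ψ W hΨ x : _ →+* R), ?_, ?_⟩, ?_, ⟨?_, ?_⟩,
    ?_⟩, F.isLocallyClosed hσ hσ', hfin, ?_⟩
  · intro R R' _ _ _ _ g x
    rw [pointHom_map, Gr.map_map]
    rfl
  · intro x
    exact (hmem _).2 ((toPrimeSpectrum_mem_genericOpens_iff he').1
      (toPrimeSpectrum_pointHom_mem hΨ x))
  · obtain ⟨χ, hχ⟩ := hne
    obtain ⟨x, hx⟩ := exists_pointHom_eq hΨ ((toPrimeSpectrum_mem_genericOpens_iff he').2 hχ)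
    -- the image of the unique point of `Spec K`
    let z : Spec (.of K) := (⟨⊥, Ideal.isPrime_bot⟩ : PrimeSpectrum K)
    exact ⟨_, (x.1 z).2⟩
  · intro x x' hxx'
    have h1 := congrArg Subtype.val hxx'
    refine pointHom_injective hΨ (map_injOn_genericPoints (F := F) he' hΛ' he hq hσ ?_ h1)
    exact (toPrimeSpectrum_mem_genericOpens_iff he').1 (toPrimeSpectrum_pointHom_mem hΨ x)
  · rintro ⟨M, hM⟩
    have h1 := map_parameterPoint he' hΛ' F he hq hσ hM
    obtain ⟨x, hx⟩ := exists_pointHom_eq hΨ ((toPrimeSpectrum_mem_genericOpens_iff he').2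
      ((hmem _).1 (h1.symm ▸ hM)))
    refine ⟨x, Subtype.ext ?_⟩
    refine Eq.trans ?_ h1
    exact congrArg (fun χ : MvPolynomial (ULift.{u} (pairs h A φ)) K →ₐ[K] K =>
      Λ.map (χ : MvPolynomial (ULift.{u} (pairs h A φ)) K →+* K)) hx
  · intro hc
    have h1 : W = ⊤ := genericOpens_eq_top fun χ => F.isGeneric_of_cyclic
      (fun a ha => hc.apply_add hA.normalized.toIsSemiModule hh ha) fun a b hab => by
        rw [universalParameter_of_not_isPair he' a b hab, map_zero]
    rw [h1]
    rfl
  · let := zariskiPoints K (MvPolynomial (ULift.{u} (pairs h A φ)) K)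
    have h1 := isHomeomorph_parametrization he' hΛ' he hq hσ hσ'
      (fun χ : genericPoints K F e => ⟨_, (hmem χ.1).2 χ.2⟩) fun _ => rfl
    have h2 := IsHomeomorph.topologicalKrullDim_eq _ h1
    rw [← h2, topologicalKrullDim_open (isOpen_genericPoints he') hne, Nat.card_ulift,
      Nat.card_coe_set_eq]
    rfl
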